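/- Let $Q(x)=\dfrac{2\sqrt2}{e^{x}+e^{-x}}$, $\phi(x_1,x_2,t)=e^{it}Q(x_1)$, $\phi_1=-Q(x_1)^2$, and set $P_r=\phi_1+|\phi|^2$, $\sqrt2\,\phi=F_r+iG_r$, $\sqrt2\,\nabla\phi=H_r+iL_r$. For real-valued functions $P,F,G$ and $\mathbb R^2$-valued functions $V,H,L$ on $\mathbb R^2\times[0,T]$ and a real number $\lambda$ put $\tilde P=P+P_r$, $\tilde F=F+F_r$, $\tilde G=G+G_r$, $\tilde H=H+H_r$, $\tilde L=L+L_r$ and consider, for $U=(P,V,F,G,H,L)^T$, the system $$\begin{aligned} &P_t+\lambda\nabla\cdot V+\tilde F\,\nabla\cdot L-\tilde G\,\nabla\cdot H+\mathcal R_1=0,\qquad V_t+\lambda\nabla P=0,\\ &F_t+\mathcal R_2=-\Delta G,\qquad G_t+\mathcal R_3=\Delta F,\\ &H_t-\tilde G\,\nabla P+\mathcal R_4=-\Delta L,\qquad L_t+\tilde F\,\nabla P+\mathcal R_5=\Delta H, \end{aligned}$$ where, with $d=F^2+G^2+2FF_r+2GG_r$ and $c=FH+GL+FH_r+F_rH+GL_r+G_rL$,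 $$\begin{aligned} \mathcal R_1&=F\,\nabla\cdot L_r-G\,\nabla\cdot H_r,\\ \mathcal R_2&=\tfrac12(\tilde F^2+\tilde G^2)G+\tfrac12 d\,G_r-\tilde PG-PG_r,\\ \mathcal R_3&=-\tfrac12(\tilde F^2+\tilde G^2)F-\tfrac12 d\,F_r+\tilde PF+PF_r,\\ \mathcal R_4&=\tfrac12(\tilde F^2+\tilde G^2)L+\tfrac12 d\,L_r+(\tilde F\tilde H+\tilde G\tilde L)G+c\,G_r-PL_r-P_rL-PL,\\ \mathcal R_5&=-\tfrac12(\tilde F^2+\tilde G^2)H-\tfrac12 d\,H_r-(\tilde F\tilde H+\tilde G\tilde L)F-c\,F_r+PH+P_rH+PH_r . \end{aligned}$$ It has the form of a dispersive perturbation of a symmetric hyperbolic system, $$U_t+\sum_{j=1}^2\bigl(A^j(U)+B^j(\phi)+\lambda C^j\bigr)U_{x_j}+\bigl(D^1(U)+D^2(\phi)\bigr)U=K\Delta U,\qquad(\ast)$$ with real $9\times9$ matrices, $A^j,B^j,C^j$ symmetric, $A^j(U)$ linear in $U$, $C^j$ constant, $K$ constant and antisymmetric, and $(D^1(U)+D^2(\phi))U=(\mathcal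 R_1,0,\mathcal R_2,\mathcal R_3,\mathcal R_4,\mathcal R_5)^T$ (here $D^2(\phi)$ does not depend on $U$, and $D^1(U)$ collects the entries of degree one and two in $U$, those of degree one having coefficients that may involve $\phi$). **Theorem.** Let $s>2$. There is a function $T:[0,\infty)\to(0,\infty)$ such that for every $\lambda\in\mathbb R$ and every real-valued $U_0\in(H^s(\mathbb R^2))^9$, with $T=T(\|U_0\|_{(H^s(\mathbb R^2))^9})$, the system $(\ast)$ has a unique (real-valued) solution $$U\in L^\infty\bigl([0,T],(H^s(\mathbb R^2))^9\bigr)\quad\text{with}\quad U(0)=U_0 .$$ Here the equation is understood in the sense of distributions, for the weakly continuous representative of $U$: writing $(\ast)$ as $U_t=N(t,U)$, for every $\eta\in C_c^\infty(\mathbb R^2)$ and every $t\in[0,T]$ one has $\langle U(t),\eta\rangle-\langle U_0,\eta\rangle=\int_0^t\langle N(\tau,U(\tau)),\eta\rangle\,d\tau$. -/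

import Mathlib

open MeasureTheory
open scoped ENNReal ContDiff FourierTransform Laplacian Matrix

noncomputable section

namespace PerturbedZakharov

/-- The plane `ℝ²` with its Euclidean structure; `x 0` and `x 1` are the coordinates `x₁`, `x₂`. -/
abbrev Plane : Type := EuclideanSpace ℝ (Fin 2)

/-- Real-valued square-integrable functions on the plane (modulo a.e. equality). -/
abbrev L2 : Type := Lp ℝ 2 (volume : Measure Plane)

/-- The unit vector in the direction `x_j`. -/
def e (j : Fin 2) : Plane := EuclideanSpace.single j 1

/-! ### Sobolev spaces -/

/-- A real `L²` function regarded as a complex one. -/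
def complexify (f : L2) : Lp ℂ 2 (volume : Measure Plane) := Complex.ofRealCLM.compLp f

/-- The norm of `(H^s(ℝ²))⁹`, `s ≥ 0`, with values in `[0, ∞]`; the space `(H^s)⁹` consists of the
elements of `(L²)⁹` of finite norm. The factor `2π` turns the frequency variable of Mathlib's
Fourier transform into the usual one, so this is `‖(1 - Δ)^{s/2} U‖_{L²}`. -/
def sobolevENorm (s : ℝ) (U : Fin 9 → L2) : ℝ≥0∞ :=
  (∑ i, ∫⁻ ξ : Plane, ENNReal.ofReal ((1 + (2 * Real.pi * ‖ξ‖) ^ 2) ^ s) *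
    ‖(𝓕 (complexify (U i)) : Lp ℂ 2 (volume : Measure Plane)) ξ‖ₑ ^ 2) ^ (1 / 2 : ℝ)

/-- Test functions: smooth with compact support. -/
def IsTest (η : Plane → ℝ) : Prop := ContDiff ℝ ∞ η ∧ HasCompactSupport η

/-- `g` is the weak derivative `∂f/∂x_j`. -/
def IsWeakDeriv (j : Fin 2) (f g : L2) : Prop :=
  ∀ η : Plane → ℝ, IsTest η → ∫ x, f x * fderiv ℝ η x (e j) = - ∫ x, g x * η x

open Classical in
/-- The weak derivative `∂f/∂x_j`, if it exists as an `L²` function (it does when `f ∈ H¹`). -/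
def weakDeriv (j : Fin 2) (f : L2) : L2 :=
  if h : ∃ g, IsWeakDeriv j f g then h.choose else 0

/-! ### The line soliton -/

/-- The ground state `Q(x) = 2√2 / (e^x + e^{-x})`. -/
def Q (x : ℝ) : ℝ := 2 * √2 / (Real.exp x + Real.exp (-x))

/-- The line soliton `φ(x₁, x₂, t) = e^{it} Q(x₁)`. -/
def phi (t : ℝ) (x : Plane) : ℂ := Complex.exp (Complex.I * t) * (Q (x 0) : ℂ)

/-- Its companion `φ₁ = -Q²`. -/
def phi₁ (x : Plane) : ℝ := -(Q (x 0)) ^ 2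

/-- `P_r = φ₁ + |φ|²` (which in fact vanishes). -/
def Pr (t : ℝ) (x : Plane) : ℝ := phi₁ x + ‖phi t x‖ ^ 2

/-- `√2 φ = F_r + i G_r`. -/
def Fr (t : ℝ) (x : Plane) : ℝ := √2 * (phi t x).re

/-- `√2 φ = F_r + i G_r`. -/
def Gr (t : ℝ) (x : Plane) : ℝ := √2 * (phi t x).im

/-- `√2 ∇φ = H_r + i L_r`. -/
def Hr (j : Fin 2) (t : ℝ) (x : Plane) : ℝ := √2 * (fderiv ℝ (phi t) x (e j)).re

/-- `√2 ∇φ = H_r + i L_r`. -/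
def Lr (j : Fin 2) (t : ℝ) (x : Plane) : ℝ := √2 * (fderiv ℝ (phi t) x (e j)).im

/-- `∇ · H_r`. -/
def divHr (t : ℝ) (x : Plane) : ℝ := ∑ j, fderiv ℝ (Hr j t) x (e j)

/-- `∇ · L_r`. -/
def divLr (t : ℝ) (x : Plane) : ℝ := ∑ j, fderiv ℝ (Lr j t) x (e j)

/-- The values of the quantities attached to the line soliton at one point `(x, t)`. -/
structure Background where
  P : ℝ
  F : ℝ
  G : ℝ
  H : Fin 2 → ℝ
  L : Fin 2 → ℝ
  divH : ℝ
  divL : ℝ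

/-- The line soliton at `(x, t)`. -/
def soliton (t : ℝ) (x : Plane) : Background where
  P := Pr t x
  F := Fr t x
  G := Gr t x
  H := fun j => Hr j t x
  L := fun j => Lr j t x
  divH := divHr t x
  divL := divLr t x

/-! ### The matrices of the system

The nine components of `U = (P, V₁, V₂, F, G, H₁, H₂, L₁, L₂)` carry the indices `0, …, 8`. -/

/-- The matrix `A^j` with entries `f`, `-g` coupling `P` with `L_j`, `H_j`. -/
def coupling (j : Fin 2) (f g : ℝ) : Matrix (Fin 9) (Fin 9) ℝ :=
  ![!![ 0, 0, 0, 0, 0, -g, 0, f, 0;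
        0, 0, 0, 0, 0,  0, 0, 0, 0;
        0, 0, 0, 0, 0,  0, 0, 0, 0;
        0, 0, 0, 0, 0,  0, 0, 0, 0;
        0, 0, 0, 0, 0,  0, 0, 0, 0;
       -g, 0, 0, 0, 0,  0, 0, 0, 0;
        0, 0, 0, 0, 0,  0, 0, 0, 0;
        f, 0, 0, 0, 0,  0, 0, 0, 0;
        0, 0, 0, 0, 0,  0, 0, 0, 0],
    !![ 0, 0, 0, 0, 0, 0, -g, 0, f;
        0, 0, 0, 0, 0, 0,  0, 0, 0;
        0, 0, 0, 0, 0, 0,  0, 0, 0;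
        0, 0, 0, 0, 0, 0,  0, 0, 0;
        0, 0, 0, 0, 0, 0,  0, 0, 0;
        0, 0, 0, 0, 0, 0,  0, 0, 0;
       -g, 0, 0, 0, 0, 0,  0, 0, 0;
        0, 0, 0, 0, 0, 0,  0, 0, 0;
        f, 0, 0, 0, 0, 0,  0, 0, 0]] j

/-- `A^j(U)`. -/
def A (j : Fin 2) (u : Fin 9 → ℝ) : Matrix (Fin 9) (Fin 9) ℝ := coupling j (u 3) (u 4)

/-- `B^j(φ)`. -/
def B (j : Fin 2) (b : Background) : Matrix (Fin 9) (Fin 9) ℝ := coupling j b.F b.G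

/-- `C^j`: the coupling of `P` with `V_j`. -/
def C (j : Fin 2) : Matrix (Fin 9) (Fin 9) ℝ :=
  ![!![0, 1, 0, 0, 0, 0, 0, 0, 0;
       1, 0, 0, 0, 0, 0, 0, 0, 0;
       0, 0, 0, 0, 0, 0, 0, 0, 0;
       0, 0, 0, 0, 0, 0, 0, 0, 0;
       0, 0, 0, 0, 0, 0, 0, 0, 0;
       0, 0, 0, 0, 0, 0, 0, 0, 0;
       0, 0, 0, 0, 0, 0, 0, 0, 0;
       0, 0, 0, 0, 0, 0, 0, 0, 0;
       0, 0, 0, 0, 0, 0, 0, 0, 0],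
    !![0, 0, 1, 0, 0, 0, 0, 0, 0;
       0, 0, 0, 0, 0, 0, 0, 0, 0;
       1, 0, 0, 0, 0, 0, 0, 0, 0;
       0, 0, 0, 0, 0, 0, 0, 0, 0;
       0, 0, 0, 0, 0, 0, 0, 0, 0;
       0, 0, 0, 0, 0, 0, 0, 0, 0;
       0, 0, 0, 0, 0, 0, 0, 0, 0;
       0, 0, 0, 0, 0, 0, 0, 0, 0;
       0, 0, 0, 0, 0, 0, 0, 0, 0]] j

/-- The antisymmetric matrix `K` of the dispersive part:
`F_t = -ΔG + …`, `G_t = ΔF + …`, `H_t = -ΔL + …`, `L_t = ΔH + …`. -/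
def K : Matrix (Fin 9) (Fin 9) ℝ :=
  !![0, 0, 0, 0,  0, 0, 0,  0,  0;
     0, 0, 0, 0,  0, 0, 0,  0,  0;
     0, 0, 0, 0,  0, 0, 0,  0,  0;
     0, 0, 0, 0, -1, 0, 0,  0,  0;
     0, 0, 0, 1,  0, 0, 0,  0,  0;
     0, 0, 0, 0,  0, 0, 0, -1,  0;
     0, 0, 0, 0,  0, 0, 0,  0, -1;
     0, 0, 0, 0,  0, 1, 0,  0,  0;
     0, 0, 0, 0,  0, 0, 1,  0,  0]

/-- The part of the zeroth-order matrix that depends on the line soliton only. -/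
def D2 (b : Background) : Matrix (Fin 9) (Fin 9) ℝ :=
  let ρ := (b.F ^ 2 + b.G ^ 2) / 2
  let τ := fun j => b.F * b.H j + b.G * b.L j
  let p := ρ + b.G ^ 2 - b.P
  let q := ρ + b.F ^ 2 - b.P
  let m := b.F * b.G
  let hf := fun j => b.F * b.L j + b.G * b.H j
  let hg := fun j => 2 * (b.G * b.L j) + τ j
  let lf := fun j => -(2 * (b.F * b.H j) + τ j)
  let lg := fun j => -(b.G * b.H j + b.F * b.L j)
  !![       0, 0, 0, b.divL, -b.divH,  0,  0,  0,  0;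
            0, 0, 0,      0,       0,  0,  0,  0,  0;
            0, 0, 0,      0,       0,  0,  0,  0,  0;
         -b.G, 0, 0,      m,       p,  0,  0,  0,  0;
          b.F, 0, 0,     -q,      -m,  0,  0,  0,  0;
     -(b.L 0), 0, 0,   hf 0,    hg 0,  m,  0,  p,  0;
     -(b.L 1), 0, 0,   hf 1,    hg 1,  0,  m,  0,  p;
        b.H 0, 0, 0,   lf 0,    lg 0, -q,  0, -m,  0;
        b.H 1, 0, 0,   lf 1,    lg 1,  0, -q,  0, -m]

/-- The part of the zeroth-order matrix that vanishes at `U = 0`. Its entries are polynomials of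
degree one and two in `U`; the terms of degree one have coefficients from the line soliton. -/
def D1 (b : Background) (u : Fin 9 → ℝ) : Matrix (Fin 9) (Fin 9) ℝ :=
  let P := u 0
  let F := u 3
  let G := u 4
  let H := ![u 5, u 6]
  let L := ![u 7, u 8]
  let r := (F ^ 2 + G ^ 2) / 2 + F * b.F + G * b.G - P
  let p := r + G * b.G
  let q := r + F * b.F
  let c := fun j => F * H j + G * L j + F * b.H j + b.F * H j + G * b.L j + b.G * L j
  let hf := fun j => F * b.L j / 2
  let hg := fun j => G * b.L j / 2 + c j
  let lf := fun j => -(F * b.H j / 2 + c j)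
  let lg := fun j => -(G * b.H j / 2)
  !![0, 0, 0,                0,               0,       0,       0,       0,       0;
     0, 0, 0,                0,               0,       0,       0,       0,       0;
     0, 0, 0,                0,               0,       0,       0,       0,       0;
     0, 0, 0,      F * b.G / 2, r + G * b.G / 2,       0,       0,       0,       0;
     0, 0, 0, -r - F * b.F / 2,  -(G * b.F / 2),       0,       0,       0,       0;
     0, 0, 0,             hf 0,            hg 0, F * b.G,       0,       p,       0;
     0, 0, 0,             hf 1,            hg 1,       0, F * b.G,       0,       p;
     0, 0, 0,             lf 0,            lg 0,      -q,       0, -(G * b.F),    0;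
     0, 0, 0,             lf 1,            lg 1,       0,      -q,       0, -(G * b.F)]

/-- The zeroth-order terms `(R₁, 0, 0, R₂, R₃, R₄, R₅)` which remain when the equations of the line
soliton are subtracted from those of the perturbed wave. -/
def residual (b : Background) (u : Fin 9 → ℝ) : Fin 9 → ℝ :=
  let P := u 0
  let F := u 3
  let G := u 4
  let H := ![u 5, u 6]
  let L := ![u 7, u 8]
  let Pt := P + b.P
  let Ft := F + b.F
  let Gt := G + b.G
  let Ht := fun j => H j + b.H j
  let Lt := fun j => L j + b.L j
  let d := F ^ 2 + G ^ 2 + 2 * F * b.F + 2 * G * b.G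
  let c := fun j => F * H j + G * L j + F * b.H j + b.F * H j + G * b.L j + b.G * L j
  let R₁ := F * b.divL - G * b.divH
  let R₂ := 1 / 2 * (Ft ^ 2 + Gt ^ 2) * G + 1 / 2 * d * b.G - Pt * G - P * b.G
  let R₃ := -(1 / 2) * (Ft ^ 2 + Gt ^ 2) * F - 1 / 2 * d * b.F + Pt * F + P * b.F
  let R₄ := fun j => 1 / 2 * (Ft ^ 2 + Gt ^ 2) * L j + 1 / 2 * d * b.L j
    + (Ft * Ht j + Gt * Lt j) * G + c j * b.G - P * b.L j - b.P * L j - P * L j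
  let R₅ := fun j => -(1 / 2) * (Ft ^ 2 + Gt ^ 2) * H j - 1 / 2 * d * b.H j
    - (Ft * Ht j + Gt * Lt j) * F - c j * b.F + P * H j + b.P * H j + P * b.H j
  ![R₁, 0, 0, R₂, R₃, R₄ 0, R₄ 1, R₅ 0, R₅ 1]

/-- The zeroth-order matrices reproduce the residual terms. -/
theorem zeroth_order_eq_residual (b : Background) (u : Fin 9 → ℝ) :
    (D1 b u + D2 b) *ᵥ u = residual b u := by
  ext i
  fin_cases i <;>
    simp [D1, D2, residual, Matrix.mulVec, dotProduct, Fin.sum_univ_succ] <;> ring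

theorem A_symm (j : Fin 2) (u : Fin 9 → ℝ) : (A j u)ᵀ = A j u := by
  fin_cases j <;> ext i k <;> fin_cases i <;> fin_cases k <;> simp [A, coupling]

theorem B_symm (j : Fin 2) (b : Background) : (B j b)ᵀ = B j b := by
  fin_cases j <;> ext i k <;> fin_cases i <;> fin_cases k <;> simp [B, coupling]

theorem C_symm (j : Fin 2) : (C j)ᵀ = C j := by
  fin_cases j <;> ext i k <;> fin_cases i <;> fin_cases k <;> simp [C]

theorem K_antisymm : Kᵀ = -K := by
  ext i k; fin_cases i <;> fin_cases k <;> simp [K]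

/-! ### Solutions -/

/-- The values at `x` of (the representatives of) nine functions. -/
def val (W : Fin 9 → L2) (x : Plane) : Fin 9 → ℝ := fun k => W k x

/-- The terms of order one and zero,
`∑_j (A^j(W) + B^j(φ) + λ C^j) ∂_j W + (D¹(W) + D²(φ)) W`, at the point `(x, t)`. -/
def lowerOrder (lam : ℝ) (W : Fin 9 → L2) (t : ℝ) (x : Plane) : Fin 9 → ℝ :=
  (∑ j, (A j (val W x) + B j (soliton t x) + lam • C j) *ᵥ val (fun k => weakDeriv j (W k)) x)
    + (D1 (soliton t x) (val W x) + D2 (soliton t x)) *ᵥ val W x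

/-- The `i`-th component of
`K Δ W - ∑_j (A^j(W) + B^j(φ) + λ C^j) ∂_j W - (D¹(W) + D²(φ)) W` at time `t`, as a distribution
on the plane, applied to the test function `η`. -/
def weakRHS (lam : ℝ) (W : Fin 9 → L2) (t : ℝ) (η : Plane → ℝ) (i : Fin 9) : ℝ :=
  (∫ x, (K *ᵥ val W x) i * Δ η x) - ∫ x, lowerOrder lam W t x i * η x

/-- `U ∈ L^∞([0,T], (H^s)⁹)` solves
`U_t + ∑_j (A^j(U) + B^j(φ) + λ C^j) U_{x_j} + (D¹(U) + D²(φ)) U = K Δ U` in the sense of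
distributions, with `U(0) = U₀`. The path `U` is the weakly continuous representative of its class,
so that its value at every time, in particular at time `0`, has a meaning.

For `s > 2` the integrability in the last field is automatic. -/
structure IsSolution (s lam T : ℝ) (U₀ : Fin 9 → L2) (U : ℝ → Fin 9 → L2) : Prop where
  aestronglyMeasurable : AEStronglyMeasurable U (volume.restrict (Set.Icc 0 T))
  bounded : essSup (fun t => sobolevENorm s (U t)) (volume.restrict (Set.Icc 0 T)) < ⊤
  initial : U 0 = U₀
  equation : ∀ η : Plane → ℝ, IsTest η → ∀ i : Fin 9,
    IntegrableOn (fun τ => weakRHS lam (U τ) τ η i) (Set.Icc 0 T) ∧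
    ∀ t ∈ Set.Icc 0 T,
      (∫ x, U t i x * η x) - ∫ x, U₀ i x * η x = ∫ τ in (0 : ℝ)..t, weakRHS lam (U τ) τ η i

end PerturbedZakharov

end

/-!
The solution is constructed by a Galerkin method with energy estimates, and uniqueness follows
from the same kind of estimate in `L²`.

*Coordinates.* A function `U` in `H^s` is written as `U = ⟨D⟩^{-s} V` with `V` in `L²` and
`‖U‖_{H^s} = ‖V‖` (`bessel`, `sob`, `sobolevENorm_bessel`). As `s > 2`, the weight `⟨ξ⟩^{1-s}` is
square integrable on the plane, so `U` and its first derivatives are bounded and have integrable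
Fourier transforms; this one fact carries all the estimates.

*The energy estimate.* For a solution, `½ d/dt ‖V‖²` is the sum of three contributions. The
dispersive term `K Δ U` contributes nothing because `K` is antisymmetric (`sum_inner_dispersion`).
In the first-order terms the matrices are symmetric (`sum_firstOrder_mul`), hence every
coefficient `a` occurs in a combination `a (∂_j U_k · ⟨D⟩^s V_l + ∂_j U_l · ⟨D⟩^s V_k)`. On the
Fourier side such a combination is a trilinear form whose symbol is a difference, which is small
when `a` has low frequency: the derivative falls on `a` (`symbol_bound`,
`IsCoef.abs_integral_symm_le`). For the constant coefficients `λ C^j` it vanishes altogether, so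
that the estimate does not depend on `λ`. The terms of order zero are estimated by the product
inequality in `H^s` (`IsCoef.exists_mul_bessel`, `exists_residual_bessel`). The outcome is
`exists_energy_bound`.

The coefficients are of two kinds: components of `U`, which are in `H^s`, and components of the
line soliton, which depend on `x₁` only and are not square integrable. Both are superpositions `∫
α(ζ) e^{2πi ζ·x} dν(ζ)` of plane waves, with `ν` the area or the length on a line, and the notion
`IsCoef` collects what the estimates need from such a superposition. It holds for the soliton
since the derivatives of `Q` are Schwartz functions.

*Existence.* Cutting off the frequencies `⟨ξ⟩ > n + 1` turns the system into an ordinary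
differential equation in `L²` with a locally Lipschitz right-hand side (`field`). The cut-off
commutes with all the multipliers, so the energy estimate holds uniformly in `n` and bounds the
truncated solutions in `H^s` on a time interval that depends on the size of the data alone
(`exists_truncated_solution`). The energy estimate for differences in `L²`
(`exists_difference_bound`) makes the truncated solutions a Cauchy sequence in `L²`, uniformly in
time (`exists_cauchy_bound`). By interpolation with the bound in `H^s` their first derivatives
converge too (`firstNorm_le_sqrt`), which is enough to pass to the limit in the nonlinear terms
(`exists_isSolution_of_truncated`).

*Uniqueness.* The difference of two solutions is a Lipschitz path in `L²` that satisfies the `L²`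
energy inequality, and vanishes by Grönwall's lemma (`eq_zero_of_weak_energy`).
-/

open MeasureTheory
open scoped ENNReal ContDiff FourierTransform Laplacian Matrix
open scoped ComplexConjugate Polynomial
open Filter Topology

noncomputable section

namespace PerturbedZakharov

/-! ### The Fourier transform of square-integrable functions -/

/-- Complex-valued square-integrable functions on the plane. -/
abbrev CL2 : Type := Lp ℂ 2 (volume : Measure Plane)

/-- The plane wave `e^{2πi ζ·x}`. -/
def planeWave (ζ x : Plane) : ℂ := (Real.fourierChar (inner ℝ ζ x) : ℂ)

theorem norm_planeWave (ζ x : Plane) : ‖planeWave ζ x‖ = 1 := Circle.norm_coe _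

theorem enorm_planeWave (ζ x : Plane) : ‖planeWave ζ x‖ₑ = 1 := by
  rw [← ofReal_norm, norm_planeWave, ENNReal.ofReal_one]

/-- The Fourier transform of a square-integrable function, tested against a Schwartz function. -/
theorem integral_fourier_mul (g : CL2) (ψ : SchwartzMap Plane ℂ) :
    ∫ x, ψ x * (𝓕 g : CL2) x = ∫ x, (𝓕 ψ) x * g x := by
  have h := Lp.fourier_toTemperedDistribution_eq g
  have h2 := congrArg (fun T => T ψ) h
  simp only [TemperedDistribution.fourier_apply] at h2
  rw [Lp.toTemperedDistribution_apply, Lp.toTemperedDistribution_apply] at h2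
  simpa using h2.symm

/-- A real test function as a complex Schwartz function. -/
def IsTest.toSchwartz {η : Plane → ℝ} (h : IsTest η) : SchwartzMap Plane ℂ :=
  HasCompactSupport.toSchwartzMap (f := fun x => (η x : ℂ))
    (h.2.comp_left (g := Complex.ofReal) Complex.ofReal_zero)
    (Complex.ofRealCLM.contDiff.comp h.1)

theorem IsTest.toSchwartz_apply {η : Plane → ℝ} (h : IsTest η) (x : Plane) :
    h.toSchwartz x = (η x : ℂ) := rfl

theorem ae_eq_of_test {F G : Plane → ℂ} (hF : LocallyIntegrable F) (hG : LocallyIntegrable G)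
    (h : ∀ η : Plane → ℝ, IsTest η → ∫ x, (η x : ℂ) * F x = ∫ x, (η x : ℂ) * G x) :
        F =ᵐ[volume] G :=
  ae_eq_of_integral_contDiff_smul_eq hF hG fun g h1 h2 => by
    simpa [Complex.real_smul] using h g ⟨h1, h2⟩

theorem locallyIntegrable_L2 (g : CL2) : LocallyIntegrable g :=
  (Lp.memLp g).locallyIntegrable (by norm_num)

theorem memLp_neg {F : Plane → ℂ} {p : ℝ≥0∞} (hF : MemLp F p) : MemLp (fun ξ => F (-ξ)) p :=
  hF.comp_measurePreserving (Measure.measurePreserving_neg volume)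

theorem memLp_conj {F : Plane → ℂ} {p : ℝ≥0∞} (hF : MemLp F p) : MemLp (fun ξ => conj (F ξ)) p :=
  hF.star

theorem IsTest.neg {η : Plane → ℝ} (h : IsTest η) : IsTest (fun x => η (-x)) :=
  ⟨h.1.comp contDiff_neg, h.2.comp_homeomorph (Homeomorph.neg Plane)⟩

theorem IsTest.translate {η : Plane → ℝ} (h : IsTest η) (ζ : Plane) : IsTest (fun x => η (x + ζ)) :=
  ⟨h.1.comp (contDiff_id.add contDiff_const), h.2.comp_homeomorph (Homeomorph.addRight ζ)⟩

theorem IsTest.fourier_neg {η : Plane → ℝ} (h : IsTest η) (ξ : Plane) :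
    (𝓕 h.neg.toSchwartz) ξ = conj ((𝓕 h.toSchwartz) ξ) := by
  simp only [SchwartzMap.fourier_coe, Real.fourier_eq]
  rw [← integral_conj, ← integral_neg_eq_self]
  congr 1; ext v
  simp [IsTest.toSchwartz_apply, Circle.smul_def, AddChar.map_neg_eq_inv]

theorem IsTest.fourier_translate {η : Plane → ℝ} (h : IsTest η) (ζ ξ : Plane) :
    (𝓕 (h.translate ζ).toSchwartz) ξ
      = planeWave ζ ξ * (𝓕 h.toSchwartz) ξ := by
  simp only [SchwartzMap.fourier_coe, Real.fourier_eq]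
  rw [← integral_const_mul, ← integral_add_right_eq_self (μ := volume) _ (-ζ)]
  congr 1; ext v
  simp [planeWave, IsTest.toSchwartz_apply, Circle.smul_def, inner_add_left, inner_neg_left,
      AddChar.map_add_eq_mul,
    ← mul_assoc]

/-- Conjugation in space is conjugation followed by reflection in frequency. -/
theorem fourier_of_conj {g h : CL2} (hgh : h =ᵐ[volume] fun x => conj (g x)) :
    (𝓕 h : CL2) =ᵐ[volume] fun ξ => conj ((𝓕 g : CL2) (-ξ)) := by
  refine ae_eq_of_test (locallyIntegrable_L2 _) ?_ fun η hη => ?_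
  · exact (memLp_conj (memLp_neg (Lp.memLp (𝓕 g : CL2)))).locallyIntegrable (by norm_num)
  calc ∫ x, (η x : ℂ) * (𝓕 h : CL2) x = ∫ x, (𝓕 hη.toSchwartz : SchwartzMap Plane ℂ) x * h x :=
        integral_fourier_mul (g := h) (ψ := hη.toSchwartz)
    _ = ∫ x, conj ((𝓕 hη.neg.toSchwartz) x * g x) := by
        refine integral_congr_ae ?_
        filter_upwards [hgh] with x hx
        simp [hx, hη.fourier_neg]
    _ = conj (∫ x, hη.neg.toSchwartz x * (𝓕 g : CL2) x) := by
        rw [integral_conj, integral_fourier_mul]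
    _ = _ := by
        rw [← integral_conj, ← integral_neg_eq_self]
        congr 1; ext x
        simp [IsTest.toSchwartz_apply]

/-- Modulation in space is translation in frequency. -/
theorem fourier_of_modulate {g h : CL2} (ζ : Plane)
    (hgh : h =ᵐ[volume] fun x => planeWave ζ x * g x) :
    (𝓕 h : CL2) =ᵐ[volume] fun ξ => (𝓕 g : CL2) (ξ - ζ) := by
  refine ae_eq_of_test (locallyIntegrable_L2 _) ?_ fun η hη => ?_
  · exact ((Lp.memLp (𝓕 g : CL2)).comp_measurePreserving
      (measurePreserving_sub_right volume ζ)).locallyIntegrable (by norm_num)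
  calc ∫ x, (η x : ℂ) * (𝓕 h : CL2) x = ∫ x, (𝓕 hη.toSchwartz : SchwartzMap Plane ℂ) x * h x :=
        integral_fourier_mul (g := h) (ψ := hη.toSchwartz)
    _ = ∫ x, (𝓕 (hη.translate ζ).toSchwartz) x * g x := by
        refine integral_congr_ae ?_
        filter_upwards [hgh] with x hx
        simp only [hx, hη.fourier_translate]; ring
    _ = ∫ x, (hη.translate ζ).toSchwartz x * (𝓕 g : CL2) x := by
        rw [integral_fourier_mul]
    _ = _ := by
        rw [← integral_sub_right_eq_self (μ := volume) _ ζ]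
        simp [IsTest.toSchwartz_apply]

/-- Fourier inversion for square-integrable functions with integrable Fourier transform. -/
theorem eq_integral_of_integrable_fourier (g : CL2) (hg : Integrable (𝓕 g : CL2)) :
    g =ᵐ[volume] fun x => ∫ ζ, (𝓕 g : CL2) ζ * planeWave ζ x := by
  have e1 : (fun x => ∫ ζ, (𝓕 g : CL2) ζ * planeWave ζ x)
      = 𝓕⁻ ((𝓕 g : CL2) : Plane → ℂ) := by
    ext x
    rw [Real.fourierInv_eq]
    congr 1; ext v; simp [planeWave, Circle.smul_def, mul_comm]
  rw [e1]
  have hc : Continuous (𝓕⁻ ((𝓕 g : CL2) : Plane → ℂ)) := by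
    rw [Real.fourierInv_eq_fourier_comp_neg]
    exact VectorFourier.fourierIntegral_continuous Real.continuous_fourierChar
      (L := innerₗ Plane) continuous_inner (by simpa using hg.comp_neg)
  refine ae_eq_of_test (locallyIntegrable_L2 _) hc.locallyIntegrable fun η hη => ?_
  have h1 := integral_fourier_mul g (𝓕⁻ hη.toSchwartz)
  rw [FourierTransform.fourier_fourierInv_eq] at h1
  have h2 : ∫ x, (η x : ℂ) * g x = ∫ x, hη.toSchwartz x * g x := rfl
  rw [h2, ← h1]
  have h3 : ∫ x, (𝓕⁻ (hη.toSchwartz : Plane → ℂ)) x * (𝓕 g : CL2) x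
      = ∫ x, hη.toSchwartz x * (𝓕⁻ ((𝓕 g : CL2) : Plane → ℂ)) x := by
    have hL : Continuous fun p : Plane × Plane => (-innerₗ Plane) p.1 p.2 :=
      (continuous_inner (𝕜 := ℝ) (E := Plane)).neg
    have h4 := VectorFourier.integral_fourierIntegral_smul_eq_flip (μ := volume) (ν := volume)
      (e := Real.fourierChar) (L := -innerₗ Plane) (f := (hη.toSchwartz : Plane → ℂ))
      (g := ((𝓕 g : CL2) : Plane → ℂ)) Real.continuous_fourierChar hL hη.toSchwartz.integrable hg
    have h5 : (-innerₗ Plane).flip = -innerₗ Plane := by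
      ext x y; simp [real_inner_comm]
    rw [h5] at h4
    exact h4
  rw [← SchwartzMap.fourierInv_coe] at h3
  exact h3

/-! ### Fourier multipliers on real square-integrable functions -/

theorem coeFn_complexify (f : L2) : complexify f =ᵐ[volume] fun x => (f x : ℂ) :=
  ContinuousLinearMap.coeFn_compLp _ f

/-- The Fourier transform of a real square-integrable function. -/
def hat (f : L2) : CL2 := 𝓕 (complexify f)

theorem complexify_add (f g : L2) : complexify (f + g) = complexify f + complexify g :=
  (Complex.ofRealCLM.compLpL 2 (volume : Measure Plane)).map_add f g

theorem complexify_smul (c : ℝ) (f : L2) : complexify (c • f) = (c : ℂ) • complexify f := by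
  apply Lp.ext
  filter_upwards [coeFn_complexify (c • f), coeFn_complexify f, Lp.coeFn_smul c f,
    Lp.coeFn_smul (c : ℂ) (complexify f)] with x h1 h2 h3 h4
  rw [h4, h1, h3, Pi.smul_apply, Pi.smul_apply, h2]
  simp

theorem hat_add (f g : L2) : hat (f + g) = hat f + hat g := by
  simp only [hat, complexify_add]; exact FourierTransform.fourier_add _ _

theorem hat_smul (c : ℝ) (f : L2) : hat (c • f) = (c : ℂ) • hat f := by
  simp only [hat, complexify_smul]; exact FourierTransform.fourier_smul _ _

theorem coeFn_hat_add (f g : L2) : hat (f + g) =ᵐ[volume] fun ξ => hat f ξ + hat g ξ := by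
  rw [hat_add]; exact Lp.coeFn_add _ _

theorem coeFn_hat_smul (c : ℝ) (f : L2) : hat (c • f) =ᵐ[volume] fun ξ => (c : ℂ) * hat f ξ := by
  rw [hat_smul]; exact Lp.coeFn_smul _ _

theorem coeFn_hat_sub (f g : L2) : hat (f - g) =ᵐ[volume] fun ξ => hat f ξ - hat g ξ := by
  have h : f - g = f + (-1 : ℝ) • g := by rw [neg_one_smul, sub_eq_add_neg]
  rw [h]
  filter_upwards [coeFn_hat_add f ((-1 : ℝ) • g), coeFn_hat_smul (-1) g] with ξ h1 h2
  rw [h1, h2]; push_cast; ring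

theorem norm_complexify (f : L2) : ‖complexify f‖ = ‖f‖ := by
  rw [Lp.norm_def, Lp.norm_def]
  congr 1
  apply eLpNorm_congr_norm_ae
  filter_upwards [coeFn_complexify f] with x hx
  simp [hx]

theorem norm_hat (f : L2) : ‖hat f‖ = ‖f‖ := by
  rw [hat, Lp.norm_fourier_eq, norm_complexify]

theorem hat_injective : Function.Injective hat := by
  intro f g h
  have : complexify f = complexify g := (Lp.fourierTransformₗᵢ Plane ℂ).injective h
  apply Lp.ext
  filter_upwards [coeFn_complexify f, coeFn_complexify g] with x h1 h2
  rw [this, h2] at h1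
  exact_mod_cast h1.symm

theorem eq_of_hat {f g : L2} (h : hat f =ᵐ[volume] hat g) : f = g :=
  hat_injective (Lp.ext h)

/-- Parseval's identity. -/
theorem integral_mul_eq_hat (f g : L2) :
    ((∫ x, f x * g x : ℝ) : ℂ) = ∫ ξ, hat f ξ * conj (hat g ξ) := by
  have h := Lp.inner_fourier_eq (complexify g) (complexify f)
  rw [L2.inner_def, L2.inner_def] at h
  rw [← integral_complex_ofReal]
  calc ∫ x, ((f x * g x : ℝ) : ℂ) = ∫ x, inner ℂ (complexify g x) (complexify f x) := by
        refine integral_congr_ae ?_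
        filter_upwards [coeFn_complexify f, coeFn_complexify g] with x h1 h2
        simp [h1, h2]
    _ = ∫ ξ, hat f ξ * conj (hat g ξ) := by
        rw [← h]; rfl

theorem inner_eq_integral (f g : L2) : inner ℝ f g = ∫ x, f x * g x := by
  rw [L2.inner_def]
  congr 1; ext x; simp [mul_comm]

theorem integrable_mul_L2 (f g : L2) : Integrable (fun x => f x * g x) :=
  (Lp.memLp f).integrable_mul (Lp.memLp g)

/-- The Fourier transform of a real function is hermitian. -/
theorem hat_neg (f : L2) : ∀ᵐ ξ : Plane, hat f (-ξ) = conj (hat f ξ) := by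
  have h : complexify f =ᵐ[volume] fun x => conj (complexify f x) := by
    filter_upwards [coeFn_complexify f] with x hx
    simp [hx]
  filter_upwards [fourier_of_conj h] with ξ hξ
  have : hat f ξ = conj (hat f (-ξ)) := hξ
  rw [this, Complex.conj_conj]

/-- Every hermitian square-integrable function is the Fourier transform of a real function. -/
theorem exists_hat_eq {F : Plane → ℂ} (hF : MemLp F 2) (hherm : ∀ᵐ ξ : Plane, F (-ξ) = conj (F ξ)) :
    ∃ g : L2, hat g =ᵐ[volume] F := by
  set G : CL2 := hF.toLp F
  set g : CL2 := 𝓕⁻ G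
  have hg : 𝓕 g = G := FourierTransform.fourier_fourierInv_eq G
  set h : CL2 := (memLp_conj (Lp.memLp g)).toLp _
  have hh : h =ᵐ[volume] fun x => conj (g x) := MemLp.coeFn_toLp _
  have e : h = g := by
    apply (Lp.fourierTransformₗᵢ Plane ℂ).injective
    apply Lp.ext
    have h1 := fourier_of_conj hh
    rw [hg] at h1
    have h2 : G =ᵐ[volume] F := MemLp.coeFn_toLp _
    have h3 : ∀ᵐ ξ : Plane, G (-ξ) = F (-ξ) :=
      (Measure.measurePreserving_neg (volume : Measure Plane)).quasiMeasurePreserving.ae h2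
    have h4 : (𝓕 h : CL2) =ᵐ[volume] (𝓕 g : CL2) := by
      rw [hg]
      filter_upwards [h1, h2, h3, hherm] with ξ a1 a2 a3 a4
      rw [a1, a3, a4, a2, Complex.conj_conj]
    exact h4
  rw [e] at hh
  -- `g` is its own conjugate, hence its real part.
  have hre : MemLp (fun x => (g x).re) 2 := (Lp.memLp g).re
  refine ⟨hre.toLp _, ?_⟩
  have : complexify (hre.toLp _) = g := by
    apply Lp.ext
    filter_upwards [coeFn_complexify (hre.toLp _), hre.coeFn_toLp, hh] with x h1 h2 h3
    rw [h1, h2]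
    exact Complex.conj_eq_iff_re.mp h3.symm
  rw [hat, this, hg]
  exact MemLp.coeFn_toLp _

/-- A symbol of a bounded Fourier multiplier that maps real functions to real functions. -/
structure Multiplier where
  /-- The symbol, as a function of the frequency. -/
  symbol : Plane → ℂ
  measurable : Measurable symbol
  hermitian : ∀ ξ, symbol (-ξ) = conj (symbol ξ)
  bounded : ∃ C : ℝ, ∀ ξ, ‖symbol ξ‖ ≤ C

theorem Multiplier.exists_apply (m : Multiplier) (f : L2) :
    ∃ g : L2, hat g =ᵐ[volume] fun ξ => m.symbol ξ * hat f ξ := by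
  obtain ⟨C, hC⟩ := m.bounded
  apply exists_hat_eq
  · exact MemLp.of_le_mul (c := C) (Lp.memLp (hat f))
      (m.measurable.aestronglyMeasurable.mul (Lp.aestronglyMeasurable _))
      (Eventually.of_forall fun ξ => by rw [norm_mul]; gcongr; exact hC ξ)
  · filter_upwards [hat_neg f] with ξ h
    rw [h, m.hermitian, map_mul]

theorem Multiplier.norm_le_of (m : Multiplier) {C : ℝ} (hC : ∀ ξ, ‖m.symbol ξ‖ ≤ C) {f g : L2}
    (h : hat g =ᵐ[volume] fun ξ => m.symbol ξ * hat f ξ) : ‖g‖ ≤ C * ‖f‖ := by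
  rw [← norm_hat, ← norm_hat f]
  apply Lp.norm_le_mul_norm_of_ae_le_mul
  filter_upwards [h] with ξ hξ
  rw [hξ, norm_mul]; gcongr; exact hC ξ

/-- The operator `f ↦ 𝓕⁻¹ (m · 𝓕 f)`. -/
def Multiplier.op (m : Multiplier) : L2 →L[ℝ] L2 :=
  LinearMap.mkContinuousOfExistsBound
    { toFun := fun f => (m.exists_apply f).choose
      map_add' := fun f g => eq_of_hat <| by
        filter_upwards [(m.exists_apply f).choose_spec, (m.exists_apply g).choose_spec,
          (m.exists_apply (f + g)).choose_spec, coeFn_hat_add f g,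
          coeFn_hat_add (m.exists_apply f).choose (m.exists_apply g).choose]
          with ξ h1 h2 h3 h4 h5
        rw [h3, h5, h4, h1, h2, mul_add]
      map_smul' := fun c f => eq_of_hat <| by
        filter_upwards [(m.exists_apply f).choose_spec,
          (m.exists_apply (c • f)).choose_spec, coeFn_hat_smul c f,
          coeFn_hat_smul c (m.exists_apply f).choose]
          with ξ h1 h3 h4 h5
        rw [RingHom.id_apply, h3, h5, h4, h1]
        ring }
    (by
      obtain ⟨C, hC⟩ := m.bounded
      exact ⟨C, fun f => m.norm_le_of hC (m.exists_apply f).choose_spec⟩)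

theorem Multiplier.hat_op (m : Multiplier) (f : L2) :
    hat (m.op f) =ᵐ[volume] fun ξ => m.symbol ξ * hat f ξ :=
  (m.exists_apply f).choose_spec

theorem Multiplier.norm_op_le (m : Multiplier) {C : ℝ} (hC : ∀ ξ, ‖m.symbol ξ‖ ≤ C) (f : L2) :
    ‖m.op f‖ ≤ C * ‖f‖ :=
  m.norm_le_of hC (m.hat_op f)

theorem Multiplier.op_eq_op {m₁ m₂ : Multiplier} {f₁ f₂ : L2}
    (h : ∀ᵐ ξ, m₁.symbol ξ * hat f₁ ξ = m₂.symbol ξ * hat f₂ ξ) : m₁.op f₁ = m₂.op f₂ :=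
  eq_of_hat <| by
    filter_upwards [m₁.hat_op f₁, m₂.hat_op f₂, h] with ξ h1 h2 h3
    rw [h1, h2, h3]

/-- The composition of two multipliers. -/
def Multiplier.mul (m₁ m₂ : Multiplier) : Multiplier where
  symbol := fun ξ => m₁.symbol ξ * m₂.symbol ξ
  measurable := m₁.measurable.mul m₂.measurable
  hermitian := fun ξ => by rw [m₁.hermitian, m₂.hermitian, map_mul]
  bounded := by
    obtain ⟨C₁, h₁⟩ := m₁.bounded
    obtain ⟨C₂, h₂⟩ := m₂.bounded
    refine ⟨C₁ * C₂, fun ξ => ?_⟩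
    rw [norm_mul]
    exact mul_le_mul (h₁ ξ) (h₂ ξ) (norm_nonneg _) ((norm_nonneg _).trans (h₁ ξ))

theorem Multiplier.op_mul (m₁ m₂ : Multiplier) (f : L2) : (m₁.mul m₂).op f = m₁.op (m₂.op f) :=
  eq_of_hat <| by
    filter_upwards [(m₁.mul m₂).hat_op f, m₁.hat_op (m₂.op f), m₂.hat_op f] with ξ h1 h2 h3
    rw [h1, h2, h3, Multiplier.mul, mul_assoc]

theorem Multiplier.ext_op {m₁ m₂ : Multiplier} (h : ∀ ξ, m₁.symbol ξ = m₂.symbol ξ) (f : L2) :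
    m₁.op f = m₂.op f :=
  op_eq_op (Eventually.of_forall fun ξ => by rw [h])

/-- Multipliers with real symbols are symmetric. -/
theorem Multiplier.inner_op_of_real (m : Multiplier) (hm : ∀ ξ, conj (m.symbol ξ) = m.symbol ξ)
    (f g : L2) : inner ℝ (m.op f) g = inner ℝ f (m.op g) := by
  have : ((inner ℝ (m.op f) g : ℝ) : ℂ) = (inner ℝ f (m.op g) : ℝ) := by
    rw [inner_eq_integral, inner_eq_integral, integral_mul_eq_hat, integral_mul_eq_hat]
    refine integral_congr_ae ?_
    filter_upwards [m.hat_op f, m.hat_op g] with ξ h1 h2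
    rw [h1, h2, map_mul, hm]; ring
  exact_mod_cast this

/-- Multipliers with imaginary symbols are antisymmetric. -/
theorem Multiplier.inner_op_of_imaginary (m : Multiplier)
    (hm : ∀ ξ, conj (m.symbol ξ) = -m.symbol ξ)
    (f g : L2) : inner ℝ (m.op f) g = -inner ℝ f (m.op g) := by
  have : ((inner ℝ (m.op f) g : ℝ) : ℂ) = -(inner ℝ f (m.op g) : ℝ) := by
    rw [inner_eq_integral, inner_eq_integral, integral_mul_eq_hat, integral_mul_eq_hat,
      ← integral_neg]
    refine integral_congr_ae ?_
    filter_upwards [m.hat_op f, m.hat_op g] with ξ h1 h2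
    rw [h1, h2, map_mul, hm]; ring
  exact_mod_cast this

/-! ### The weight `⟨ξ⟩` -/

/-- The weight `⟨ξ⟩ = (1 + |2πξ|²)^{1/2}`. -/
def jb (ξ : Plane) : ℝ := √(1 + (2 * Real.pi * ‖ξ‖) ^ 2)

theorem one_le_jb (ξ : Plane) : 1 ≤ jb ξ := by
  rw [jb, Real.one_le_sqrt]; nlinarith [sq_nonneg (2 * Real.pi * ‖ξ‖)]

theorem jb_pos (ξ : Plane) : 0 < jb ξ := zero_lt_one.trans_le (one_le_jb ξ)

theorem jb_neg (ξ : Plane) : jb (-ξ) = jb ξ := by simp [jb]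

theorem continuous_jb : Continuous jb := by unfold jb; fun_prop

theorem measurable_jb : Measurable jb := continuous_jb.measurable

theorem jb_sq (ξ : Plane) : jb ξ ^ 2 = 1 + (2 * Real.pi * ‖ξ‖) ^ 2 :=
  Real.sq_sqrt (by positivity)

theorem two_pi_norm_le_jb (ξ : Plane) : 2 * Real.pi * ‖ξ‖ ≤ jb ξ :=
  Real.le_sqrt_of_sq_le (by linarith)

theorem two_pi_coord_le_jb (ξ : Plane) (j : Fin 2) : |2 * Real.pi * ξ j| ≤ jb ξ := by
  refine le_trans ?_ (two_pi_norm_le_jb ξ)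
  rw [abs_mul, abs_of_pos Real.two_pi_pos]
  gcongr
  exact PiLp.norm_apply_le ξ j

theorem jb_le_add (ξ η : Plane) : jb ξ ≤ jb η + 2 * Real.pi * ‖ξ - η‖ := by
  apply Real.sqrt_le_iff.2
  have h0 := jb_pos η
  have h1 : ‖ξ‖ ≤ ‖η‖ + ‖ξ - η‖ := by
    simpa using norm_add_le η (ξ - η)
  have hp := Real.two_pi_pos
  refine ⟨by positivity, ?_⟩
  have h2 := jb_sq η
  have h3 := two_pi_norm_le_jb η
  have h4 : 2 * Real.pi * ‖ξ‖ ≤ 2 * Real.pi * ‖η‖ + 2 * Real.pi * ‖ξ - η‖ := by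
    rw [← mul_add]; gcongr
  have h5 : (2 * Real.pi * ‖ξ‖) ^ 2 ≤ (2 * Real.pi * ‖η‖ + 2 * Real.pi * ‖ξ - η‖) ^ 2 := by gcongr
  have h6 : 0 ≤ 2 * Real.pi * ‖ξ - η‖ := by positivity
  nlinarith [mul_le_mul_of_nonneg_right h3 h6]

theorem abs_jb_sub_le (ξ ζ : Plane) : |jb ξ - jb (ξ - ζ)| ≤ jb ζ := by
  have h1 := jb_le_add ξ (ξ - ζ)
  have h2 := jb_le_add (ξ - ζ) ξ
  have h3 := two_pi_norm_le_jb ζ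
  rw [sub_sub_cancel] at h1
  rw [sub_sub_cancel_left, norm_neg] at h2
  rw [abs_le]; constructor <;> linarith

theorem jb_rpow_sq (ξ : Plane) (r : ℝ) : (jb ξ ^ r) ^ 2 = (1 + (2 * Real.pi * ‖ξ‖) ^ 2) ^ r := by
  rw [← jb_sq, ← Real.rpow_natCast, ← Real.rpow_natCast, ← Real.rpow_mul (jb_pos ξ).le,
    ← Real.rpow_mul (jb_pos ξ).le, mul_comm]

theorem continuous_jb_rpow (r : ℝ) : Continuous fun ξ => jb ξ ^ r :=
  continuous_jb.rpow_const fun ξ => Or.inl (jb_pos ξ).ne'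

theorem measurable_jb_rpow (r : ℝ) : Measurable fun ξ => jb ξ ^ r :=
    (continuous_jb_rpow r).measurable

theorem memLp_jb_rpow {r : ℝ} (hr : r < -1) : MemLp (fun ξ => jb ξ ^ r) 2 := by
  rw [memLp_two_iff_integrable_sq (continuous_jb_rpow r).aestronglyMeasurable]
  have h := integrable_rpow_neg_one_add_norm_sq (E := Plane) (μ := volume) (r := -2 * r)
    (by simp; linarith)
  refine h.mono' ((continuous_jb_rpow r).pow 2).aestronglyMeasurable
      (Eventually.of_forall fun ξ => ?_)
  rw [Real.norm_eq_abs, abs_of_nonneg (sq_nonneg _), jb_rpow_sq]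
  rw [show -(-2 * r) / 2 = r by ring]
  apply Real.rpow_le_rpow_of_nonpos (by positivity) _ (by linarith)
  have : 1 ≤ (2 * Real.pi) ^ 2 := by nlinarith [Real.pi_gt_three]
  nlinarith [sq_nonneg ‖ξ‖]

/-! ### The multipliers of the problem -/

/-- The multiplier with a bounded even real symbol. -/
def evenMultiplier (w : Plane → ℝ) (h1 : Measurable w) (h2 : ∀ ξ, w (-ξ) = w ξ)
    (h3 : ∃ C : ℝ, ∀ ξ, |w ξ| ≤ C) : Multiplier where
  symbol := fun ξ => (w ξ : ℂ)
  measurable := Complex.measurable_ofReal.comp h1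
  hermitian := fun ξ => by simp [h2]
  bounded := by simpa using h3

/-- The multiplier whose symbol is `i` times a bounded odd real function. -/
def oddMultiplier (w : Plane → ℝ) (h1 : Measurable w) (h2 : ∀ ξ, w (-ξ) = -w ξ)
    (h3 : ∃ C : ℝ, ∀ ξ, |w ξ| ≤ C) : Multiplier where
  symbol := fun ξ => Complex.I * (w ξ : ℂ)
  measurable := measurable_const.mul (Complex.measurable_ofReal.comp h1)
  hermitian := fun ξ => by simp [h2]
  bounded := by simpa using h3

theorem jb_rpow_neg_le_one {s : ℝ} (hs : 2 < s) (ξ : Plane) : jb ξ ^ (-s) ≤ 1 :=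
  Real.rpow_le_one_of_one_le_of_nonpos (one_le_jb ξ) (by linarith)

/-- The Bessel potential `(1 - Δ)^{-s/2}`; it maps `L²` onto `H^s`. -/
def bessel {s : ℝ} (hs : 2 < s) : Multiplier :=
  evenMultiplier (fun ξ => jb ξ ^ (-s)) (measurable_jb_rpow _) (fun ξ => by rw [jb_neg])
    ⟨1, fun ξ => by
      rw [abs_of_nonneg (Real.rpow_nonneg (jb_pos ξ).le _)]; exact jb_rpow_neg_le_one hs ξ⟩

theorem coord_mul_jb_rpow_le (s : ℝ) (j : Fin 2) (ξ : Plane) :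
    |2 * Real.pi * ξ j * jb ξ ^ (-s)| ≤ jb ξ ^ (1 - s) := by
  rw [abs_mul, abs_of_nonneg (Real.rpow_nonneg (jb_pos ξ).le (-s)), sub_eq_add_neg,
    Real.rpow_add (jb_pos ξ), Real.rpow_one]
  gcongr
  · exact Real.rpow_nonneg (jb_pos ξ).le _
  · exact two_pi_coord_le_jb ξ j

/-- The derivative `∂_j (1 - Δ)^{-s/2}`. -/
def dBessel {s : ℝ} (hs : 2 < s) (j : Fin 2) : Multiplier :=
  oddMultiplier (fun ξ => 2 * Real.pi * ξ j * jb ξ ^ (-s))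
    ((measurable_const.mul (by fun_prop)).mul (measurable_jb_rpow _)) (fun ξ =>
        by rw [jb_neg]; simp)
    ⟨1, fun ξ => (coord_mul_jb_rpow_le s j ξ).trans
      (Real.rpow_le_one_of_one_le_of_nonpos (one_le_jb ξ) (by linarith))⟩

/-- The Laplacian `Δ (1 - Δ)^{-s/2}`. -/
def lapBessel {s : ℝ} (hs : 2 < s) : Multiplier :=
  evenMultiplier (fun ξ => -((2 * Real.pi * ‖ξ‖) ^ 2 * jb ξ ^ (-s)))
    (by have := measurable_jb_rpow (-s); fun_prop) (fun ξ => by rw [jb_neg]; simp)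
    ⟨1, fun ξ => by
      have h0 := Real.rpow_nonneg (jb_pos ξ).le (-s)
      rw [abs_neg, abs_of_nonneg (by positivity)]
      calc (2 * Real.pi * ‖ξ‖) ^ 2 * jb ξ ^ (-s) ≤ jb ξ ^ 2 * jb ξ ^ (-s) := by
            refine mul_le_mul_of_nonneg_right ?_ h0; rw [jb_sq]; linarith
        _ = jb ξ ^ (2 - s) := by
            rw [← Real.rpow_natCast, ← Real.rpow_add (jb_pos ξ)]; norm_num [sub_eq_add_neg]
        _ ≤ 1 := Real.rpow_le_one_of_one_le_of_nonpos (one_le_jb ξ) (by linarith)⟩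

/-- The sharp frequency cut-off to `⟨ξ⟩ ≤ n + 1`, as a function. -/
def cut (n : ℕ) (ξ : Plane) : ℝ := if jb ξ ≤ n + 1 then 1 else 0

theorem cut_nonneg (n : ℕ) (ξ : Plane) : 0 ≤ cut n ξ := by unfold cut; split_ifs <;> simp

theorem cut_le_one (n : ℕ) (ξ : Plane) : cut n ξ ≤ 1 := by unfold cut; split_ifs <;> simp

theorem abs_cut_le_one (n : ℕ) (ξ : Plane) : |cut n ξ| ≤ 1 := by
  rw [abs_of_nonneg (cut_nonneg n ξ)]; exact cut_le_one n ξ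

theorem cut_mul_self (n : ℕ) (ξ : Plane) : cut n ξ * cut n ξ = cut n ξ := by
  unfold cut; split_ifs <;> simp

theorem cut_neg (n : ℕ) (ξ : Plane) : cut n (-ξ) = cut n ξ := by simp [cut, jb_neg]

theorem measurable_cut (n : ℕ) : Measurable (cut n) :=
  Measurable.ite (measurableSet_le measurable_jb measurable_const) measurable_const measurable_const

/-- The projection to the frequencies with `⟨ξ⟩ ≤ n + 1`. -/
def proj (n : ℕ) : Multiplier :=
  evenMultiplier (cut n) (measurable_cut n) (cut_neg n) ⟨1, abs_cut_le_one n⟩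

theorem cut_mul_jb_rpow_le (n : ℕ) {r : ℝ} (hr : 0 ≤ r) (ξ : Plane) :
    cut n ξ * jb ξ ^ r ≤ ((n : ℝ) + 1) ^ r := by
  unfold cut
  split_ifs with h
  · rw [one_mul]; exact Real.rpow_le_rpow (jb_pos ξ).le h hr
  · rw [zero_mul]; positivity

/-- The truncation of `(1 - Δ)^{s/2}` to `⟨ξ⟩ ≤ n + 1`. -/
def invBessel {s : ℝ} (hs : 2 < s) (n : ℕ) : Multiplier :=
  evenMultiplier (fun ξ => cut n ξ * jb ξ ^ s) ((measurable_cut n).mul (measurable_jb_rpow _))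
    (fun ξ => by rw [jb_neg, cut_neg])
    ⟨((n : ℝ) + 1) ^ s, fun ξ => by
      rw [abs_of_nonneg (mul_nonneg (cut_nonneg n ξ) (Real.rpow_nonneg (jb_pos ξ).le _))]
      exact cut_mul_jb_rpow_le n (by linarith) ξ⟩

/-- The truncation of the Laplacian to `⟨ξ⟩ ≤ n + 1`. -/
def lapProj (n : ℕ) : Multiplier :=
  evenMultiplier (fun ξ => -(cut n ξ * (2 * Real.pi * ‖ξ‖) ^ 2))
    (by have := measurable_cut n; fun_prop) (fun ξ => by rw [cut_neg, norm_neg])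
    ⟨((n : ℝ) + 1) ^ (2 : ℝ), fun ξ => by
      have h0 := cut_nonneg n ξ
      rw [abs_neg, abs_of_nonneg (by positivity)]
      refine le_trans ?_ (cut_mul_jb_rpow_le n (by norm_num : (0 : ℝ) ≤ 2) ξ)
      gcongr
      rw [Real.rpow_two, jb_sq]; linarith⟩

theorem bessel_symbol {s : ℝ} (hs : 2 < s) (ξ : Plane) :
    (bessel hs).symbol ξ = ((jb ξ ^ (-s) : ℝ) : ℂ) := rfl

theorem dBessel_symbol {s : ℝ} (hs : 2 < s) (j : Fin 2) (ξ : Plane) :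
    (dBessel hs j).symbol ξ = Complex.I * ((2 * Real.pi * ξ j * jb ξ ^ (-s) : ℝ) : ℂ) := rfl

theorem lapBessel_symbol {s : ℝ} (hs : 2 < s) (ξ : Plane) :
    (lapBessel hs).symbol ξ = ((-((2 * Real.pi * ‖ξ‖) ^ 2 * jb ξ ^ (-s)) : ℝ) : ℂ) := rfl

theorem proj_symbol (n : ℕ) (ξ : Plane) : (proj n).symbol ξ = (cut n ξ : ℂ) := rfl

theorem invBessel_symbol {s : ℝ} (hs : 2 < s) (n : ℕ) (ξ : Plane) :
    (invBessel hs n).symbol ξ = ((cut n ξ * jb ξ ^ s : ℝ) : ℂ) := rfl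

theorem lapProj_symbol (n : ℕ) (ξ : Plane) :
    (lapProj n).symbol ξ = ((-(cut n ξ * (2 * Real.pi * ‖ξ‖) ^ 2) : ℝ) : ℂ) := rfl

/-! ### Sobolev embedding -/

theorem lintegral_mul_le_sqrt {α : Type*} [MeasurableSpace α] {μ : Measure α} {f g : α → ℝ≥0∞}
    (hf : AEMeasurable f μ) (hg : AEMeasurable g μ) :
    ∫⁻ x, f x * g x ∂μ ≤ (∫⁻ x, f x ^ 2 ∂μ) ^ (1 / 2 : ℝ) * (∫⁻ x, g x ^ 2 ∂μ) ^ (1 / 2 : ℝ) := by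
  have := ENNReal.lintegral_mul_le_Lp_mul_Lq μ (p := 2) (q := 2)
    (Real.holderConjugate_iff.2 ⟨by norm_num, by norm_num⟩) hf hg
  simpa using this

theorem enorm_eq_sqrt_lintegral (g : CL2) :
    ‖g‖ₑ = (∫⁻ ξ, ‖g ξ‖ₑ ^ 2) ^ (1 / 2 : ℝ) := by
  rw [Lp.enorm_def, eLpNorm_eq_lintegral_rpow_enorm_toReal (by norm_num) (by norm_num)]
  simp

theorem sqrt_lintegral_hat (f : L2) :
    (∫⁻ ξ, ‖hat f ξ‖ₑ ^ 2) ^ (1 / 2 : ℝ) = ENNReal.ofReal ‖f‖ := by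
  rw [← enorm_eq_sqrt_lintegral, ← ofReal_norm, norm_hat]

theorem aemeasurable_hat (f : L2) : AEMeasurable (fun ξ => ‖hat f ξ‖ₑ) :=
  (Lp.aestronglyMeasurable _).enorm

/-- The constant of the Sobolev embedding `H^{s-1} ⊂ L^∞`, `s > 2`. -/
def embConst (s : ℝ) : ℝ := ((∫⁻ ξ, ENNReal.ofReal (jb ξ ^ (1 - s)) ^ 2) ^ (1 / 2 : ℝ)).toReal

theorem embConst_nonneg (s : ℝ) : 0 ≤ embConst s := ENNReal.toReal_nonneg

theorem ofReal_embConst {s : ℝ} (hs : 2 < s) :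
    (∫⁻ ξ, ENNReal.ofReal (jb ξ ^ (1 - s)) ^ 2) ^ (1 / 2 : ℝ) = ENNReal.ofReal (embConst s) := by
  rw [embConst, ENNReal.ofReal_toReal]
  have h := (memLp_jb_rpow (r := 1 - s) (by linarith)).eLpNorm_lt_top
  rw [eLpNorm_eq_lintegral_rpow_enorm_toReal (by norm_num) (by norm_num)] at h
  have h2 : ∀ ξ, ‖jb ξ ^ (1 - s)‖ₑ = ENNReal.ofReal (jb ξ ^ (1 - s)) := fun ξ =>
    Real.enorm_of_nonneg (Real.rpow_nonneg (jb_pos ξ).le _)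
  simp only [h2] at h
  simpa using h.ne

theorem lintegral_jb_hat_le {s : ℝ} (hs : 2 < s) {h : Plane → ℝ≥0∞} (hh : AEMeasurable h) :
    ∫⁻ ξ, ENNReal.ofReal (jb ξ ^ (1 - s)) * h ξ
      ≤ ENNReal.ofReal (embConst s) * (∫⁻ ξ, h ξ ^ 2) ^ (1 / 2 : ℝ) := by
  rw [← ofReal_embConst hs]
  exact lintegral_mul_le_sqrt (measurable_jb_rpow _).ennreal_ofReal.aemeasurable hh

/-- The Fourier transform is integrable if it is dominated by `⟨ξ⟩^{1-s}` times a square-integrable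
function, by the Cauchy–Schwarz inequality. -/
theorem lintegral_hat_le {s : ℝ} (hs : 2 < s) {g V : L2}
    (h : ∀ᵐ ξ, ‖hat g ξ‖ ≤ jb ξ ^ (1 - s) * ‖hat V ξ‖) :
    ∫⁻ ξ, ‖hat g ξ‖ₑ ≤ ENNReal.ofReal (embConst s * ‖V‖) := by
  rw [ENNReal.ofReal_mul (embConst_nonneg s), ← sqrt_lintegral_hat]
  refine le_trans (lintegral_mono_ae ?_) (lintegral_jb_hat_le hs (aemeasurable_hat V))
  filter_upwards [h] with ξ hξ
  rw [← ofReal_norm, ← ofReal_norm,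
    ← ENNReal.ofReal_mul (Real.rpow_nonneg (jb_pos ξ).le _)]
  exact ENNReal.ofReal_le_ofReal hξ

theorem integrable_hat {s : ℝ} (hs : 2 < s) {g V : L2}
    (h : ∀ᵐ ξ, ‖hat g ξ‖ ≤ jb ξ ^ (1 - s) * ‖hat V ξ‖) : Integrable (hat g) :=
  ⟨Lp.aestronglyMeasurable _, (lintegral_hat_le hs h).trans_lt ENNReal.ofReal_lt_top⟩

theorem coe_eq_integral_hat {g : L2} (h : Integrable (hat g)) :
    ∀ᵐ x, (g x : ℂ) = ∫ ζ, hat g ζ * planeWave ζ x := by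
  filter_upwards [coeFn_complexify g, eq_integral_of_integrable_fourier
      (complexify g) h] with x h1 h2
  rw [← h1, h2]; rfl

theorem abs_le_of_hat_le {s : ℝ} (hs : 2 < s) {g V : L2}
    (h : ∀ᵐ ξ, ‖hat g ξ‖ ≤ jb ξ ^ (1 - s) * ‖hat V ξ‖) : ∀ᵐ x, |g x| ≤ embConst s * ‖V‖ := by
  have hi := integrable_hat hs h
  filter_upwards [coe_eq_integral_hat hi] with x hx
  rw [← Real.norm_eq_abs, ← Complex.norm_real, hx]
  refine (norm_integral_le_integral_norm _).trans ?_
  simp only [norm_mul, norm_planeWave, mul_one]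
  rw [integral_norm_eq_lintegral_enorm hi.1]
  exact ENNReal.toReal_le_of_le_ofReal (mul_nonneg (embConst_nonneg s) (norm_nonneg _))
    (lintegral_hat_le hs h)

theorem norm_hat_bessel_le {s : ℝ} (hs : 2 < s) (V : L2) :
    ∀ᵐ ξ, ‖hat ((bessel hs).op V) ξ‖ ≤ jb ξ ^ (1 - s) * ‖hat V ξ‖ := by
  filter_upwards [(bessel hs).hat_op V] with ξ hξ
  rw [hξ, norm_mul]
  gcongr
  simp only [bessel, evenMultiplier, Complex.norm_real, Real.norm_eq_abs]
  rw [abs_of_nonneg (Real.rpow_nonneg (jb_pos ξ).le _)]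
  exact Real.rpow_le_rpow_of_exponent_le (one_le_jb ξ) (by linarith)

theorem norm_hat_dBessel_le {s : ℝ} (hs : 2 < s) (j : Fin 2) (V : L2) :
    ∀ᵐ ξ, ‖hat ((dBessel hs j).op V) ξ‖ ≤ jb ξ ^ (1 - s) * ‖hat V ξ‖ := by
  filter_upwards [(dBessel hs j).hat_op V] with ξ hξ
  rw [hξ, norm_mul]
  gcongr
  rw [dBessel_symbol, norm_mul, Complex.norm_I, one_mul, Complex.norm_real, Real.norm_eq_abs]
  exact coord_mul_jb_rpow_le s j ξ

/-- Sobolev embedding: functions in `H^s` are bounded. -/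
theorem abs_bessel_le {s : ℝ} (hs : 2 < s) (V : L2) :
    ∀ᵐ x, |(bessel hs).op V x| ≤ embConst s * ‖V‖ :=
  abs_le_of_hat_le hs (norm_hat_bessel_le hs V)

/-- Sobolev embedding: first derivatives of functions in `H^s` are bounded. -/
theorem abs_dBessel_le {s : ℝ} (hs : 2 < s) (j : Fin 2) (V : L2) :
    ∀ᵐ x, |(dBessel hs j).op V x| ≤ embConst s * ‖V‖ :=
  abs_le_of_hat_le hs (norm_hat_dBessel_le hs j V)

/-! ### Test functions and weak derivatives -/

theorem IsTest.memLp {η : Plane → ℝ} (h : IsTest η) : MemLp η 2 :=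
  h.1.continuous.memLp_of_hasCompactSupport h.2

/-- A test function as an element of `L²`. -/
def IsTest.toL2 {η : Plane → ℝ} (h : IsTest η) : L2 := h.memLp.toLp η

theorem IsTest.coeFn_toL2 {η : Plane → ℝ} (h : IsTest η) : h.toL2 =ᵐ[volume] η := h.memLp.coeFn_toLp

theorem IsTest.hat_toL2 {η : Plane → ℝ} (h : IsTest η) :
    hat h.toL2 =ᵐ[volume] (𝓕 h.toSchwartz : SchwartzMap Plane ℂ) := by
  have : complexify h.toL2 = h.toSchwartz.toLp 2 := by
    apply Lp.ext
    filter_upwards [coeFn_complexify h.toL2, h.coeFn_toL2,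
        h.toSchwartz.coeFn_toLp 2 volume] with x h1 h2 h3
    rw [h1, h2, h3, h.toSchwartz_apply]
  rw [hat, this, SchwartzMap.toLp_fourier_eq]
  exact (𝓕 h.toSchwartz : SchwartzMap Plane ℂ).coeFn_toLp 2 volume

theorem IsTest.integral_mul {η : Plane → ℝ} (h : IsTest η) (f : L2) :
    ∫ x, f x * η x = inner ℝ f h.toL2 := by
  rw [inner_eq_integral]
  refine integral_congr_ae ?_
  filter_upwards [h.coeFn_toL2] with x hx
  rw [hx]

theorem L2_ext_of_test {f g : L2} (h : ∀ η, IsTest η → ∫ x, f x * η x = ∫ x, g x * η x) : f =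
    g := by
  apply Lp.ext
  have hl : ∀ f : L2, LocallyIntegrable (f : Plane → ℝ) volume := fun f =>
    (Lp.memLp f).locallyIntegrable (by norm_num : (1 : ℝ≥0∞) ≤ 2)
  refine ae_eq_of_integral_contDiff_smul_eq (hl f) (hl g) fun η h1 h2 => ?_
  simpa [mul_comm] using h η ⟨h1, h2⟩

theorem IsTest.deriv {η : Plane → ℝ} (h : IsTest η) (j : Fin 2) :
    IsTest (fun x => fderiv ℝ η x (e j)) :=
  ⟨(h.1.fderiv_right (by simp)).clm_apply contDiff_const,
    (h.2.fderiv ℝ).comp_left (g := fun L : Plane →L[ℝ] ℝ => L (e j)) rfl⟩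

open LineDeriv in
theorem IsTest.toSchwartz_deriv {η : Plane → ℝ} (h : IsTest η) (j : Fin 2) :
    (h.deriv j).toSchwartz = ∂_{e j} h.toSchwartz := by
  ext x
  rw [SchwartzMap.lineDerivOp_apply_eq_fderiv, IsTest.toSchwartz_apply]
  have h1 : HasFDerivAt (fun x => (η x : ℂ)) (Complex.ofRealCLM.comp (fderiv ℝ η x)) x :=
    Complex.ofRealCLM.hasFDerivAt.comp x (h.1.differentiable (by simp) x).hasFDerivAt
  have h2 : fderiv ℝ h.toSchwartz x = Complex.ofRealCLM.comp (fderiv ℝ η x) := h1.fderiv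
  rw [h2]; simp

theorem IsTest.fourier_deriv {η : Plane → ℝ} (h : IsTest η) (j : Fin 2) (ξ : Plane) :
    (𝓕 (h.deriv j).toSchwartz) ξ
      = Complex.I * ((2 * Real.pi * ξ j : ℝ) : ℂ) * (𝓕 h.toSchwartz) ξ := by
  rw [h.toSchwartz_deriv, SchwartzMap.fourier_lineDerivOp_eq]
  have : (inner ℝ · (e j) : Plane → ℝ).HasTemperateGrowth := by fun_prop
  rw [_root_.smul_apply, SchwartzMap.smulLeftCLM_apply_apply this]
  simp only [e, EuclideanSpace.inner_single_right, smul_eq_mul, Complex.real_smul]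
  push_cast
  simp
  ring

theorem IsTest.laplacian_eq {η : Plane → ℝ} (h : IsTest η) (x : Plane) :
    Δ η x = ∑ j, fderiv ℝ (fun y => fderiv ℝ η y (e j)) x (e j) := by
  rw [InnerProductSpace.laplacian_eq_iteratedFDeriv_orthonormalBasis η (EuclideanSpace.basisFun
      (Fin 2) ℝ)]
  refine Finset.sum_congr rfl fun j _ => ?_
  rw [iteratedFDeriv_two_apply]
  have hd : DifferentiableAt ℝ (fderiv ℝ η) x :=
    ((h.1.fderiv_right (m := 1) (by norm_cast)).differentiable (by simp)) x
  simp [e, fderiv_clm_apply hd (differentiableAt_const _)]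

theorem isWeakDeriv_bessel {s : ℝ} (hs : 2 < s) (j : Fin 2) (V : L2) :
    IsWeakDeriv j ((bessel hs).op V) ((dBessel hs j).op V) := by
  intro η hη
  rw [hη.integral_mul, (hη.deriv j).integral_mul, inner_eq_integral, inner_eq_integral]
  apply Complex.ofReal_injective
  rw [Complex.ofReal_neg, integral_mul_eq_hat, integral_mul_eq_hat, ← integral_neg]
  refine integral_congr_ae ?_
  filter_upwards [(bessel hs).hat_op V, (dBessel hs j).hat_op V, hη.hat_toL2, (hη.deriv j).hat_toL2]
    with ξ h1 h2 h3 h4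
  rw [h1, h2, h3, h4, hη.fourier_deriv]
  rw [bessel_symbol, dBessel_symbol]
  simp only [map_mul, Complex.conj_I, Complex.conj_ofReal]
  push_cast
  ring

theorem weakDeriv_eq {j : Fin 2} {f g : L2} (h : IsWeakDeriv j f g) : weakDeriv j f = g := by
  have h1 : ∃ g, IsWeakDeriv j f g := ⟨g, h⟩
  rw [weakDeriv, dif_pos h1]
  refine L2_ext_of_test fun η hη => ?_
  have h2 := h1.choose_spec η hη
  rw [h η hη] at h2
  exact (neg_injective h2).symm

theorem weakDeriv_bessel {s : ℝ} (hs : 2 < s) (j : Fin 2) (V : L2) :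
    weakDeriv j ((bessel hs).op V) = (dBessel hs j).op V :=
  weakDeriv_eq (isWeakDeriv_bessel hs j V)

/-- `Δ ⟨D⟩^{-s} V`, as a distribution, is the function obtained by the multiplier `lapBessel`. -/
theorem integral_bessel_mul_laplacian {s : ℝ} (hs : 2 < s) (V : L2) {η : Plane → ℝ} (hη :
    IsTest η) :
    ∫ x, (bessel hs).op V x * Δ η x = ∫ x, (lapBessel hs).op V x * η x := by
  have h0 : ∀ x, Δ η x = ∑ j, fderiv ℝ (fun y => fderiv ℝ η y (e j)) x (e j) := hη.laplacian_eq
  have h1 : ∫ x, (bessel hs).op V x * Δ η x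
      = ∑ j, ∫ x, (bessel hs).op V x * fderiv ℝ (fun y => fderiv ℝ η y (e j)) x (e j) := by
    rw [← integral_finsetSum]
    · simp_rw [h0, Finset.mul_sum]
    · intro j _
      exact (Lp.memLp _).integrable_mul ((hη.deriv j).deriv j).memLp
  rw [h1, hη.integral_mul]
  simp_rw [((hη.deriv _).deriv _).integral_mul, inner_eq_integral]
  apply Complex.ofReal_injective
  rw [Fin.sum_univ_two, Complex.ofReal_add, integral_mul_eq_hat, integral_mul_eq_hat,
    integral_mul_eq_hat, ← integral_add]
  · refine integral_congr_ae ?_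
    filter_upwards [(bessel hs).hat_op V, (lapBessel hs).hat_op V, hη.hat_toL2,
      ((hη.deriv 0).deriv 0).hat_toL2, ((hη.deriv 1).deriv 1).hat_toL2] with ξ h1 h2 h3 h4 h5
    rw [h1, h2, h3, h4, h5, (hη.deriv _).fourier_deriv, (hη.deriv _).fourier_deriv,
      hη.fourier_deriv, hη.fourier_deriv]
    have hn : ‖ξ‖ ^ 2 = ξ 0 ^ 2 + ξ 1 ^ 2 := by
      rw [EuclideanSpace.norm_sq_eq]; simp
    have hn' : ((‖ξ‖ : ℂ)) ^ 2 = (ξ 0 : ℂ) ^ 2 + (ξ 1 : ℂ) ^ 2 := by exact_mod_cast hn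
    simp only [bessel_symbol, lapBessel_symbol, map_mul, Complex.conj_I, Complex.conj_ofReal]
    push_cast
    simp only [mul_pow, hn']
    ring_nf
    rw [Complex.I_sq]; ring
  · exact (Lp.memLp _).integrable_mul (memLp_conj (Lp.memLp _))
  · exact (Lp.memLp _).integrable_mul (memLp_conj (Lp.memLp _))

theorem dense_test : Dense {f : L2 | ∃ (η : Plane → ℝ) (h : IsTest η), h.toL2 = f} := by
  refine (Lp.dense_hasCompactSupport_contDiff (F := ℝ) (μ := (volume : Measure Plane)) (p := 2)
    (by norm_num)).mono ?_
  rintro f ⟨g, h1, h2, h3⟩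
  exact ⟨g, ⟨h3, h2⟩, Lp.ext ((IsTest.coeFn_toL2 ⟨h3, h2⟩).trans h1.symm)⟩

/-! ### Characterizations of `H^s` -/

theorem sq_sqrt_ennreal (a : ℝ≥0∞) : (a ^ (1 / 2 : ℝ)) ^ 2 = a := by
  rw [← ENNReal.rpow_natCast, ← ENNReal.rpow_mul]; norm_num

theorem lintegral_hat_sq (f : L2) : ∫⁻ ξ, ‖hat f ξ‖ₑ ^ 2 = ENNReal.ofReal (‖f‖ ^ 2) := by
  rw [← sq_sqrt_ennreal (∫⁻ ξ, ‖hat f ξ‖ₑ ^ 2), sqrt_lintegral_hat,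
    ENNReal.ofReal_pow (norm_nonneg f)]

/-- The weight in the Sobolev norm as a factor of the Fourier transform. -/
theorem weight_mul_sq (s : ℝ) (ξ : Plane) (z : ℂ) :
    ENNReal.ofReal ((1 + (2 * Real.pi * ‖ξ‖) ^ 2) ^ s) * ‖z‖ₑ ^ 2
      = ‖((jb ξ ^ s : ℝ) : ℂ) * z‖ₑ ^ 2 := by
  rw [← jb_rpow_sq, enorm_mul, mul_pow, ← ofReal_norm ((jb ξ ^ s : ℝ) : ℂ), Complex.norm_real,
    Real.norm_eq_abs, abs_of_nonneg (Real.rpow_nonneg (jb_pos ξ).le _),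
    ENNReal.ofReal_pow (Real.rpow_nonneg (jb_pos ξ).le _)]

theorem jb_rpow_mul_neg (s : ℝ) (ξ : Plane) : jb ξ ^ s * jb ξ ^ (-s) = 1 := by
  rw [← Real.rpow_add (jb_pos ξ)]; simp

/-- The coordinates `V = ⟨D⟩^s U` turn the norm of `H^s` into that of `L²`. -/
theorem sobolevENorm_bessel {s : ℝ} (hs : 2 < s) (V : Fin 9 → L2) :
    sobolevENorm s (fun i => (bessel hs).op (V i)) = ENNReal.ofReal (√(∑ i, ‖V i‖ ^ 2)) := by
  have h : ∀ i, ∫⁻ ξ : Plane, ENNReal.ofReal ((1 + (2 * Real.pi * ‖ξ‖) ^ 2) ^ s) *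
      ‖(𝓕 (complexify ((bessel hs).op (V i))) : Lp ℂ 2 (volume : Measure Plane)) ξ‖ₑ ^ 2
      = ENNReal.ofReal (‖V i‖ ^ 2) := by
    intro i
    rw [← lintegral_hat_sq]
    refine lintegral_congr_ae ?_
    filter_upwards [(bessel hs).hat_op (V i)] with ξ hξ
    rw [weight_mul_sq]
    change ‖((jb ξ ^ s : ℝ) : ℂ) * hat ((bessel hs).op (V i)) ξ‖ₑ ^ 2 = _
    rw [hξ, bessel_symbol, ← mul_assoc, ← Complex.ofReal_mul, jb_rpow_mul_neg, Complex.ofReal_one,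
      one_mul]
  rw [sobolevENorm]
  simp_rw [h]
  rw [← ENNReal.ofReal_sum_of_nonneg (fun i _ => sq_nonneg _), Real.sqrt_eq_rpow,
    ENNReal.ofReal_rpow_of_nonneg (Finset.sum_nonneg fun i _ => sq_nonneg _) (by norm_num)]

theorem exists_bessel_eq {s : ℝ} (hs : 2 < s) {f : L2}
    (h : MemLp (fun ξ => ((jb ξ ^ s : ℝ) : ℂ) * hat f ξ) 2) :
    ∃ V, f = (bessel hs).op V ∧ hat V =ᵐ[volume] fun ξ => ((jb ξ ^ s : ℝ) : ℂ) * hat f ξ := by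
  obtain ⟨V, hV⟩ := exists_hat_eq h (by
    filter_upwards [hat_neg f] with ξ hξ
    rw [hξ, jb_neg, map_mul, Complex.conj_ofReal])
  refine ⟨V, eq_of_hat ?_, hV⟩
  filter_upwards [(bessel hs).hat_op V, hV] with ξ h1 h2
  rw [h1, h2, bessel_symbol, ← mul_assoc, ← Complex.ofReal_mul, mul_comm (jb ξ ^ (-s)),
    jb_rpow_mul_neg, Complex.ofReal_one, one_mul]

theorem aestronglyMeasurable_jb_mul_hat (s : ℝ) (f : L2) :
    AEStronglyMeasurable (fun ξ => ((jb ξ ^ s : ℝ) : ℂ) * hat f ξ) volume :=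
  (Complex.measurable_ofReal.comp (measurable_jb_rpow s)).aestronglyMeasurable.mul
    (Lp.aestronglyMeasurable _)

theorem memLp_two_of_lintegral {F : Plane → ℂ} (hF : AEStronglyMeasurable F volume)
    (h : ∫⁻ ξ, ‖F ξ‖ₑ ^ 2 < ⊤) : MemLp F 2 := by
  refine ⟨hF, ?_⟩
  rw [eLpNorm_eq_lintegral_rpow_enorm_toReal (by norm_num) (by norm_num)]
  apply ENNReal.rpow_lt_top_of_nonneg (by norm_num)
  simpa using h.ne

/-- Every element of `H^s` is of the form `⟨D⟩^{-s} V` with `V` in `L²`. -/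
theorem exists_bessel_of_sobolevENorm {s : ℝ} (hs : 2 < s) {U : Fin 9 → L2}
    (h : sobolevENorm s U < ⊤) : ∃ V : Fin 9 → L2, ∀ i, U i = (bessel hs).op (V i) := by
  have h1 : ∀ i, ∃ V, U i = (bessel hs).op V := by
    intro i
    have h2 : MemLp (fun ξ => ((jb ξ ^ s : ℝ) : ℂ) * hat (U i) ξ) 2 := by
      refine memLp_two_of_lintegral (aestronglyMeasurable_jb_mul_hat s _) ?_
      rw [sobolevENorm] at h
      have h3 := (ENNReal.rpow_lt_top_iff_of_pos (by norm_num)).1 h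
      have h4 := ENNReal.sum_lt_top.1 h3 i (Finset.mem_univ i)
      simp_rw [weight_mul_sq] at h4
      exact h4
    obtain ⟨V, hV, -⟩ := exists_bessel_eq hs h2
    exact ⟨V, hV⟩
  choose V hV using h1
  exact ⟨V, hV⟩

theorem eventually_cut_eq_one (ξ : Plane) : ∀ᶠ n : ℕ in atTop, cut n ξ = 1 := by
  obtain ⟨N, hN⟩ := exists_nat_ge (jb ξ)
  filter_upwards [eventually_ge_atTop N] with n hn
  have : (N : ℝ) ≤ n := by exact_mod_cast hn
  exact if_pos (by linarith)

/-- A function whose truncated `H^s` norms are bounded belongs to `H^s`. -/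
theorem exists_bessel_of_bounded {s : ℝ} (hs : 2 < s) {f : L2} {M : ℝ}
    (h : ∀ n, ‖(invBessel hs n).op f‖ ≤ M) : ∃ V, f = (bessel hs).op V ∧ ‖V‖ ≤ M := by
  have hM : 0 ≤ M := (norm_nonneg _).trans (h 0)
  have key : ∫⁻ ξ, ‖((jb ξ ^ s : ℝ) : ℂ) * hat f ξ‖ₑ ^ 2 ≤ ENNReal.ofReal (M ^ 2) := by
    have h1 : ∀ n, ∫⁻ ξ, ‖((cut n ξ * jb ξ ^ s : ℝ) : ℂ) * hat f ξ‖ₑ ^ 2 ≤ ENNReal.ofReal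
        (M ^ 2) := by
      intro n
      calc _ = ∫⁻ ξ, ‖hat ((invBessel hs n).op f) ξ‖ₑ ^ 2 := by
            refine lintegral_congr_ae ?_
            filter_upwards [(invBessel hs n).hat_op f] with ξ hξ
            rw [hξ, invBessel_symbol]
        _ ≤ _ := by
            rw [lintegral_hat_sq]
            exact ENNReal.ofReal_le_ofReal (by gcongr; exact h n)
    have h2 : ∀ ξ, Tendsto (fun n : ℕ => ‖((cut n ξ * jb ξ ^ s : ℝ) : ℂ) * hat f ξ‖ₑ ^ 2) atTop
        (𝓝 (‖((jb ξ ^ s : ℝ) : ℂ) * hat f ξ‖ₑ ^ 2)) := by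
      intro ξ
      refine tendsto_const_nhds.congr' ?_
      filter_upwards [eventually_cut_eq_one ξ] with n hn
      rw [hn, one_mul]
    calc _ = ∫⁻ ξ, liminf (fun n : ℕ => ‖((cut n ξ * jb ξ ^ s : ℝ) : ℂ) * hat f ξ‖ₑ ^ 2) atTop := by
          simp_rw [(h2 _).liminf_eq]
      _ ≤ liminf (fun n : ℕ => ∫⁻ ξ, ‖((cut n ξ * jb ξ ^ s : ℝ) : ℂ) * hat f ξ‖ₑ ^ 2) atTop := by
          refine lintegral_liminf_le' fun n => ?_
          refine AEMeasurable.pow_const (AEStronglyMeasurable.enorm ?_) 2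
          exact (Complex.measurable_ofReal.comp
            ((measurable_cut n).mul (measurable_jb_rpow s))).aestronglyMeasurable.mul
              (Lp.aestronglyMeasurable _)
      _ ≤ _ := by
          refine liminf_le_of_le (by isBoundedDefault) fun b hb => ?_
          obtain ⟨n, hn⟩ := hb.exists
          exact hn.trans (h1 n)
  obtain ⟨V, h1, h2⟩ := exists_bessel_eq hs
    (memLp_two_of_lintegral (aestronglyMeasurable_jb_mul_hat s f)
      (key.trans_lt ENNReal.ofReal_lt_top))
  refine ⟨V, h1, ?_⟩
  have h3 : ENNReal.ofReal (‖V‖ ^ 2) ≤ ENNReal.ofReal (M ^ 2) := by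
    rw [← lintegral_hat_sq]
    refine le_trans (le_of_eq (lintegral_congr_ae ?_)) key
    filter_upwards [h2] with ξ hξ
    rw [hξ]
  rw [ENNReal.ofReal_le_ofReal_iff (by positivity)] at h3
  exact abs_le_of_sq_le_sq' h3 hM |>.2

/-! ### Estimates of symbols -/

/-- Lipschitz continuity of `r ↦ r ^ s` at `1`, from Bernoulli's inequality for `r` and `r⁻¹`. -/
theorem abs_rpow_sub_one_le {s r : ℝ} (hs : 1 ≤ s) (h0 : 0 < r) (h2 : r ≤ 2) :
    |r ^ s - 1| ≤ s * 2 ^ s * |r - 1| := by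
  have h2s : (1 : ℝ) ≤ 2 ^ s := Real.one_le_rpow (by norm_num) (by linarith)
  rcases le_total r 1 with h | h
  · have h1 := one_add_mul_self_le_rpow_one_add (s := r - 1) (by linarith) hs
    have h3 : r ^ s ≤ 1 := Real.rpow_le_one h0.le h (by linarith)
    rw [add_sub_cancel] at h1
    rw [abs_of_nonpos (by linarith), abs_of_nonpos (by linarith)]
    nlinarith [mul_nonneg (by linarith : 0 ≤ s) (by linarith : 0 ≤ 1 - r)]
  · have hr1 : 0 < r⁻¹ := by positivity
    have h1 := one_add_mul_self_le_rpow_one_add (s := r⁻¹ - 1) (by linarith) hs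
    rw [add_sub_cancel, Real.inv_rpow h0.le] at h1
    have h3 : 1 ≤ r ^ s := Real.one_le_rpow h (by linarith)
    have h4 : r ^ s ≤ 2 ^ s := Real.rpow_le_rpow h0.le h2 (by linarith)
    rw [abs_of_nonneg (by linarith), abs_of_nonneg (by linarith)]
    have h5 : r ^ s * (1 + s * (r⁻¹ - 1)) ≤ 1 := by
      calc _ ≤ r ^ s * (r ^ s)⁻¹ := by gcongr
        _ = 1 := mul_inv_cancel₀ (by linarith)
    have h6 : r⁻¹ - 1 = -(r⁻¹ * (r - 1)) := by field_simp; ring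
    rw [h6] at h5
    have h7 : r⁻¹ ≤ 1 := inv_le_one_of_one_le₀ h
    have h8 : r ^ s * (s * (r⁻¹ * (r - 1))) ≤ 2 ^ s * (s * (1 * (r - 1))) := by
      have : 0 ≤ r - 1 := by linarith
      gcongr
    nlinarith

/-- The weight that controls the symbols of commutators and products; `ζ` is the frequency of the
coefficient and `ξ - ζ`, `ξ` are the frequencies of the other two factors. -/
def triWeight (s : ℝ) (ζ ξ : Plane) : ℝ :=
  jb ζ + jb ζ ^ s * (jb (ξ - ζ) ^ (1 - s) + jb ξ ^ (1 - s))

/-- The constant in the symbol estimates. -/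
def symbolConst (s : ℝ) : ℝ := 3 ^ s + 2 ^ s + (1 + 2 ^ s) * (s * 2 ^ s)

/-- The symbol estimate behind the commutator estimate. It is applied with `x = ⟨ξ⟩`, `y = ⟨ξ -
ζ⟩`, `z = ⟨ζ⟩`, and `p`, `q` the `j`-th coordinates of `2π(ξ - ζ)` and `2πξ`. If `z` is small
compared with `y`, then `x` and `y` are comparable, and the two terms on the left differ by a
multiple of `z`, although each of them has the size of `y`. -/
theorem symbol_bound {s x y z p q : ℝ} (hs : 1 ≤ s) (hx : 1 ≤ x) (hy : 1 ≤ y) (hz : 1 ≤ z)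
    (hp : |p| ≤ y) (hq : |q| ≤ x) (hpq : |p - q| ≤ z) (hxy : |x - y| ≤ z) :
    |p * y ^ (-s) * x ^ s - q * x ^ (-s) * y ^ s|
      ≤ symbolConst s * (z + z ^ s * (y ^ (1 - s) + x ^ (1 - s))) := by
  have hx0 : 0 < x := by linarith
  have hy0 : 0 < y := by linarith
  have hz0 : 0 < z := by linarith
  have hs0 : 0 ≤ s := by linarith
  have e1 : y ^ (1 - s) = y * y ^ (-s) := by
    rw [sub_eq_add_neg, Real.rpow_add hy0, Real.rpow_one]
  have e2 : x ^ (1 - s) = x * x ^ (-s) := by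
    rw [sub_eq_add_neg, Real.rpow_add hx0, Real.rpow_one]
  have hY := Real.rpow_pos_of_pos hy0 (-s)
  have hX := Real.rpow_pos_of_pos hx0 (-s)
  have hYs := Real.rpow_pos_of_pos hy0 s
  have hXs := Real.rpow_pos_of_pos hx0 s
  have hZs := Real.rpow_pos_of_pos hz0 s
  have h2s := Real.rpow_pos_of_pos (zero_lt_two (α := ℝ)) s
  have h3s := Real.rpow_pos_of_pos (zero_lt_three (α := ℝ)) s
  obtain ⟨hxy1, hxy2⟩ := abs_le.1 hxy
  rw [e1, e2]
  rcases le_or_gt (2 * z) y with h | h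
  · -- low frequency of the coefficient: `x` and `y` are comparable
    set r := x / y with hr
    have hr0 : 0 < r := by positivity
    have hr2 : r ≤ 2 := by rw [hr, div_le_iff₀ hy0]; linarith
    have hr1 : 1 / 2 ≤ r := by rw [hr, le_div_iff₀ hy0]; linarith
    have hrs : y ^ (-s) * x ^ s = r ^ s := by
      rw [hr, Real.div_rpow hx0.le hy0.le, Real.rpow_neg hy0.le]; field_simp
    have hrs' : x ^ (-s) * y ^ s = (r ^ s)⁻¹ := by
      rw [hr, Real.div_rpow hx0.le hy0.le, Real.rpow_neg hx0.le]; field_simp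
    have hrinv : (r ^ s)⁻¹ ≤ 2 ^ s := by
      rw [← Real.inv_rpow hr0.le]
      refine Real.rpow_le_rpow (by positivity) ?_ hs0
      rw [inv_le_comm₀ hr0 two_pos]; linarith
    have hrsp : 0 < r ^ s := by positivity
    have h1 := abs_rpow_sub_one_le hs hr0 hr2
    have h2 : |r ^ s - (r ^ s)⁻¹| ≤ (1 + 2 ^ s) * (s * 2 ^ s * |r - 1|) := by
      have : r ^ s - (r ^ s)⁻¹ = (1 + (r ^ s)⁻¹) * (r ^ s - 1) := by field_simp; ring
      rw [this, abs_mul, abs_of_pos (by positivity)]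
      gcongr
    have h3 : |r - 1| * y ≤ z := by
      have : r - 1 = (x - y) / y := by rw [hr]; field_simp
      rw [this, abs_div, abs_of_pos hy0, div_mul_cancel₀ _ hy0.ne']
      exact hxy
    have h4 : p * y ^ (-s) * x ^ s - q * x ^ (-s) * y ^ s
        = p * (r ^ s - (r ^ s)⁻¹) + (p - q) * (r ^ s)⁻¹ := by
      rw [mul_assoc p, mul_assoc q, hrs, hrs']; ring
    rw [h4]
    calc _ ≤ |p| * |r ^ s - (r ^ s)⁻¹| + |p - q| * (r ^ s)⁻¹ := by
          refine (abs_add_le _ _).trans ?_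
          rw [abs_mul, abs_mul, abs_of_pos (inv_pos.2 hrsp)]
      _ ≤ y * ((1 + 2 ^ s) * (s * 2 ^ s * |r - 1|)) + z * 2 ^ s := by gcongr
      _ = (1 + 2 ^ s) * (s * 2 ^ s) * (|r - 1| * y) + 2 ^ s * z := by ring
      _ ≤ (1 + 2 ^ s) * (s * 2 ^ s) * z + 2 ^ s * z := by gcongr
      _ ≤ symbolConst s * z := by rw [symbolConst]; nlinarith
      _ ≤ _ := by
          have : 0 ≤ symbolConst s := by rw [symbolConst]; positivity
          gcongr
          have : 0 ≤ z ^ s * (y * y ^ (-s) + x * x ^ (-s)) := by positivity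
          linarith
  · -- high frequency of the coefficient
    have hxz : x ^ s ≤ 3 ^ s * z ^ s := by
      rw [← Real.mul_rpow (by norm_num) hz0.le]
      exact Real.rpow_le_rpow hx0.le (by linarith) hs0
    have hyz : y ^ s ≤ 3 ^ s * z ^ s := by
      rw [← Real.mul_rpow (by norm_num) hz0.le]
      exact Real.rpow_le_rpow hy0.le (by linarith) hs0
    calc _ ≤ |p| * y ^ (-s) * x ^ s + |q| * x ^ (-s) * y ^ s := by
          refine (abs_sub _ _).trans (le_of_eq ?_)
          rw [abs_mul, abs_mul, abs_mul, abs_mul, abs_of_pos hY, abs_of_pos hX, abs_of_pos hXs,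
            abs_of_pos hYs]
      _ ≤ y * y ^ (-s) * (3 ^ s * z ^ s) + x * x ^ (-s) * (3 ^ s * z ^ s) := by gcongr
      _ = 3 ^ s * (z ^ s * (y * y ^ (-s) + x * x ^ (-s))) := by ring
      _ ≤ symbolConst s * (z ^ s * (y * y ^ (-s) + x * x ^ (-s))) := by
          gcongr
          rw [symbolConst]
          have : 0 ≤ (1 + (2 : ℝ) ^ s) * (s * 2 ^ s) := by positivity
          linarith
      _ ≤ _ := by
          have : 0 ≤ symbolConst s := by rw [symbolConst]; positivity
          gcongr
          linarith

/-- The symbol estimate behind the product estimate in `H^s`, with `x`, `y`,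
    `z` as in `symbol_bound`. -/
theorem symbol_product_bound {s x y z : ℝ} (hs : 1 ≤ s) (hx : 1 ≤ x) (hy : 1 ≤ y) (hz : 1 ≤ z)
    (hxy : |x - y| ≤ z) :
    y ^ (-s) * x ^ s ≤ symbolConst s * (z + z ^ s * (y ^ (1 - s) + x ^ (1 - s))) := by
  have hx0 : 0 < x := by linarith
  have hy0 : 0 < y := by linarith
  have hz0 : 0 < z := by linarith
  have hs0 : 0 ≤ s := by linarith
  have hY := Real.rpow_pos_of_pos hy0 (-s)
  have hX1 := Real.rpow_pos_of_pos hx0 (1 - s)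
  have hZs := Real.rpow_pos_of_pos hz0 s
  have h2s := Real.rpow_pos_of_pos (zero_lt_two (α := ℝ)) s
  have h3s := Real.rpow_pos_of_pos (zero_lt_three (α := ℝ)) s
  have hc : 2 ^ s ≤ symbolConst s := by
    rw [symbolConst]
    have : 0 ≤ (1 + (2 : ℝ) ^ s) * (s * 2 ^ s) := by positivity
    linarith
  obtain ⟨hxy1, hxy2⟩ := abs_le.1 hxy
  have h1 : x ^ s ≤ 2 ^ s * (y ^ s + z ^ s) := by
    have hm : x ≤ 2 * max y z := by
      have := le_max_left y z
      have := le_max_right y z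
      linarith
    have hm0 : 0 < max y z := lt_max_of_lt_left hy0
    calc x ^ s ≤ (2 * max y z) ^ s := Real.rpow_le_rpow hx0.le hm hs0
      _ = 2 ^ s * (max y z) ^ s := Real.mul_rpow (by norm_num) hm0.le
      _ ≤ _ := by
          have hYs := Real.rpow_pos_of_pos hy0 s
          gcongr
          rcases max_choice y z with h | h <;> rw [h] <;> linarith
  have h2 : y ^ (-s) * y ^ s = 1 := by rw [← Real.rpow_add hy0]; simp
  have h3 : y ^ (-s) ≤ y ^ (1 - s) := Real.rpow_le_rpow_of_exponent_le hy (by linarith)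
  calc _ ≤ y ^ (-s) * (2 ^ s * (y ^ s + z ^ s)) := by gcongr
    _ = 2 ^ s * (1 + z ^ s * y ^ (-s)) := by linear_combination 2 ^ s * h2
    _ ≤ 2 ^ s * (z + z ^ s * (y ^ (1 - s) + x ^ (1 - s))) := by
        gcongr
        linarith
    _ ≤ _ := by gcongr

theorem symbolConst_nonneg {s : ℝ} (hs : 2 < s) : 0 ≤ symbolConst s := by
  rw [symbolConst]; positivity

/-! ### Coefficients and trilinear estimates -/

/-- `a` is a superposition `∫ α(ζ) e^{2πi ζ·x} dν(ζ)` of plane waves which is an admissible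
coefficient in `H^s` with constant `C`. Both `H^s` functions (`ν` is the area, `α` the Fourier
transform) and profiles that depend on `x₁` only (`ν` is the length on a line) are of this form. -/
def IsCoef (s : ℝ) (a : Plane → ℝ) (C : ℝ) : Prop :=
  ∃ (ν : Measure Plane) (_ : SFinite ν) (α : Plane → ℂ), Measurable α ∧
    (∀ᵐ x, (a x : ℂ) = ∫ ζ, α ζ * planeWave ζ x ∂ν) ∧
    (∫⁻ ζ, ‖α ζ‖ₑ * ENNReal.ofReal (jb ζ) ∂ν ≤ ENNReal.ofReal C) ∧
    ∀ h g : Plane → ℝ≥0∞, Measurable h → Measurable g →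
      ∫⁻ ζ, ‖α ζ‖ₑ * (∫⁻ ξ, ENNReal.ofReal (triWeight s ζ ξ) * (h (ξ - ζ) * g ξ)) ∂ν
        ≤ ENNReal.ofReal C * ((∫⁻ ξ, h ξ ^ 2) ^ (1 / 2 : ℝ) * (∫⁻ ξ, g ξ ^ 2) ^ (1 / 2 : ℝ))

theorem IsCoef.mono {s : ℝ} {a : Plane → ℝ} {C C' : ℝ} (h : IsCoef s a C) (hC : C ≤ C') :
    IsCoef s a C' := by
  obtain ⟨ν, hν, α, h1, h2, h3, h4⟩ := h
  refine ⟨ν, hν, α, h1, h2, h3.trans (ENNReal.ofReal_le_ofReal hC), fun h g hh hg => ?_⟩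
  refine (h4 h g hh hg).trans ?_
  gcongr

theorem lintegral_enorm_le_of_jb {ν : Measure Plane} {α : Plane → ℂ} {C : ℝ}
    (h : ∫⁻ ζ, ‖α ζ‖ₑ * ENNReal.ofReal (jb ζ) ∂ν ≤ ENNReal.ofReal C) :
    ∫⁻ ζ, ‖α ζ‖ₑ ∂ν ≤ ENNReal.ofReal C := by
  refine le_trans (lintegral_mono fun ζ => ?_) h
  exact le_mul_of_one_le_right zero_le (by simpa using one_le_jb ζ)

theorem norm_integral_plane_waves_le {ν : Measure Plane} {α : Plane → ℂ} {C : ℝ} (hC : 0 ≤ C)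
    (h : ∫⁻ ζ, ‖α ζ‖ₑ ∂ν ≤ ENNReal.ofReal C) (x : Plane) :
    ‖∫ ζ, α ζ * planeWave ζ x ∂ν‖ ≤ C := by
  refine (norm_integral_le_lintegral_norm _).trans ?_
  refine ENNReal.toReal_le_of_le_ofReal hC (le_trans (le_of_eq ?_) h)
  congr 1; ext ζ
  rw [ofReal_norm, enorm_mul, enorm_planeWave, mul_one]

/-- Admissible coefficients are bounded. -/
theorem IsCoef.abs_le {s : ℝ} {a : Plane → ℝ} {C : ℝ} (hC : 0 ≤ C) (h : IsCoef s a C) :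
    ∀ᵐ x, |a x| ≤ C := by
  obtain ⟨ν, _, α, h1, h2, h3, -⟩ := h
  filter_upwards [h2] with x hx
  rw [← Real.norm_eq_abs, ← Complex.norm_real, hx]
  exact norm_integral_plane_waves_le hC (lintegral_enorm_le_of_jb h3) x

theorem continuous_planeWave : Continuous fun p : Plane × Plane =>
    planeWave p.2 p.1 :=
  continuous_subtype_val.comp (Real.continuous_fourierChar.comp
      (continuous_snd.inner continuous_fst))

theorem continuous_integral_plane_waves {ν : Measure Plane} {α : Plane → ℂ} (h : Integrable α ν) :
    Continuous fun x => ∫ ζ, α ζ * planeWave ζ x ∂ν := by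
  refine continuous_of_dominated (bound := fun ζ => ‖α ζ‖) (fun x => ?_) (fun x => ?_) h.norm ?_
  · exact h.1.mul (continuous_planeWave.comp (Continuous.prodMk_right x)).aestronglyMeasurable
  · exact Eventually.of_forall fun ζ => by rw [norm_mul, norm_planeWave, mul_one]
  · exact Eventually.of_forall fun ζ =>
      continuous_const.mul (continuous_planeWave.comp (Continuous.prodMk_left ζ))

theorem integrable_of_jb {ν : Measure Plane} {α : Plane → ℂ} {C : ℝ} (hm : Measurable α)
    (h : ∫⁻ ζ, ‖α ζ‖ₑ * ENNReal.ofReal (jb ζ) ∂ν ≤ ENNReal.ofReal C) : Integrable α ν :=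
  ⟨hm.aestronglyMeasurable, (lintegral_enorm_le_of_jb h).trans_lt ENNReal.ofReal_lt_top⟩

theorem IsCoef.aestronglyMeasurable {s : ℝ} {a : Plane → ℝ} {C : ℝ} (h : IsCoef s a C) :
    AEStronglyMeasurable a := by
  obtain ⟨ν, _, α, h1, h2, h3, -⟩ := h
  have hc := Complex.continuous_re.comp (continuous_integral_plane_waves (integrable_of_jb h1 h3))
  refine hc.aestronglyMeasurable.congr ?_
  filter_upwards [h2] with x hx
  rw [Function.comp_apply, ← hx, Complex.ofReal_re]

/-- Fubini's theorem for a superposition of plane waves. -/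
theorem integral_plane_waves_mul {ν : Measure Plane} [SFinite ν] {α : Plane → ℂ}
    (hα : Integrable α ν) {a : Plane → ℝ}
    (ha : ∀ᵐ x, (a x : ℂ) = ∫ ζ, α ζ * planeWave ζ x ∂ν)
    {Φ : Plane → ℝ} (hΦ : Integrable Φ) :
    ((∫ x, a x * Φ x : ℝ) : ℂ)
      = ∫ ζ, α ζ * (∫ x, planeWave ζ x * (Φ x : ℂ)) ∂ν := by
  rw [← integral_complex_ofReal]
  calc ∫ x, ((a x * Φ x : ℝ) : ℂ)
      = ∫ x, ∫ ζ, α ζ * planeWave ζ x * (Φ x : ℂ) ∂ν := by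
        refine integral_congr_ae ?_
        filter_upwards [ha] with x hx
        rw [integral_mul_const, ← hx]; push_cast; rfl
    _ = ∫ ζ, (∫ x, α ζ * planeWave ζ x * (Φ x : ℂ)) ∂ν := by
        refine integral_integral_swap ?_
        have h1 : Integrable (fun p : Plane × Plane => (Φ p.1 : ℂ) * α p.2) (volume.prod ν) :=
          hΦ.ofReal.mul_prod hα
        refine (h1.bdd_mul (c := 1) continuous_planeWave.aestronglyMeasurable
          (Eventually.of_forall fun p => (norm_planeWave _ _).le)).congr
              (Eventually.of_forall fun p => ?_)
        simp only [Function.uncurry]; ring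
    _ = _ := by
        congr 1; ext ζ
        rw [← integral_const_mul]
        congr 1; ext x; ring

/-- Parseval's identity for a modulated product. -/
theorem integral_planeWave_mul (ζ : Plane) (f g : L2) :
    ∫ x, planeWave ζ x * ((f x * g x : ℝ) : ℂ)
      = ∫ ξ, hat f (ξ - ζ) * conj (hat g ξ) := by
  have hF : MemLp (fun x => planeWave ζ x * complexify f x) 2 := by
    refine MemLp.of_le (Lp.memLp (complexify f)) ?_ (Eventually.of_forall fun x => by
      rw [norm_mul, norm_planeWave, one_mul])
    exact (continuous_planeWave.comp (Continuous.prodMk_left ζ)).aestronglyMeasurable.mul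
      (Lp.aestronglyMeasurable _)
  have h := Lp.inner_fourier_eq (complexify g) (hF.toLp _)
  rw [L2.inner_def, L2.inner_def] at h
  have h2 := fourier_of_modulate ζ hF.coeFn_toLp
  calc _ = ∫ x, inner ℂ (complexify g x) ((hF.toLp _ : CL2) x) := by
        refine integral_congr_ae ?_
        filter_upwards [coeFn_complexify f, coeFn_complexify g, hF.coeFn_toLp] with x h1 h2 h3
        rw [h3, h1, h2, RCLike.inner_apply, Complex.conj_ofReal]; push_cast; ring
    _ = _ := by
        rw [← h]
        refine integral_congr_ae ?_
        filter_upwards [h2] with ξ hξ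
        rw [hξ]
        rw [RCLike.inner_apply]; rfl

theorem ae_translate {p : Plane → Prop} (h : ∀ᵐ ξ, p ξ) (ζ : Plane) : ∀ᵐ ξ, p (ξ - ζ) :=
  (measurePreserving_sub_right (volume : Measure Plane) ζ).quasiMeasurePreserving.ae h

theorem integrable_hat_mul (f g : L2) (ζ : Plane) :
    Integrable fun ξ => hat f (ξ - ζ) * conj (hat g ξ) :=
  ((Lp.memLp (hat f)).comp_measurePreserving
    (measurePreserving_sub_right volume ζ)).integrable_mul (memLp_conj (Lp.memLp _))

/-- The estimate of a trilinear form in the frequency variables by that of its kernel. -/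
theorem abs_le_of_kernel {s : ℝ} (hs : 2 < s) {ν : Measure Plane} {α : Plane → ℂ} {C : ℝ}
    (hα : ∀ h g : Plane → ℝ≥0∞, Measurable h → Measurable g →
      ∫⁻ ζ, ‖α ζ‖ₑ * (∫⁻ ξ, ENNReal.ofReal (triWeight s ζ ξ) * (h (ξ - ζ) * g ξ)) ∂ν
        ≤ ENNReal.ofReal C * ((∫⁻ ξ, h ξ ^ 2) ^ (1 / 2 : ℝ) * (∫⁻ ξ, g ξ ^ 2) ^ (1 / 2 : ℝ)))
    (hC : 0 ≤ C) (V W : L2) {T : ℝ} {κ : Plane → Plane → ℂ}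
    (hκ : ∀ ζ ξ, ‖κ ζ ξ‖ ≤ symbolConst s * triWeight s ζ ξ)
    (hT : (T : ℂ) = ∫ ζ, α ζ * (∫ ξ, κ ζ ξ * (hat V (ξ - ζ) * conj (hat W ξ))) ∂ν) :
    |T| ≤ symbolConst s * C * (‖V‖ * ‖W‖) := by
  have hc := symbolConst_nonneg hs
  rw [← Real.norm_eq_abs, ← Complex.norm_real, hT]
  have hm : ∀ f : L2, Measurable fun ξ => ‖hat f ξ‖ₑ := fun f =>
    (Lp.stronglyMeasurable (hat f)).enorm
  have h1 := hα _ _ (hm V) (hm W)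
  rw [sqrt_lintegral_hat, sqrt_lintegral_hat, ← ENNReal.ofReal_mul (norm_nonneg _),
    ← ENNReal.ofReal_mul hC] at h1
  rw [← ENNReal.ofReal_le_ofReal_iff (by positivity), ofReal_norm]
  refine (enorm_integral_le_lintegral_enorm _).trans ?_
  rw [mul_assoc, ENNReal.ofReal_mul hc]
  refine le_trans ?_ (mul_le_mul_right h1 _)
  rw [← lintegral_const_mul' _ _ ENNReal.ofReal_ne_top]
  refine lintegral_mono fun ζ => ?_
  rw [enorm_mul, mul_left_comm]
  gcongr
  refine (enorm_integral_le_lintegral_enorm _).trans ?_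
  rw [← lintegral_const_mul' _ _ ENNReal.ofReal_ne_top]
  refine lintegral_mono fun ξ => ?_
  rw [enorm_mul, enorm_mul (hat V _), ← mul_assoc (ENNReal.ofReal _), ← ENNReal.ofReal_mul hc]
  have : ‖conj (hat W ξ)‖ₑ = ‖hat W ξ‖ₑ := by
    rw [← ofReal_norm, ← ofReal_norm, RCLike.norm_conj]
  rw [this]
  gcongr
  rw [← ofReal_norm]
  exact ENNReal.ofReal_le_ofReal (hκ ζ ξ)

theorem abs_coord_sub_le (ζ ξ : Plane) (j : Fin 2) :
    |2 * Real.pi * (ξ - ζ) j - 2 * Real.pi * ξ j| ≤ jb ζ := by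
  have := two_pi_coord_le_jb ζ j
  rw [← abs_neg] at this
  convert this using 2
  simp; ring

/-- The commutator estimate. The first-order operator with coefficient `a` couples two components
symmetrically, so that the derivative which is lost falls on `a`. -/
theorem IsCoef.abs_integral_symm_le {s : ℝ} (hs : 2 < s) {a : Plane → ℝ} {C : ℝ} (hC : 0 ≤ C)
    (ha : IsCoef s a C) (j : Fin 2) (n : ℕ) (V W : L2) :
    |∫ x, a x * ((dBessel hs j).op ((proj n).op V) x * (invBessel hs n).op W x
        + (dBessel hs j).op ((proj n).op W) x * (invBessel hs n).op V x)|
      ≤ symbolConst s * C * (‖V‖ * ‖W‖) := by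
  obtain ⟨ν, _, α, h1, h2, h3, h4⟩ := ha
  refine abs_le_of_kernel hs h4 hC V W (κ := fun ζ ξ => ((cut n (ξ - ζ) * cut n ξ : ℝ) : ℂ) *
    (Complex.I * ((2 * Real.pi * (ξ - ζ) j * jb (ξ - ζ) ^ (-s) * jb ξ ^ s
      - 2 * Real.pi * ξ j * jb ξ ^ (-s) * jb (ξ - ζ) ^ s : ℝ) : ℂ))) ?_ ?_
  · intro ζ ξ
    rw [norm_mul, norm_mul, Complex.norm_I, one_mul, Complex.norm_real, Complex.norm_real,
      Real.norm_eq_abs, Real.norm_eq_abs, abs_mul]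
    have hb := symbol_bound (s := s) (by linarith) (one_le_jb ξ) (one_le_jb (ξ - ζ)) (one_le_jb ζ)
      (two_pi_coord_le_jb (ξ - ζ) j) (two_pi_coord_le_jb ξ j) (abs_coord_sub_le ζ ξ j)
      (abs_jb_sub_le ξ ζ)
    refine le_trans ?_ hb
    have hc : |cut n (ξ - ζ)| * |cut n ξ| ≤ 1 :=
      mul_le_one₀ (abs_cut_le_one _ _) (abs_nonneg _) (abs_cut_le_one _ _)
    exact mul_le_of_le_one_left (abs_nonneg _) hc
  · rw [integral_plane_waves_mul (integrable_of_jb h1 h3) h2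
      (Φ := fun x => (dBessel hs j).op ((proj n).op V) x * (invBessel hs n).op W x
        + (dBessel hs j).op ((proj n).op W) x * (invBessel hs n).op V x)
      ((integrable_mul_L2 _ _).add (integrable_mul_L2 _ _))]
    congr 1; ext ζ
    congr 1
    have e1 : ∀ x, planeWave ζ x *
        (((dBessel hs j).op ((proj n).op V) x * (invBessel hs n).op W x
          + (dBessel hs j).op ((proj n).op W) x * (invBessel hs n).op V x : ℝ) : ℂ)
        = planeWave ζ x *
            (((dBessel hs j).op ((proj n).op V) x * (invBessel hs n).op W x : ℝ) : ℂ)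
          + planeWave ζ x *
            (((invBessel hs n).op V x * (dBessel hs j).op ((proj n).op W) x : ℝ) : ℂ) := by
      intro x; push_cast; ring
    have hi : ∀ f g : L2, Integrable fun x => planeWave ζ x *
        ((f x * g x : ℝ) : ℂ) := fun f g =>
      (integrable_mul_L2 f g).ofReal.bdd_mul (c := 1)
        (continuous_planeWave.comp (Continuous.prodMk_left ζ)).aestronglyMeasurable
        (Eventually.of_forall fun x => (norm_planeWave _ _).le)
    simp_rw [e1]
    rw [integral_add (hi _ _) (hi _ _), integral_planeWave_mul, integral_planeWave_mul,
      ← integral_add (integrable_hat_mul _ _ _) (integrable_hat_mul _ _ _)]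
    refine integral_congr_ae ?_
    filter_upwards [ae_translate ((dBessel hs j).hat_op ((proj n).op V)) ζ,
      ae_translate ((proj n).hat_op V) ζ, ae_translate ((invBessel hs n).hat_op V) ζ,
      (dBessel hs j).hat_op ((proj n).op W), (proj n).hat_op W, (invBessel hs n).hat_op W]
      with ξ a1 a2 a3 b1 b2 b3
    rw [a1, a2, a3, b1, b2, b3]
    simp only [dBessel_symbol, proj_symbol, invBessel_symbol, map_mul, Complex.conj_ofReal,
      Complex.conj_I]
    push_cast
    ring

/-- The product estimate `‖a u‖_{H^s} ≤ C ‖u‖_{H^s}`. -/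
theorem IsCoef.exists_mul_bessel {s : ℝ} (hs : 2 < s) {a : Plane → ℝ} {C : ℝ} (hC : 0 ≤ C)
    (ha : IsCoef s a C) (V : L2) :
    ∃ Z : L2, ‖Z‖ ≤ symbolConst s * C * ‖V‖ ∧
      (bessel hs).op Z =ᵐ[volume] fun x => a x * (bessel hs).op V x := by
  have hm : MemLp (fun x => a x * (bessel hs).op V x) 2 := by
    refine MemLp.of_le_mul (c := C) (Lp.memLp ((bessel hs).op V))
      (ha.aestronglyMeasurable.mul (Lp.aestronglyMeasurable _)) ?_
    filter_upwards [ha.abs_le hC] with x hx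
    rw [norm_mul]
    gcongr
    exact hx
  set f : L2 := hm.toLp _
  have hf := hm.coeFn_toLp
  obtain ⟨ν, _, α, h1, h2, h3, h4⟩ := ha
  have key : ∀ n, ‖(invBessel hs n).op f‖ ≤ symbolConst s * C * ‖V‖ := by
    intro n
    set g := (invBessel hs n).op f
    have hg : ‖g‖ ^ 2 = ∫ x, a x * ((bessel hs).op V x * (invBessel hs n).op g x) := by
      rw [← real_inner_self_eq_norm_sq, (invBessel hs n).inner_op_of_real
        (fun ξ => by rw [invBessel_symbol, Complex.conj_ofReal]), inner_eq_integral]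
      refine integral_congr_ae ?_
      filter_upwards [hf] with x hx
      rw [hx, mul_assoc]
    have hb : |‖g‖ ^ 2| ≤ symbolConst s * C * (‖V‖ * ‖g‖) := by
      rw [hg]
      refine abs_le_of_kernel hs h4 hC V g (κ := fun ζ ξ =>
        ((cut n ξ * (jb (ξ - ζ) ^ (-s) * jb ξ ^ s) : ℝ) : ℂ)) ?_ ?_
      · intro ζ ξ
        rw [Complex.norm_real, Real.norm_eq_abs, abs_mul]
        have h0 : 0 ≤ jb (ξ - ζ) ^ (-s) * jb ξ ^ s :=
          mul_nonneg (Real.rpow_nonneg (jb_pos _).le _) (Real.rpow_nonneg (jb_pos _).le _)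
        rw [abs_of_nonneg h0]
        exact (mul_le_of_le_one_left h0 (abs_cut_le_one n ξ)).trans
          (symbol_product_bound (by linarith) (one_le_jb ξ) (one_le_jb (ξ - ζ)) (one_le_jb ζ)
            (abs_jb_sub_le ξ ζ))
      · rw [integral_plane_waves_mul (integrable_of_jb h1 h3) h2 (integrable_mul_L2 _ _)]
        congr 1; ext ζ
        congr 1
        rw [integral_planeWave_mul]
        refine integral_congr_ae ?_
        filter_upwards [ae_translate ((bessel hs).hat_op V) ζ, (invBessel hs n).hat_op g]
          with ξ a1 a2
        rw [a1, a2]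
        simp only [bessel_symbol, invBessel_symbol, map_mul, Complex.conj_ofReal]
        push_cast
        ring
    rw [abs_of_nonneg (sq_nonneg _)] at hb
    rcases (norm_nonneg g).eq_or_lt with h0 | h0
    · rw [← h0]
      have := symbolConst_nonneg hs
      positivity
    · refine le_of_mul_le_mul_right ?_ h0
      calc _ = ‖g‖ ^ 2 := by ring
        _ ≤ _ := hb
        _ = _ := by ring
  obtain ⟨Z, hZ1, hZ2⟩ := exists_bessel_of_bounded hs key
  refine ⟨Z, hZ2, ?_⟩
  rw [← hZ1]
  exact hf

/-- The `L²` version of the commutator estimate: integration by parts against the coefficient. -/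
theorem IsCoef.abs_integral_symm_L2_le {s : ℝ} (hs : 2 < s) {a : Plane → ℝ} {C : ℝ} (hC : 0 ≤ C)
    (ha : IsCoef s a C) (j : Fin 2) (V W : L2) :
    |∫ x, a x * ((dBessel hs j).op V x * (bessel hs).op W x
        + (dBessel hs j).op W x * (bessel hs).op V x)|
      ≤ C * (‖(bessel hs).op V‖ * ‖(bessel hs).op W‖) := by
  obtain ⟨ν, _, α, h1, h2, h3, h4⟩ := ha
  set T := ∫ x, a x * ((dBessel hs j).op V x * (bessel hs).op W x
        + (dBessel hs j).op W x * (bessel hs).op V x) with hTdef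
  have hT : (T : ℂ) = ∫ ζ, α ζ * (∫ ξ, (Complex.I * ((2 * Real.pi * (ξ - ζ) j
      - 2 * Real.pi * ξ j : ℝ) : ℂ)) *
        (hat ((bessel hs).op V) (ξ - ζ) * conj (hat ((bessel hs).op W) ξ))) ∂ν := by
    rw [hTdef, integral_plane_waves_mul (integrable_of_jb h1 h3) h2
      (Φ := fun x => (dBessel hs j).op V x * (bessel hs).op W x
        + (dBessel hs j).op W x * (bessel hs).op V x)
      ((integrable_mul_L2 _ _).add (integrable_mul_L2 _ _))]
    congr 1; ext ζ
    congr 1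
    have e1 : ∀ x, planeWave ζ x *
        (((dBessel hs j).op V x * (bessel hs).op W x
          + (dBessel hs j).op W x * (bessel hs).op V x : ℝ) : ℂ)
        = planeWave ζ x *
            (((dBessel hs j).op V x * (bessel hs).op W x : ℝ) : ℂ)
          + planeWave ζ x *
            (((bessel hs).op V x * (dBessel hs j).op W x : ℝ) : ℂ) := by
      intro x; push_cast; ring
    have hi : ∀ f g : L2, Integrable fun x => planeWave ζ x *
        ((f x * g x : ℝ) : ℂ) := fun f g =>
      (integrable_mul_L2 f g).ofReal.bdd_mul (c := 1)
        (continuous_planeWave.comp (Continuous.prodMk_left ζ)).aestronglyMeasurable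
        (Eventually.of_forall fun x => (norm_planeWave _ _).le)
    simp_rw [e1]
    rw [integral_add (hi _ _) (hi _ _), integral_planeWave_mul, integral_planeWave_mul,
      ← integral_add (integrable_hat_mul _ _ _) (integrable_hat_mul _ _ _)]
    refine integral_congr_ae ?_
    filter_upwards [ae_translate ((dBessel hs j).hat_op V) ζ,
      ae_translate ((bessel hs).hat_op V) ζ, (dBessel hs j).hat_op W, (bessel hs).hat_op W]
      with ξ a1 a2 b1 b2
    rw [a1, a2, b1, b2]
    simp only [dBessel_symbol, bessel_symbol, map_mul, Complex.conj_ofReal, Complex.conj_I]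
    push_cast
    ring
  rw [← Real.norm_eq_abs, ← Complex.norm_real, hT, ← ENNReal.ofReal_le_ofReal_iff (by positivity),
    ofReal_norm, ENNReal.ofReal_mul hC]
  refine (enorm_integral_le_lintegral_enorm _).trans ?_
  refine le_trans ?_ (mul_le_mul_left h3 _)
  rw [← lintegral_mul_const' _ _ ENNReal.ofReal_ne_top]
  refine lintegral_mono fun ζ => ?_
  rw [enorm_mul, mul_assoc]
  gcongr
  refine (enorm_integral_le_lintegral_enorm _).trans ?_
  set v := (bessel hs).op V
  set w := (bessel hs).op W
  have hb : ∀ ξ, ‖(Complex.I * ((2 * Real.pi * (ξ - ζ) j - 2 * Real.pi * ξ j : ℝ) : ℂ)) *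
        (hat v (ξ - ζ) * conj (hat w ξ))‖ₑ
      ≤ ENNReal.ofReal (jb ζ) * (‖hat v (ξ - ζ)‖ₑ * ‖hat w ξ‖ₑ) := by
    intro ξ
    have : ‖conj (hat w ξ)‖ₑ = ‖hat w ξ‖ₑ := by
      rw [← ofReal_norm, ← ofReal_norm, RCLike.norm_conj]
    rw [enorm_mul, enorm_mul (hat v _), this]
    gcongr
    rw [← ofReal_norm, norm_mul, Complex.norm_I, one_mul, Complex.norm_real]
    exact ENNReal.ofReal_le_ofReal (abs_coord_sub_le ζ ξ j)
  refine (lintegral_mono hb).trans ?_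
  rw [lintegral_const_mul' _ _ ENNReal.ofReal_ne_top]
  gcongr
  have hm : ∀ f : L2, Measurable fun ξ => ‖hat f ξ‖ₑ := fun f =>
    (Lp.stronglyMeasurable (hat f)).enorm
  refine (lintegral_mul_le_sqrt ((hm v).comp (measurable_sub_const ζ)).aemeasurable
    (hm w).aemeasurable).trans ?_
  simp only [Function.comp_apply]
  rw [lintegral_sub_right_eq_self (fun ξ => ‖hat v ξ‖ₑ ^ 2) ζ, sqrt_lintegral_hat,
    sqrt_lintegral_hat, ENNReal.ofReal_mul (norm_nonneg _)]

/-! ### Admissible coefficients: Sobolev functions and line profiles -/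

/-- Young's inequality for a trilinear form, with the coefficient in `L¹`. In the two variants below
another one of the three functions is in `L¹`. -/
theorem lintegral_conv_le {A B G : Plane → ℝ≥0∞} {ν : Measure Plane} (hA : Measurable A) (hB :
    Measurable B)
    (hG : Measurable G) :
    ∫⁻ ζ, A ζ * (∫⁻ ξ, B (ξ - ζ) * G ξ) ∂ν
      ≤ (∫⁻ ζ, A ζ ∂ν) * ((∫⁻ ξ, B ξ ^ 2) ^ (1 / 2 : ℝ) * (∫⁻ ξ, G ξ ^ 2) ^ (1 / 2 : ℝ)) := by
  have h : ∀ ζ, ∫⁻ ξ, B (ξ - ζ) * G ξ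
      ≤ (∫⁻ ξ, B ξ ^ 2) ^ (1 / 2 : ℝ) * (∫⁻ ξ, G ξ ^ 2) ^ (1 / 2 : ℝ) := by
    intro ζ
    refine (lintegral_mul_le_sqrt (hB.comp (measurable_sub_const ζ)).aemeasurable
      hG.aemeasurable).trans ?_
    simp only [Function.comp_apply]
    rw [lintegral_sub_right_eq_self (fun ξ => B ξ ^ 2) ζ]
  calc _ ≤ ∫⁻ ζ, A ζ * ((∫⁻ ξ, B ξ ^ 2) ^ (1 / 2 : ℝ) * (∫⁻ ξ, G ξ ^ 2) ^ (1 / 2 : ℝ)) ∂ν :=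
        lintegral_mono fun ζ => mul_le_mul_right (h ζ) _
    _ ≤ _ := (lintegral_mul_const _ hA).le

theorem lintegral_conv_swap {A B G : Plane → ℝ≥0∞} (hA : Measurable A) (hB : Measurable B)
    (hG : Measurable G) :
    ∫⁻ ζ, A ζ * (∫⁻ ξ, B (ξ - ζ) * G ξ) = ∫⁻ ξ, G ξ * (∫⁻ ζ, A ζ * B (ξ - ζ)) := by
  have h1 : ∀ ζ, A ζ * (∫⁻ ξ, B (ξ - ζ) * G ξ) = ∫⁻ ξ, A ζ * (B (ξ - ζ) * G ξ) := fun ζ =>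
    (lintegral_const_mul _ ((hB.comp (measurable_sub_const ζ)).mul hG)).symm
  have h2 : ∀ ξ, G ξ * (∫⁻ ζ, A ζ * B (ξ - ζ)) = ∫⁻ ζ, A ζ * (B (ξ - ζ) * G ξ) := fun ξ => by
    have h3 : Measurable fun ζ => A ζ * B (ξ - ζ) := hA.mul (hB.comp (measurable_const_sub ξ))
    rw [← lintegral_const_mul _ h3]
    congr 1; ext ζ; ring
  simp_rw [h1, h2]
  refine lintegral_lintegral_swap ?_
  have h3 : Measurable fun p : Plane × Plane => A p.1 * (B (p.2 - p.1) * G p.2) := by fun_prop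
  exact h3.aemeasurable

theorem lintegral_conv_comm (A B : Plane → ℝ≥0∞) (ξ : Plane) :
    ∫⁻ ζ, A ζ * B (ξ - ζ) = ∫⁻ ζ, B ζ * A (ξ - ζ) := by
  rw [← lintegral_sub_left_eq_self (fun ζ => A ζ * B (ξ - ζ)) ξ]
  congr 1; ext ζ; rw [sub_sub_cancel, mul_comm]

/-- Young's inequality for a trilinear form, with the second function in `L¹`. -/
theorem lintegral_conv_le_left {A B G : Plane → ℝ≥0∞} (hA : Measurable A) (hB : Measurable B)
    (hG : Measurable G) :
    ∫⁻ ζ, A ζ * (∫⁻ ξ, B (ξ - ζ) * G ξ)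
      ≤ (∫⁻ ζ, B ζ) * ((∫⁻ ξ, A ξ ^ 2) ^ (1 / 2 : ℝ) * (∫⁻ ξ, G ξ ^ 2) ^ (1 / 2 : ℝ)) := by
  rw [lintegral_conv_swap hA hB hG]
  simp_rw [lintegral_conv_comm A B]
  rw [← lintegral_conv_swap hB hA hG]
  exact lintegral_conv_le hB hA hG

/-- Young's inequality for a trilinear form, with the third function in `L¹`. -/
theorem lintegral_conv_le_right {A B G : Plane → ℝ≥0∞} (hA : Measurable A) (hB : Measurable B)
    (hG : Measurable G) :
    ∫⁻ ζ, A ζ * (∫⁻ ξ, B (ξ - ζ) * G ξ)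
      ≤ (∫⁻ ζ, G ζ) * ((∫⁻ ξ, A ξ ^ 2) ^ (1 / 2 : ℝ) * (∫⁻ ξ, B ξ ^ 2) ^ (1 / 2 : ℝ)) := by
  rw [lintegral_conv_swap hA hB hG]
  have h : ∀ ξ, ∫⁻ ζ, A ζ * B (ξ - ζ)
      ≤ (∫⁻ ξ, A ξ ^ 2) ^ (1 / 2 : ℝ) * (∫⁻ ξ, B ξ ^ 2) ^ (1 / 2 : ℝ) := by
    intro ξ
    refine (lintegral_mul_le_sqrt hA.aemeasurable
      (hB.comp (measurable_const_sub ξ)).aemeasurable).trans ?_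
    simp only [Function.comp_apply]
    rw [lintegral_sub_left_eq_self (fun ξ => B ξ ^ 2) ξ]
  calc _ ≤ ∫⁻ ζ, G ζ * ((∫⁻ ξ, A ξ ^ 2) ^ (1 / 2 : ℝ) * (∫⁻ ξ, B ξ ^ 2) ^ (1 / 2 : ℝ)) :=
        lintegral_mono fun ζ => mul_le_mul_right (h ζ) _
    _ ≤ _ := (lintegral_mul_const _ hG).le

theorem ofReal_jb_mul (s : ℝ) (ζ : Plane) :
    ENNReal.ofReal (jb ζ ^ (-s)) * ENNReal.ofReal (jb ζ) = ENNReal.ofReal (jb ζ ^ (1 - s)) := by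
  rw [← ENNReal.ofReal_mul (Real.rpow_nonneg (jb_pos ζ).le _), sub_eq_neg_add,
    Real.rpow_add (jb_pos ζ), Real.rpow_one]

/-- The Fourier transform of a function in `H^s` gains the factor `⟨ζ⟩^{-s}`. It reduces
`triWeight` to a sum of three terms, each with a square-integrable weight on one of the three
functions. -/
theorem ofReal_jb_mul_triWeight (s : ℝ) (ζ ξ : Plane) :
    ENNReal.ofReal (jb ζ ^ (-s)) * ENNReal.ofReal (triWeight s ζ ξ)
      = ENNReal.ofReal (jb ζ ^ (1 - s)) + ENNReal.ofReal (jb (ξ - ζ) ^ (1 - s))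
        + ENNReal.ofReal (jb ξ ^ (1 - s)) := by
  have h : ∀ (η : Plane) (r : ℝ), 0 ≤ jb η ^ r := fun η r => Real.rpow_nonneg (jb_pos η).le _
  rw [← ENNReal.ofReal_mul (h _ _), ← ENNReal.ofReal_add (h _ _) (h _ _),
    ← ENNReal.ofReal_add (add_nonneg (h _ _) (h _ _)) (h _ _)]
  congr 1
  have h1 := jb_rpow_mul_neg s ζ
  have h2 : jb ζ ^ (1 - s) = jb ζ * jb ζ ^ (-s) := by
    rw [sub_eq_add_neg, Real.rpow_add (jb_pos ζ), Real.rpow_one]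
  rw [triWeight, h2]
  linear_combination (jb (ξ - ζ) ^ (1 - s) + jb ξ ^ (1 - s)) * h1

/-- Functions in `H^s` are admissible coefficients. -/
theorem isCoef_bessel {s : ℝ} (hs : 2 < s) (V : L2) :
    IsCoef s ((bessel hs).op V) (3 * (embConst s * ‖V‖)) := by
  have hE := embConst_nonneg s
  have hm : Measurable fun ξ => ‖hat V ξ‖ₑ := (Lp.stronglyMeasurable (hat V)).enorm
  have hw : Measurable fun ξ : Plane => ENNReal.ofReal (jb ξ ^ (1 - s)) :=
    (measurable_jb_rpow _).ennreal_ofReal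
  have hα : ∀ᵐ ζ, ‖hat ((bessel hs).op V) ζ‖ₑ = ENNReal.ofReal (jb ζ ^ (-s)) * ‖hat V ζ‖ₑ := by
    filter_upwards [(bessel hs).hat_op V] with ζ hζ
    rw [hζ, enorm_mul, bessel_symbol, ← ofReal_norm ((jb ζ ^ (-s) : ℝ) : ℂ), Complex.norm_real,
      Real.norm_eq_abs, abs_of_nonneg (Real.rpow_nonneg (jb_pos ζ).le _)]
  have hle : ENNReal.ofReal (embConst s * ‖V‖) ≤ ENNReal.ofReal (3 * (embConst s * ‖V‖)) := by
    apply ENNReal.ofReal_le_ofReal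
    nlinarith [mul_nonneg hE (norm_nonneg V)]
  have hV1 : ∫⁻ ξ, ENNReal.ofReal (jb ξ ^ (1 - s)) * ‖hat V ξ‖ₑ ≤ ENNReal.ofReal
      (embConst s * ‖V‖) := by
    rw [ENNReal.ofReal_mul hE, ← sqrt_lintegral_hat]
    exact lintegral_jb_hat_le hs (aemeasurable_hat V)
  refine ⟨volume, inferInstance, hat ((bessel hs).op V), (Lp.stronglyMeasurable _).measurable,
    coe_eq_integral_hat (integrable_hat hs (norm_hat_bessel_le hs V)), ?_, fun h g hh hg => ?_⟩
  · refine le_trans (le_of_eq (lintegral_congr_ae ?_)) (hV1.trans hle)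
    filter_upwards [hα] with ζ hζ
    rw [hζ, mul_right_comm, ofReal_jb_mul]
  · set N := (∫⁻ ξ, h ξ ^ 2) ^ (1 / 2 : ℝ) * (∫⁻ ξ, g ξ ^ 2) ^ (1 / 2 : ℝ) with hN
    have e1 : ∀ᵐ ζ, ‖hat ((bessel hs).op V) ζ‖ₑ *
          (∫⁻ ξ, ENNReal.ofReal (triWeight s ζ ξ) * (h (ξ - ζ) * g ξ))
        = (ENNReal.ofReal (jb ζ ^ (1 - s)) * ‖hat V ζ‖ₑ) * (∫⁻ ξ, h (ξ - ζ) * g ξ)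
          + ‖hat V ζ‖ₑ * (∫⁻ ξ, (ENNReal.ofReal (jb (ξ - ζ) ^ (1 - s)) * h (ξ - ζ)) * g ξ)
          + ‖hat V ζ‖ₑ * (∫⁻ ξ, h (ξ - ζ) * (ENNReal.ofReal (jb ξ ^ (1 - s)) * g ξ)) := by
      filter_upwards [hα] with ζ hζ
      have m1 : Measurable fun ξ => h (ξ - ζ) := hh.comp (measurable_sub_const ζ)
      have m2 : Measurable fun ξ => ENNReal.ofReal (jb (ξ - ζ) ^ (1 - s)) :=
        hw.comp (measurable_sub_const ζ)
      rw [hζ, mul_comm (ENNReal.ofReal _) (‖hat V ζ‖ₑ), mul_assoc,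
        ← lintegral_const_mul' _ _ ENNReal.ofReal_ne_top,
        mul_comm (ENNReal.ofReal (jb ζ ^ (1 - s))), mul_assoc ‖hat V ζ‖ₑ,
        ← lintegral_const_mul' _ _ ENNReal.ofReal_ne_top, ← mul_add, ← mul_add,
        ← lintegral_add_left (by fun_prop), ← lintegral_add_left (by fun_prop)]
      congr 1
      refine lintegral_congr fun ξ => ?_
      rw [← mul_assoc, ofReal_jb_mul_triWeight]; ring
    have hmj := measurable_jb
    rw [lintegral_congr_ae e1, lintegral_add_left (by fun_prop), lintegral_add_left (by fun_prop)]
    have b1 : ∫⁻ ζ, (ENNReal.ofReal (jb ζ ^ (1 - s)) * ‖hat V ζ‖ₑ) * (∫⁻ ξ, h (ξ - ζ) * g ξ)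
        ≤ ENNReal.ofReal (embConst s * ‖V‖) * N :=
      (lintegral_conv_le (hw.mul hm) hh hg).trans (mul_le_mul_left hV1 _)
    have b2 : ∫⁻ ζ, ‖hat V ζ‖ₑ *
        (∫⁻ ξ, (ENNReal.ofReal (jb (ξ - ζ) ^ (1 - s)) * h (ξ - ζ)) * g ξ)
        ≤ ENNReal.ofReal (embConst s * ‖V‖) * N := by
      refine (lintegral_conv_le_left (B := fun ξ => ENNReal.ofReal (jb ξ ^ (1 - s)) * h ξ)
        hm (hw.mul hh) hg).trans ?_
      rw [sqrt_lintegral_hat]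
      calc _ ≤ (ENNReal.ofReal (embConst s) * (∫⁻ ξ, h ξ ^ 2) ^ (1 / 2 : ℝ)) *
            (ENNReal.ofReal ‖V‖ * (∫⁻ ξ, g ξ ^ 2) ^ (1 / 2 : ℝ)) := by
              gcongr; exact lintegral_jb_hat_le hs hh.aemeasurable
        _ = _ := by rw [ENNReal.ofReal_mul hE, hN]; ring
    have b3 : ∫⁻ ζ, ‖hat V ζ‖ₑ *
        (∫⁻ ξ, h (ξ - ζ) * (ENNReal.ofReal (jb ξ ^ (1 - s)) * g ξ))
        ≤ ENNReal.ofReal (embConst s * ‖V‖) * N := by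
      refine (lintegral_conv_le_right (G := fun ξ => ENNReal.ofReal (jb ξ ^ (1 - s)) * g ξ)
        hm hh (hw.mul hg)).trans ?_
      rw [sqrt_lintegral_hat]
      calc _ ≤ (ENNReal.ofReal (embConst s) * (∫⁻ ξ, g ξ ^ 2) ^ (1 / 2 : ℝ)) *
            (ENNReal.ofReal ‖V‖ * (∫⁻ ξ, h ξ ^ 2) ^ (1 / 2 : ℝ)) := by
              gcongr; exact lintegral_jb_hat_le hs hg.aemeasurable
        _ = _ := by rw [ENNReal.ofReal_mul hE, hN]; ring
    calc _ ≤ ENNReal.ofReal (embConst s * ‖V‖) * N + ENNReal.ofReal (embConst s * ‖V‖) * N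
          + ENNReal.ofReal (embConst s * ‖V‖) * N := add_le_add (add_le_add b1 b2) b3
      _ = _ := by
          rw [ENNReal.ofReal_mul (by norm_num : (0 : ℝ) ≤ 3)]
          norm_num
          ring

/-- A function of `x₁` alone is an admissible coefficient if the Fourier transform of its profile
decays fast enough. -/
theorem isCoef_line {s : ℝ} (hs : 2 < s) {q : ℝ → ℝ} {β : ℝ → ℂ} (hβ : Measurable β)
    (hq : ∀ x, (q x : ℂ) = ∫ r, β r * (Real.fourierChar (r * x) : ℂ)) {C : ℝ}
    (hC : ∫⁻ r, ‖β r‖ₑ * ENNReal.ofReal (jb (r • e 0) ^ s) ≤ ENNReal.ofReal C) :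
    IsCoef s (fun x => q (x 0)) (3 * C) := by
  have hι : Measurable fun r : ℝ => r • e 0 := by fun_prop
  have hα : Measurable fun ζ : Plane => β (ζ 0) := hβ.comp (by fun_prop)
  have h0 : ∀ r : ℝ, (r • e 0 : Plane) 0 = r := fun r => by simp [e]
  have hjb : ∀ ζ, jb ζ ≤ jb ζ ^ s := fun ζ => by
    simpa using Real.rpow_le_rpow_of_exponent_le (one_le_jb ζ) (by linarith : (1 : ℝ) ≤ s)
  have hle : ENNReal.ofReal C ≤ ENNReal.ofReal (3 * C) := by
    rcases le_total 0 C with h | h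
    · exact ENNReal.ofReal_le_ofReal (by linarith)
    · rw [ENNReal.ofReal_of_nonpos h]; exact zero_le
  refine ⟨Measure.map (fun r : ℝ => r • e 0) volume, inferInstance, fun ζ => β (ζ 0), hα, ?_, ?_,
    fun h g hh hg => ?_⟩
  · refine Eventually.of_forall fun x => ?_
    have hm : Measurable fun ζ : Plane => β (ζ 0) * planeWave ζ x :=
      hα.mul (continuous_planeWave.comp (Continuous.prodMk_right x)).measurable
    rw [integral_map hι.aemeasurable hm.aestronglyMeasurable, hq]
    congr 1; ext r
    rw [h0, planeWave]
    congr 3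
    simp [e, inner_smul_left, EuclideanSpace.inner_single_left]
  · refine (lintegral_map_le _ _).trans ((lintegral_mono fun r => ?_).trans (hC.trans hle))
    simp only [h0]
    gcongr
    exact hjb _
  · have hw : ∀ ζ ξ, triWeight s ζ ξ ≤ 3 * jb ζ ^ s := by
      intro ζ ξ
      have h1 : ∀ η, jb η ^ (1 - s) ≤ 1 := fun η =>
        Real.rpow_le_one_of_one_le_of_nonpos (one_le_jb η) (by linarith)
      have h2 := hjb ζ
      have h3 : 0 ≤ jb ζ ^ s := Real.rpow_nonneg (jb_pos ζ).le _
      unfold triWeight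
      nlinarith [mul_le_mul_of_nonneg_left (h1 (ξ - ζ)) h3, mul_le_mul_of_nonneg_left (h1 ξ) h3]
    set ν := Measure.map (fun r : ℝ => (r • e 0 : Plane)) volume
    calc _ ≤ ∫⁻ ζ, (‖β (ζ 0)‖ₑ * ENNReal.ofReal (3 * jb ζ ^ s)) * (∫⁻ ξ, h (ξ - ζ) * g ξ) ∂ν := by
          refine lintegral_mono fun ζ => ?_
          rw [mul_assoc]
          gcongr
          rw [← lintegral_const_mul' _ _ ENNReal.ofReal_ne_top]
          refine lintegral_mono fun ξ => ?_
          gcongr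
          exact hw ζ ξ
      _ ≤ (∫⁻ ζ, ‖β (ζ 0)‖ₑ * ENNReal.ofReal (3 * jb ζ ^ s) ∂ν) * _ :=
          lintegral_conv_le (by have := measurable_jb; fun_prop) hh hg
      _ ≤ _ := by
          gcongr
          refine (lintegral_map_le _ _).trans ?_
          simp only [h0]
          rw [ENNReal.ofReal_mul (by norm_num : (0 : ℝ) ≤ 3)]
          simp_rw [ENNReal.ofReal_mul (by norm_num : (0 : ℝ) ≤ 3), mul_left_comm _
              (ENNReal.ofReal 3)]
          rw [lintegral_const_mul' _ _ ENNReal.ofReal_ne_top]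
          gcongr

theorem jb_line_le (r : ℝ) : jb (r • e 0) ≤ 7 * (1 + |r|) := by
  have h := jb_le_add (r • e 0) 0
  have h0 : jb 0 = 1 := by simp [jb]
  have h1 : ‖r • e 0‖ = |r| := by simp [e, norm_smul]
  rw [sub_zero, h0, h1] at h
  nlinarith [Real.pi_lt_d2, abs_nonneg r]

/-- Schwartz profiles are admissible. -/
theorem exists_isCoef_schwartz {s : ℝ} (hs : 2 < s) (q : SchwartzMap ℝ ℝ) :
    ∃ C : ℝ, 0 ≤ C ∧ IsCoef s (fun x => q (x 0)) C := by
  set Q : SchwartzMap ℝ ℂ := SchwartzMap.postcompCLM (𝕜 := ℝ) Complex.ofRealCLM q with hQ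
  have hQa : ∀ x, Q x = (q x : ℂ) := fun x => rfl
  set β : SchwartzMap ℝ ℂ := 𝓕 Q with hβ
  obtain ⟨N, hN⟩ := exists_nat_ge s
  have hi : Integrable fun r : ℝ => ‖β r‖ * jb (r • e 0) ^ s := by
    have h1 : Integrable fun r : ℝ => 7 ^ N * 2 ^ N * (‖β r‖ + ‖r‖ ^ N * ‖β r‖) :=
      (β.integrable.norm.add (β.integrable_pow_mul volume N)).const_mul _
    have hm : Measurable fun r : ℝ => jb (r • e 0) ^ s :=
      (measurable_jb_rpow s).comp (by fun_prop)
    refine h1.mono' (β.continuous.norm.measurable.mul hm).aestronglyMeasurable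
      (Eventually.of_forall fun r => ?_)
    have hj : jb (r • e 0) ^ s ≤ 7 ^ N * 2 ^ N * (1 + ‖r‖ ^ N) := by
      calc jb (r • e 0) ^ s ≤ jb (r • e 0) ^ (N : ℝ) :=
            Real.rpow_le_rpow_of_exponent_le (one_le_jb _) hN
        _ = jb (r • e 0) ^ N := Real.rpow_natCast _ _
        _ ≤ (7 * (1 + |r|)) ^ N := pow_le_pow_left₀ (jb_pos _).le (jb_line_le r) N
        _ = 7 ^ N * (1 + |r|) ^ N := mul_pow _ _ _
        _ ≤ 7 ^ N * (2 ^ N * (1 + |r| ^ N)) := by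
            gcongr
            have hmax : 1 + |r| ≤ 2 * max 1 |r| := by
              have := le_max_left 1 |r|
              have := le_max_right 1 |r|
              linarith
            calc (1 + |r|) ^ N ≤ (2 * max 1 |r|) ^ N := by gcongr
              _ = 2 ^ N * max 1 |r| ^ N := mul_pow _ _ _
              _ ≤ _ := by
                  gcongr
                  have := pow_nonneg (abs_nonneg r) N
                  rcases max_choice 1 |r| with h | h <;> rw [h] <;> simp [this]
        _ = _ := by rw [Real.norm_eq_abs]; ring
    rw [Real.norm_eq_abs, abs_of_nonneg
      (mul_nonneg (norm_nonneg _) (Real.rpow_nonneg (jb_pos _).le _))]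
    calc _ ≤ ‖β r‖ * (7 ^ N * 2 ^ N * (1 + ‖r‖ ^ N)) := by gcongr
      _ = _ := by ring
  refine ⟨3 * ∫ r, ‖β r‖ * jb (r • e 0) ^ s, ?_, ?_⟩
  · refine mul_nonneg (by norm_num) (integral_nonneg fun r => ?_)
    exact mul_nonneg (norm_nonneg _) (Real.rpow_nonneg (jb_pos _).le _)
  · refine isCoef_line hs β.continuous.measurable (fun x => ?_) ?_
    · have h1 : Q = 𝓕⁻ β := (FourierTransform.fourierInv_fourier_eq Q).symm
      rw [← hQa, h1, SchwartzMap.fourierInv_coe, Real.fourierInv_eq]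
      congr 1; ext r
      rw [Circle.smul_def, smul_eq_mul, mul_comm]
      congr 3
      simp [mul_comm]
    · rw [ofReal_integral_eq_lintegral_ofReal hi (Eventually.of_forall fun r =>
        mul_nonneg (norm_nonneg _) (Real.rpow_nonneg (jb_pos _).le _))]
      refine lintegral_mono fun r => ?_
      rw [ENNReal.ofReal_mul (norm_nonneg _), ofReal_norm]

/-! ### The line soliton -/

theorem Q_eq (x : ℝ) : Q x = √2 / Real.cosh x := by
  rw [Q, Real.cosh_eq]
  field_simp

theorem hasDerivAt_Q (x : ℝ) : HasDerivAt Q (-(Q x * Real.tanh x)) x := by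
  have h : HasDerivAt (fun x => √2 / Real.cosh x) (-(Q x * Real.tanh x)) x := by
    have hc := (Real.cosh_pos x).ne'
    refine ((hasDerivAt_const x (√2 : ℝ)).div (Real.hasDerivAt_cosh x) hc).congr_deriv ?_
    rw [Q_eq, Real.tanh_eq_sinh_div_cosh]
    field_simp
    ring
  exact h.congr_of_eventuallyEq (Eventually.of_forall Q_eq)

theorem hasDerivAt_tanh' (x : ℝ) : HasDerivAt Real.tanh (1 - Real.tanh x ^ 2) x := by
  have hc := (Real.cosh_pos x).ne'
  have h : HasDerivAt (fun x => Real.sinh x / Real.cosh x) (1 - Real.tanh x ^ 2) x := by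
    refine ((Real.hasDerivAt_sinh x).div (Real.hasDerivAt_cosh x) hc).congr_deriv ?_
    rw [Real.tanh_eq_sinh_div_cosh]
    field_simp
  exact h.congr_of_eventuallyEq (Eventually.of_forall Real.tanh_eq_sinh_div_cosh)

/-- The derivatives of `Q` are polynomials in `tanh` times `Q`. -/
theorem iteratedDeriv_Q (n : ℕ) : ∃ p : ℝ[X], iteratedDeriv n Q = fun x => Q x * p.eval
    (Real.tanh x) := by
  induction n with
  | zero => exact ⟨1, by ext x; simp⟩
  | succ n ih =>
    obtain ⟨p, hp⟩ := ih
    refine ⟨-(Polynomial.X * p) + (1 - Polynomial.X ^ 2) * Polynomial.derivative p, ?_⟩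
    ext x
    rw [iteratedDeriv_succ, hp]
    have h1 := (p.hasDerivAt (Real.tanh x)).comp x (hasDerivAt_tanh' x)
    have h2 := ((hasDerivAt_Q x).mul h1).deriv
    simp only [Function.comp_def] at h2
    refine Eq.trans h2 ?_
    simp
    ring

theorem contDiff_Q : ContDiff ℝ ∞ Q := by
  have h : Q = fun x => √2 / Real.cosh x := funext Q_eq
  rw [h]
  exact contDiff_const.div Real.contDiff_cosh fun x => (Real.cosh_pos x).ne'

theorem abs_pow_mul_Q_le (k : ℕ) (x : ℝ) : |x| ^ k * |Q x| ≤ 2 * √2 * k.factorial := by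
  have h1 : |Q x| = 2 * √2 / (Real.exp x + Real.exp (-x)) := by
    rw [Q, abs_of_nonneg (by positivity)]
  have h2 : Real.exp |x| ≤ Real.exp x + Real.exp (-x) := by
    have := Real.exp_pos x
    have := Real.exp_pos (-x)
    rcases abs_choice x with h | h <;> rw [h] <;> linarith
  have h3 := Real.pow_div_factorial_le_exp |x| (abs_nonneg x) k
  have hk : (0 : ℝ) < k.factorial := by exact_mod_cast k.factorial_pos
  rw [div_le_iff₀ hk] at h3
  rw [h1, mul_div_assoc', div_le_iff₀ (by positivity)]
  calc |x| ^ k * (2 * √2) ≤ (Real.exp |x| * k.factorial) * (2 * √2) := by gcongr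
    _ ≤ ((Real.exp x + Real.exp (-x)) * k.factorial) * (2 * √2) := by gcongr
    _ = _ := by ring

/-- The profile of the soliton is a Schwartz function. -/
def profile : SchwartzMap ℝ ℝ where
  toFun := Q
  smooth' := contDiff_Q
  decay' := by
    intro k n
    obtain ⟨p, hp⟩ := iteratedDeriv_Q n
    obtain ⟨M, hM⟩ := (isCompact_Icc (a := (-1 : ℝ)) (b := 1)).exists_bound_of_continuousOn
      p.continuous.continuousOn
    refine ⟨2 * √2 * k.factorial * M, fun x => ?_⟩
    rw [norm_iteratedFDeriv_eq_norm_iteratedDeriv, hp, norm_mul, Real.norm_eq_abs, Real.norm_eq_abs,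
      ← mul_assoc]
    have h1 := abs_pow_mul_Q_le k x
    have h2 := hM (Real.tanh x) ⟨(Real.neg_one_lt_tanh x).le, (Real.tanh_lt_one x).le⟩
    have h3 : 0 ≤ M := (norm_nonneg _).trans h2
    gcongr

theorem deriv_Q_eq : ∃ q : SchwartzMap ℝ ℝ, ∀ x, q x = deriv Q x :=
  ⟨SchwartzMap.derivCLM ℝ ℝ profile, fun x => SchwartzMap.derivCLM_apply ℝ profile x⟩

theorem deriv_deriv_Q_eq : ∃ q : SchwartzMap ℝ ℝ, ∀ x, q x = deriv (deriv Q) x := by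
  refine ⟨SchwartzMap.derivCLM ℝ ℝ (SchwartzMap.derivCLM ℝ ℝ profile), fun x => ?_⟩
  rw [SchwartzMap.derivCLM_apply]
  congr 1

/-- The background with amplitudes `c`, `σ` of the real and imaginary part and profile values
`q₀`, `q₁`, `q₂` of `Q`, `Q'`, `Q''`. -/
def lineBackground (c σ q₀ q₁ q₂ : ℝ) : Background where
  P := 0
  F := c * q₀
  G := σ * q₀
  H := ![c * q₁, 0]
  L := ![σ * q₁, 0]
  divH := c * q₂
  divL := σ * q₂

theorem phi_eq (t : ℝ) (x : Plane) :
    phi t x = ((Real.cos t : ℝ) + (Real.sin t : ℝ) * Complex.I) * (Q (x 0) : ℂ) := by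
  rw [phi, mul_comm Complex.I, Complex.exp_mul_I, Complex.ofReal_cos, Complex.ofReal_sin]

theorem hasFDerivAt_line {q : ℝ → ℝ} {q' : ℝ} {x : Plane} (h : HasDerivAt q q' (x 0)) :
    HasFDerivAt (fun y : Plane => q (y 0)) (q' • (EuclideanSpace.proj 0 : Plane →L[ℝ] ℝ)) x :=
  h.comp_hasFDerivAt x (EuclideanSpace.proj 0 : Plane →L[ℝ] ℝ).hasFDerivAt

theorem fderiv_phi (t : ℝ) (x : Plane) (j : Fin 2) :
    fderiv ℝ (phi t) x (e j)
      = ((Real.cos t : ℝ) + (Real.sin t : ℝ) * Complex.I) * ((deriv Q (x 0) * e j 0 : ℝ) : ℂ) := by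
  have h1 := hasFDerivAt_line (x := x) (hasDerivAt_Q (x 0)).differentiableAt.hasDerivAt
  have h2 := Complex.ofRealCLM.hasFDerivAt.comp x h1
  have h3 := h2.const_mul (((Real.cos t : ℝ) + (Real.sin t : ℝ) * Complex.I : ℂ))
  have h4 : phi t = fun y => ((Real.cos t : ℝ) + (Real.sin t : ℝ) * Complex.I : ℂ) *
      ((Complex.ofRealCLM ∘ fun y : Plane => Q (y 0)) y) := funext fun y => phi_eq t y
  rw [h4, h3.fderiv]
  simp

theorem differentiable_deriv_Q : Differentiable ℝ (deriv Q) := by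
  obtain ⟨q, hq⟩ := deriv_Q_eq
  have : deriv Q = q := funext fun x => (hq x).symm
  rw [this]; exact q.differentiable

theorem fderiv_line_smul (c : ℝ) (x : Plane) (j k : Fin 2) :
    fderiv ℝ (fun y : Plane => c * (deriv Q (y 0) * e j 0)) x (e k)
      = c * (deriv (deriv Q) (x 0) * e j 0) * e k 0 := by
  have h1 := hasFDerivAt_line (x := x) (differentiable_deriv_Q (x 0)).hasDerivAt
  rw [((h1.mul_const (e j 0)).const_mul c).fderiv]
  simp
  ring

theorem re_cos_add_sin (t : ℝ) : (((Real.cos t : ℝ) + (Real.sin t : ℝ) * Complex.I : ℂ)).re =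
    Real.cos t := by
  rw [Complex.add_re, Complex.re_ofReal_mul, Complex.I_re, mul_zero, add_zero, Complex.ofReal_re]

theorem im_cos_add_sin (t : ℝ) : (((Real.cos t : ℝ) + (Real.sin t : ℝ) * Complex.I : ℂ)).im =
    Real.sin t := by
  rw [Complex.add_im, Complex.im_ofReal_mul, Complex.I_im, mul_one, Complex.ofReal_im, zero_add]

theorem Hr_eq (j : Fin 2) (t : ℝ) (x : Plane) :
    Hr j t x = √2 * Real.cos t * (deriv Q (x 0) * e j 0) := by
  rw [Hr, fderiv_phi, Complex.re_mul_ofReal, re_cos_add_sin]; ring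

theorem Lr_eq (j : Fin 2) (t : ℝ) (x : Plane) :
    Lr j t x = √2 * Real.sin t * (deriv Q (x 0) * e j 0) := by
  rw [Lr, fderiv_phi, Complex.im_mul_ofReal, im_cos_add_sin]; ring

/-- The background is explicit: `P_r` vanishes,
    and the other terms are products of a function of time
and of `Q` or one of its derivatives. -/
theorem soliton_eq (t : ℝ) (x : Plane) :
    soliton t x = lineBackground (√2 * Real.cos t) (√2 * Real.sin t)
      (Q (x 0)) (deriv Q (x 0)) (deriv (deriv Q) (x 0)) := by
  have e00 : e 0 0 = 1 := by simp [e]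
  have e10 : e 1 0 = 0 := by simp [e]
  have hQ : 0 ≤ Q (x 0) := by rw [Q]; positivity
  have hP : Pr t x = 0 := by
    rw [Pr, phi₁, phi, mul_comm Complex.I, norm_mul, Complex.norm_exp_ofReal_mul_I, one_mul,
      Complex.norm_real, Real.norm_eq_abs, sq_abs]
    ring
  have hF : Fr t x = √2 * Real.cos t * Q (x 0) := by
    rw [Fr, phi_eq, Complex.re_mul_ofReal, re_cos_add_sin]; ring
  have hG : Gr t x = √2 * Real.sin t * Q (x 0) := by
    rw [Gr, phi_eq, Complex.im_mul_ofReal, im_cos_add_sin]; ring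
  have hdH : divHr t x = √2 * Real.cos t * deriv (deriv Q) (x 0) := by
    have h : ∀ j, Hr j t = fun y => √2 * Real.cos t * (deriv Q (y 0) * e j 0) := fun j =>
      funext fun y => Hr_eq j t y
    simp only [divHr, h, fderiv_line_smul, Fin.sum_univ_two, e00, e10]
    ring
  have hdL : divLr t x = √2 * Real.sin t * deriv (deriv Q) (x 0) := by
    have h : ∀ j, Lr j t = fun y => √2 * Real.sin t * (deriv Q (y 0) * e j 0) := fun j =>
      funext fun y => Lr_eq j t y
    simp only [divLr, h, fderiv_line_smul, Fin.sum_univ_two, e00, e10]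
    ring
  have hH : (fun j => Hr j t x) = ![√2 * Real.cos t * deriv Q (x 0), 0] := by
    ext j; fin_cases j <;> simp [Hr_eq, e00, e10]
  have hL : (fun j => Lr j t x) = ![√2 * Real.sin t * deriv Q (x 0), 0] := by
    ext j; fin_cases j <;> simp [Lr_eq, e00, e10]
  simp only [soliton, lineBackground, hP, hF, hG, hdH, hdL, hH, hL]

theorem IsCoef.const_mul {s : ℝ} {a : Plane → ℝ} {C : ℝ} (h : IsCoef s a C) (c : ℝ) :
    IsCoef s (fun x => c * a x) (|c| * C) := by
  obtain ⟨ν, hν, α, h1, h2, h3, h4⟩ := h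
  have hc : ∀ ζ, ‖(c : ℂ) * α ζ‖ₑ = ENNReal.ofReal |c| * ‖α ζ‖ₑ := fun ζ => by
    rw [enorm_mul, ← ofReal_norm (c : ℂ), Complex.norm_real, Real.norm_eq_abs]
  refine ⟨ν, hν, fun ζ => c * α ζ, measurable_const.mul h1, ?_, ?_, fun h g hh hg => ?_⟩
  · filter_upwards [h2] with x hx
    simp_rw [mul_assoc]
    rw [integral_const_mul, ← hx]; push_cast; rfl
  · simp_rw [hc, mul_assoc]
    rw [lintegral_const_mul' _ _ ENNReal.ofReal_ne_top, ENNReal.ofReal_mul (abs_nonneg c)]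
    gcongr
  · simp_rw [hc, mul_assoc]
    rw [lintegral_const_mul' _ _ ENNReal.ofReal_ne_top, ENNReal.ofReal_mul (abs_nonneg c),
        mul_assoc]
    gcongr
    exact h4 h g hh hg

/-- The functions attached to the soliton are admissible coefficients, uniformly in time. -/
theorem exists_isCoef_profile {s : ℝ} (hs : 2 < s) : ∃ C : ℝ, 0 ≤ C ∧ ∀ c : ℝ, |c| ≤ √2 →
    IsCoef s (fun x => c * Q (x 0)) C ∧ IsCoef s (fun x => c * deriv Q (x 0)) C ∧
      IsCoef s (fun x => c * deriv (deriv Q) (x 0)) C := by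
  obtain ⟨q1, hq1⟩ := deriv_Q_eq
  obtain ⟨q2, hq2⟩ := deriv_deriv_Q_eq
  obtain ⟨C0, hC0, h0⟩ := exists_isCoef_schwartz hs profile
  obtain ⟨C1, hC1, h1⟩ := exists_isCoef_schwartz hs q1
  obtain ⟨C2, hC2, h2⟩ := exists_isCoef_schwartz hs q2
  simp only [hq1] at h1
  simp only [hq2] at h2
  refine ⟨√2 * (C0 + C1 + C2), by positivity, fun c hc => ⟨(h0.const_mul c).mono ?_,
    (h1.const_mul c).mono ?_, (h2.const_mul c).mono ?_⟩⟩
  all_goals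
    gcongr
    linarith

theorem abs_sqrt_two_mul_cos_le (t : ℝ) : |√2 * Real.cos t| ≤ √2 := by
  rw [abs_mul, abs_of_nonneg (Real.sqrt_nonneg 2)]
  exact mul_le_of_le_one_right (Real.sqrt_nonneg 2) (Real.abs_cos_le_one t)

theorem abs_sqrt_two_mul_sin_le (t : ℝ) : |√2 * Real.sin t| ≤ √2 := by
  rw [abs_mul, abs_of_nonneg (Real.sqrt_nonneg 2)]
  exact mul_le_of_le_one_right (Real.sqrt_nonneg 2) (Real.abs_sin_le_one t)

/-- `Q` and its first two derivatives are bounded. -/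
theorem exists_bound_profile : ∃ M : ℝ, ∀ x, |Q x| ≤ M ∧ |deriv Q x| ≤ M ∧ |deriv (deriv Q) x| ≤
    M := by
  obtain ⟨q1, hq1⟩ := deriv_Q_eq
  obtain ⟨q2, hq2⟩ := deriv_deriv_Q_eq
  have hb : ∀ q : SchwartzMap ℝ ℝ, ∃ M, ∀ x, |q x| ≤ M := fun q => by
    obtain ⟨M, hM⟩ := q.decay' 0 0
    exact ⟨M, fun x => by simpa using! hM x⟩
  obtain ⟨M0, h0⟩ := hb profile
  obtain ⟨M1, h1⟩ := hb q1
  obtain ⟨M2, h2⟩ := hb q2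
  simp only [hq1] at h1
  simp only [hq2] at h2
  exact ⟨max M0 (max M1 M2), fun x => ⟨(h0 x).trans (le_max_left _ _),
    (h1 x).trans ((le_max_left _ _).trans (le_max_right _ _)),
    (h2 x).trans ((le_max_right _ _).trans (le_max_right _ _))⟩⟩

/-! ### Products in `H^s` and the zeroth-order terms -/

/-- A family of functions that is bounded in `H^s`. -/
def UnifSobolev {s : ℝ} (hs : 2 < s) {ι : Type*} (f : ι → Plane → ℝ) : Prop :=
  ∃ C : ℝ, 0 ≤ C ∧ ∀ i, ∃ Z : L2, ‖Z‖ ≤ C ∧ (bessel hs).op Z =ᵐ[volume] f i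

/-- A family of functions that is bounded as a family of pointwise multipliers of `H^s`. -/
def UnifMul {s : ℝ} (hs : 2 < s) {ι : Type*} (a : ι → Plane → ℝ) : Prop :=
  ∃ C : ℝ, 0 ≤ C ∧ ∀ i, ∀ V : L2, ∃ Z : L2, ‖Z‖ ≤ C * ‖V‖ ∧
    (bessel hs).op Z =ᵐ[volume] fun x => a i x * (bessel hs).op V x

section Families

variable {s : ℝ} {hs : 2 < s} {ι : Type*} {f g a b : ι → Plane → ℝ}

theorem UnifSobolev.add (hf : UnifSobolev hs f) (hg : UnifSobolev hs g) :
    UnifSobolev hs fun i x => f i x + g i x := by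
  obtain ⟨C, hC, h⟩ := hf
  obtain ⟨D, hD, k⟩ := hg
  refine ⟨C + D, by positivity, fun i => ?_⟩
  obtain ⟨Y, hY, hY'⟩ := h i
  obtain ⟨Z, hZ, hZ'⟩ := k i
  refine ⟨Y + Z, (norm_add_le _ _).trans (add_le_add hY hZ), ?_⟩
  rw [map_add]
  filter_upwards [hY', hZ', Lp.coeFn_add ((bessel hs).op Y) ((bessel hs).op Z)] with x h1 h2 h3
  rw [h3, Pi.add_apply, h1, h2]

theorem UnifSobolev.const_mul (hf : UnifSobolev hs f) (c : ℝ) :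
    UnifSobolev hs fun i x => c * f i x := by
  obtain ⟨C, hC, h⟩ := hf
  refine ⟨|c| * C, by positivity, fun i => ?_⟩
  obtain ⟨Y, hY, hY'⟩ := h i
  refine ⟨c • Y, ?_, ?_⟩
  · rw [norm_smul, Real.norm_eq_abs]; gcongr
  rw [map_smul]
  filter_upwards [hY', Lp.coeFn_smul c ((bessel hs).op Y)] with x h1 h3
  rw [h3, Pi.smul_apply, h1, smul_eq_mul]

theorem UnifSobolev.congr (hf : UnifSobolev hs f) (h : ∀ i x, f i x = g i x) :
    UnifSobolev hs g := by
  obtain rfl : f = g := funext fun i => funext fun x => h i x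
  exact hf

theorem UnifSobolev.sub (hf : UnifSobolev hs f) (hg : UnifSobolev hs g) :
    UnifSobolev hs fun i x => f i x - g i x :=
  (hf.add (hg.const_mul (-1))).congr fun i x => by ring

theorem UnifSobolev.zero : UnifSobolev hs fun (_ : ι) _ => 0 :=
  ⟨0, le_rfl, fun _ => ⟨0, by simp, by rw [map_zero]; exact Lp.coeFn_zero _ _ _⟩⟩

theorem UnifMul.mul_sobolev (ha : UnifMul hs a) (hf : UnifSobolev hs f) :
    UnifSobolev hs fun i x => a i x * f i x := by
  obtain ⟨C, hC, h⟩ := hf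
  obtain ⟨D, hD, k⟩ := ha
  refine ⟨D * C, by positivity, fun i => ?_⟩
  obtain ⟨Y, hY, hY'⟩ := h i
  obtain ⟨Z, hZ, hZ'⟩ := k i Y
  refine ⟨Z, hZ.trans (by gcongr), ?_⟩
  filter_upwards [hY', hZ'] with x h1 h2
  rw [h2, h1]

theorem UnifMul.add (ha : UnifMul hs a) (hb : UnifMul hs b) :
    UnifMul hs fun i x => a i x + b i x := by
  obtain ⟨C, hC, h⟩ := ha
  obtain ⟨D, hD, k⟩ := hb
  refine ⟨C + D, by positivity, fun i V => ?_⟩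
  obtain ⟨Y, hY, hY'⟩ := h i V
  obtain ⟨Z, hZ, hZ'⟩ := k i V
  refine ⟨Y + Z, (norm_add_le _ _).trans ((add_le_add hY hZ).trans_eq (by ring)), ?_⟩
  rw [map_add]
  filter_upwards [hY', hZ', Lp.coeFn_add ((bessel hs).op Y) ((bessel hs).op Z)] with x h1 h2 h3
  rw [h3, Pi.add_apply, h1, h2]; ring

theorem UnifMul.mul (ha : UnifMul hs a) (hb : UnifMul hs b) :
    UnifMul hs fun i x => a i x * b i x := by
  obtain ⟨C, hC, h⟩ := ha
  obtain ⟨D, hD, k⟩ := hb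
  refine ⟨C * D, by positivity, fun i V => ?_⟩
  obtain ⟨Y, hY, hY'⟩ := k i V
  obtain ⟨Z, hZ, hZ'⟩ := h i Y
  refine ⟨Z, hZ.trans ((mul_le_mul_of_nonneg_left hY hC).trans_eq (by ring)), ?_⟩
  filter_upwards [hY', hZ'] with x h1 h2
  rw [h2, h1]; ring

theorem UnifMul.of_isCoef {C : ℝ} (hC : 0 ≤ C) (h : ∀ i, IsCoef s (a i) C) : UnifMul hs a :=
  ⟨symbolConst s * C, mul_nonneg (symbolConst_nonneg hs) hC, fun i V =>
    (h i).exists_mul_bessel hs hC V⟩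

theorem UnifSobolev.toMul (hf : UnifSobolev hs f) : UnifMul hs f := by
  obtain ⟨C, hC, h⟩ := hf
  have hE := embConst_nonneg s
  have hS := symbolConst_nonneg hs
  refine ⟨symbolConst s * (3 * (embConst s * C)), by positivity, fun i V => ?_⟩
  obtain ⟨Y, hY, hY'⟩ := h i
  have h1 := (isCoef_bessel hs Y).mono (C' := 3 * (embConst s * C)) (by gcongr)
  obtain ⟨Z, hZ, hZ'⟩ := h1.exists_mul_bessel hs (by positivity) V
  refine ⟨Z, hZ, ?_⟩
  filter_upwards [hY', hZ'] with x h1 h2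
  rw [h2, h1]

/-- The zeroth-order terms are bounded in `H^s` if the solution is. -/
theorem UnifSobolev.residual {u : ι → Plane → Fin 9 → ℝ} {β : ι → Plane → Background}
    (hu : ∀ k, UnifSobolev hs fun i x => u i x k)
    (hP : UnifMul hs fun i x => (β i x).P) (hF : UnifMul hs fun i x => (β i x).F)
    (hG : UnifMul hs fun i x => (β i x).G) (hH : ∀ j, UnifMul hs fun i x => (β i x).H j)
    (hL : ∀ j, UnifMul hs fun i x => (β i x).L j) (hdH : UnifMul hs fun i x => (β i x).divH)
    (hdL : UnifMul hs fun i x => (β i x).divL) (k : Fin 9) :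
    UnifSobolev hs fun i x => residual (β i x) (u i x) k := by
  have hPt := (hu 0).toMul.add hP
  have hFt := (hu 3).toMul.add hF
  have hGt := (hu 4).toMul.add hG
  have hS := (hFt.mul hFt).add (hGt.mul hGt)
  have hd := (((hu 3).toMul.mul_sobolev (hu 3)).add ((hu 4).toMul.mul_sobolev (hu 4))).add
    (((hF.mul_sobolev (hu 3)).add (hG.mul_sobolev (hu 4))).const_mul 2)
  have h4 : ∀ (j : Fin 2) (m n : Fin 9), UnifSobolev hs fun i x =>
      1 / 2 * ((u i x 3 + (β i x).F) ^ 2 + (u i x 4 + (β i x).G) ^ 2) * u i x n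
        + 1 / 2 * (u i x 3 ^ 2 + u i x 4 ^ 2 + 2 * u i x 3 * (β i x).F + 2 * u i x 4 * (β i x).G)
          * (β i x).L j
        + ((u i x 3 + (β i x).F) * (u i x m + (β i x).H j)
          + (u i x 4 + (β i x).G) * (u i x n + (β i x).L j)) * u i x 4
        + (u i x 3 * u i x m + u i x 4 * u i x n + u i x 3 * (β i x).H j + (β i x).F * u i x m
          + u i x 4 * (β i x).L j + (β i x).G * u i x n) * (β i x).G
        - u i x 0 * (β i x).L j - (β i x).P * u i x n - u i x 0 * u i x n := by
    intro j m n
    have hc := ((((((hu 3).toMul.mul_sobolev (hu m)).add ((hu 4).toMul.mul_sobolev (hu n))).add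
      ((hH j).mul_sobolev (hu 3))).add (hF.mul_sobolev (hu m))).add
      ((hL j).mul_sobolev (hu 4))).add (hG.mul_sobolev (hu n))
    have hT := (hFt.mul ((hu m).toMul.add (hH j))).add (hGt.mul ((hu n).toMul.add (hL j)))
    refine ((((((((hS.mul_sobolev (hu n)).const_mul (1 / 2)).add
      (((hL j).mul_sobolev hd).const_mul (1 / 2))).add (hT.mul_sobolev (hu 4))).add
      (hG.mul_sobolev hc)).sub ((hL j).mul_sobolev (hu 0))).sub (hP.mul_sobolev (hu n))).sub
      ((hu 0).toMul.mul_sobolev (hu n))).congr fun i x => by ring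
  have h5 : ∀ (j : Fin 2) (m n : Fin 9), UnifSobolev hs fun i x =>
      -(1 / 2) * ((u i x 3 + (β i x).F) ^ 2 + (u i x 4 + (β i x).G) ^ 2) * u i x m
        - 1 / 2 * (u i x 3 ^ 2 + u i x 4 ^ 2 + 2 * u i x 3 * (β i x).F + 2 * u i x 4 * (β i x).G)
          * (β i x).H j
        - ((u i x 3 + (β i x).F) * (u i x m + (β i x).H j)
          + (u i x 4 + (β i x).G) * (u i x n + (β i x).L j)) * u i x 3
        - (u i x 3 * u i x m + u i x 4 * u i x n + u i x 3 * (β i x).H j + (β i x).F * u i x m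
          + u i x 4 * (β i x).L j + (β i x).G * u i x n) * (β i x).F
        + u i x 0 * u i x m + (β i x).P * u i x m + u i x 0 * (β i x).H j := by
    intro j m n
    have hc := ((((((hu 3).toMul.mul_sobolev (hu m)).add ((hu 4).toMul.mul_sobolev (hu n))).add
      ((hH j).mul_sobolev (hu 3))).add (hF.mul_sobolev (hu m))).add
      ((hL j).mul_sobolev (hu 4))).add (hG.mul_sobolev (hu n))
    have hT := (hFt.mul ((hu m).toMul.add (hH j))).add (hGt.mul ((hu n).toMul.add (hL j)))
    refine ((((((((hS.mul_sobolev (hu m)).const_mul (-(1 / 2))).sub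
      (((hH j).mul_sobolev hd).const_mul (1 / 2))).sub (hT.mul_sobolev (hu 3))).sub
      (hF.mul_sobolev hc)).add ((hu 0).toMul.mul_sobolev (hu m))).add (hP.mul_sobolev (hu m))).add
      ((hH j).mul_sobolev (hu 0))).congr fun i x => by ring
  fin_cases k
  · exact ((hdL.mul_sobolev (hu 3)).sub (hdH.mul_sobolev (hu 4))).congr fun i x => by
      simp [PerturbedZakharov.residual]; ring
  · exact UnifSobolev.zero.congr fun i x => by simp [PerturbedZakharov.residual]
  · exact UnifSobolev.zero.congr fun i x => by simp [PerturbedZakharov.residual]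
  · exact (((((hS.mul_sobolev (hu 4)).const_mul (1 / 2)).add
      ((hG.mul_sobolev hd).const_mul (1 / 2))).sub (hPt.mul_sobolev (hu 4))).sub
      (hG.mul_sobolev (hu 0))).congr fun i x => by
        simp [PerturbedZakharov.residual]; ring
  · exact (((((hS.mul_sobolev (hu 3)).const_mul (-(1 / 2))).sub
      ((hF.mul_sobolev hd).const_mul (1 / 2))).add (hPt.mul_sobolev (hu 3))).add
      (hF.mul_sobolev (hu 0))).congr fun i x => by
        simp [PerturbedZakharov.residual]; ring
  · exact (h4 0 5 7).congr fun i x => by simp [PerturbedZakharov.residual]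
  · exact (h4 1 6 8).congr fun i x => by simp [PerturbedZakharov.residual]
  · exact (h5 0 5 7).congr fun i x => by simp [PerturbedZakharov.residual]
  · exact (h5 1 6 8).congr fun i x => by simp [PerturbedZakharov.residual]

end Families

/-- The zeroth-order terms at the soliton are bounded in `H^s`, uniformly in time, on balls. -/
theorem exists_residual_bessel {s : ℝ} (hs : 2 < s) (R : ℝ) :
    ∃ C : ℝ, 0 ≤ C ∧ ∀ (t : ℝ) (V : Fin 9 → L2), (∀ k, ‖V k‖ ≤ R) → ∀ k, ∃ Z : L2, ‖Z‖ ≤ C ∧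
      (bessel hs).op Z =ᵐ[volume] fun x =>
        residual (soliton t x) (fun k => (bessel hs).op (V k) x) k := by
  obtain ⟨C, hC, hcoef⟩ := exists_isCoef_profile hs
  let ι := {p : ℝ × (Fin 9 → L2) // ∀ k, ‖p.2 k‖ ≤ R}
  have hcos : ∀ i : ι, |√2 * Real.cos i.1.1| ≤ √2 := fun i => abs_sqrt_two_mul_cos_le _
  have hsin : ∀ i : ι, |√2 * Real.sin i.1.1| ≤ √2 := fun i => abs_sqrt_two_mul_sin_le _
  have hzero : UnifMul hs fun (_ : ι) (_ : Plane) => (0 : ℝ) :=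
    UnifMul.of_isCoef hC fun i => by simpa using (hcoef 0 (by simp)).1
  have key : ∀ k, UnifSobolev hs fun (i : ι) x =>
      residual (soliton i.1.1 x) (fun k => (bessel hs).op (i.1.2 k) x) k := by
    intro k
    refine UnifSobolev.residual (fun k => ?_) ?_ ?_ ?_ ?_ ?_ ?_ ?_ k
    · refine ⟨max R 0, le_max_right _ _, fun i => ⟨i.1.2 k, (i.2 k).trans (le_max_left _ _), ?_⟩⟩
      exact EventuallyEq.rfl
    · simpa only [soliton_eq, lineBackground] using hzero
    · simp only [soliton_eq, lineBackground]
      exact UnifMul.of_isCoef hC fun i => (hcoef _ (hcos i)).1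
    · simp only [soliton_eq, lineBackground]
      exact UnifMul.of_isCoef hC fun i => (hcoef _ (hsin i)).1
    · simp only [soliton_eq, lineBackground]
      intro j
      fin_cases j
      · exact UnifMul.of_isCoef hC fun i => (hcoef _ (hcos i)).2.1
      · exact hzero
    · simp only [soliton_eq, lineBackground]
      intro j
      fin_cases j
      · exact UnifMul.of_isCoef hC fun i => (hcoef _ (hsin i)).2.1
      · exact hzero
    · simp only [soliton_eq, lineBackground]
      exact UnifMul.of_isCoef hC fun i => (hcoef _ (hcos i)).2.2
    · simp only [soliton_eq, lineBackground]
      exact UnifMul.of_isCoef hC fun i => (hcoef _ (hsin i)).2.2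
  choose D hD hZ using key
  refine ⟨∑ k, D k, Finset.sum_nonneg fun k _ => hD k, fun t V hV k => ?_⟩
  obtain ⟨Z, h1, h2⟩ := hZ k ⟨(t, V), hV⟩
  exact ⟨Z, h1.trans (Finset.single_le_sum (fun k _ => hD k) (Finset.mem_univ k)), h2⟩

/-! ### Pointwise algebra of the lower-order terms -/

/-- The first-order terms at one point: `b` is the background, `u` the solution and `p` its
gradient. -/
def firstOrder (lam : ℝ) (b : Background) (u : Fin 9 → ℝ) (p : Fin 2 → Fin 9 → ℝ) : Fin 9 → ℝ :=
  ∑ j, (A j u + B j b + lam • C j) *ᵥ p j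

/-- The terms of order one and zero at one point. -/
def lowerTerms (lam : ℝ) (b : Background) (u : Fin 9 → ℝ) (p : Fin 2 → Fin 9 → ℝ) : Fin 9 → ℝ :=
  firstOrder lam b u p + residual b u

theorem lowerOrder_eq (lam : ℝ) (W : Fin 9 → L2) (t : ℝ) (x : Plane) :
    lowerOrder lam W t x = lowerTerms lam (soliton t x) (val W x)
      (fun j => val (fun k => weakDeriv j (W k)) x) := by
  rw [lowerOrder, zeroth_order_eq_residual]; rfl

theorem lowerTerms_sub (lam : ℝ) (b : Background) (u : Fin 9 → ℝ) (p p' : Fin 2 → Fin 9 → ℝ) :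
    lowerTerms lam b u p - lowerTerms lam b u p' = firstOrder lam b u (p - p') := by
  simp only [lowerTerms, firstOrder, Pi.sub_apply, Matrix.mulVec_sub, Finset.sum_sub_distrib]
  abel

/-- The quadratic form of the first-order terms only involves symmetric expressions, because the
matrices are symmetric. -/
theorem sum_firstOrder_mul (lam : ℝ) (b : Background) (u v : Fin 9 → ℝ)
    (p : Fin 2 → Fin 9 → ℝ) :
    ∑ i, firstOrder lam b u p i * v i =
      -(u 4 * (p 0 5 * v 0 + p 0 0 * v 5)) + -(u 4 * (p 1 6 * v 0 + p 1 0 * v 6))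
        + (-(b.G * (p 0 5 * v 0 + p 0 0 * v 5)) + -(b.G * (p 1 6 * v 0 + p 1 0 * v 6)))
        + (u 3 * (p 0 7 * v 0 + p 0 0 * v 7) + u 3 * (p 1 8 * v 0 + p 1 0 * v 8))
        + (b.F * (p 0 7 * v 0 + p 0 0 * v 7) + b.F * (p 1 8 * v 0 + p 1 0 * v 8))
        + (lam * (p 0 1 * v 0 + p 0 0 * v 1) + lam * (p 1 2 * v 0 + p 1 0 * v 2)) := by
  simp [firstOrder, A, B, C, coupling, Matrix.mulVec, dotProduct, Fin.sum_univ_succ]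
  ring

/-- The lower-order terms are polynomials in the two functions of time, the values of `Q`, `Q'`,
    `Q''`,
the unknowns and their first derivatives. -/
theorem contDiff_lowerTerms (lam : ℝ) :
    ContDiff ℝ 1 fun z : (Fin 5 → ℝ) × (Fin 9 → ℝ) × (Fin 2 → Fin 9 → ℝ) =>
      lowerTerms lam (lineBackground (z.1 0) (z.1 1) (z.1 2) (z.1 3) (z.1 4)) z.2.1 z.2.2 := by
  have h1 : ∀ i, ContDiff ℝ 1 fun z : (Fin 5 → ℝ) × (Fin 9 → ℝ) × (Fin 2 → Fin 9 → ℝ) =>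
      z.1 i := fun i => by fun_prop
  have h2 : ∀ i, ContDiff ℝ 1 fun z : (Fin 5 → ℝ) × (Fin 9 → ℝ) × (Fin 2 → Fin 9 → ℝ) =>
      z.2.1 i := fun i => by fun_prop
  have h3 : ∀ j i, ContDiff ℝ 1 fun z : (Fin 5 → ℝ) × (Fin 9 → ℝ) × (Fin 2 → Fin 9 → ℝ) =>
      z.2.2 j i := fun j i => by fun_prop
  refine contDiff_pi.2 fun i => ?_
  fin_cases i <;>
  · simp [lowerTerms, firstOrder, residual, lineBackground, A, B, C, coupling,
      dotProduct, Fin.sum_univ_succ]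
    fun_prop

theorem lowerTerms_zero (lam : ℝ) (b : Background) : lowerTerms lam b 0 0 = 0 := by
  ext i
  fin_cases i <;> simp [lowerTerms, firstOrder, residual]

theorem pi_norm_le_sum {ι : Type*} [Fintype ι] {G : ι → Type*}
    [∀ i, SeminormedAddCommGroup (G i)] (f : ∀ i, G i) : ‖f‖ ≤ ∑ i, ‖f i‖ :=
  (pi_norm_le_iff_of_nonneg (Finset.sum_nonneg fun _ _ => norm_nonneg _)).2 fun i =>
    Finset.single_le_sum (f := fun i => ‖f i‖) (fun _ _ => norm_nonneg _) (Finset.mem_univ i)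

/-- Lipschitz continuity of the lower-order terms on bounded sets, uniformly in time. -/
theorem exists_lipschitz_lowerTerms (lam M : ℝ) : ∃ N : ℝ, 0 ≤ N ∧
    ∀ (t : ℝ) (x : Plane) (u u' : Fin 9 → ℝ) (p p' : Fin 2 → Fin 9 → ℝ),
      (∀ k, |u k| ≤ M) → (∀ k, |u' k| ≤ M) → (∀ j k, |p j k| ≤ M) → (∀ j k, |p' j k| ≤ M) →
      ∀ i, |lowerTerms lam (soliton t x) u p i - lowerTerms lam (soliton t x) u' p' i| ≤
        N * (∑ k, |u k - u' k| + ∑ j, ∑ k, |p j k - p' j k|) := by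
  obtain ⟨M', hM'⟩ := exists_bound_profile
  set m : ℝ := max (max M M') (√2) with hm
  have hm0 : 0 ≤ m := (Real.sqrt_nonneg 2).trans (le_max_right _ _)
  obtain ⟨N, hN⟩ := (contDiff_lowerTerms lam).locallyLipschitz.locallyLipschitzOn
    (s := Metric.closedBall 0 m) |>.exists_lipschitzOnWith_of_compact (isCompact_closedBall 0 m)
  refine ⟨N, N.2, fun t x u u' p p' hu hu' hp hp' i => ?_⟩
  let θ : Fin 5 → ℝ := ![√2 * Real.cos t, √2 * Real.sin t, Q (x 0), deriv Q (x 0),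
    deriv (deriv Q) (x 0)]
  have hle : ∀ r : ℝ, r ≤ M → r ≤ m := fun r h => h.trans ((le_max_left _ _).trans
      (le_max_left _ _))
  have hθ : ‖θ‖ ≤ m := by
    have h2 : ∀ r : ℝ, r ≤ M' → r ≤ m := fun r h =>
      h.trans ((le_max_right _ _).trans (le_max_left _ _))
    refine (pi_norm_le_iff_of_nonneg hm0).2 fun k => ?_
    rw [Real.norm_eq_abs]
    fin_cases k
    · exact (abs_sqrt_two_mul_cos_le t).trans (le_max_right _ _)
    · exact (abs_sqrt_two_mul_sin_le t).trans (le_max_right _ _)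
    · exact h2 _ (hM' _).1
    · exact h2 _ (hM' _).2.1
    · exact h2 _ (hM' _).2.2
  have hball : ∀ (u : Fin 9 → ℝ) (p : Fin 2 → Fin 9 → ℝ), (∀ k, |u k| ≤ M) →
      (∀ j k, |p j k| ≤ M) → (θ, u, p) ∈ Metric.closedBall
        (0 : (Fin 5 → ℝ) × (Fin 9 → ℝ) × (Fin 2 → Fin 9 → ℝ)) m := by
    intro u p hu hp
    rw [mem_closedBall_zero_iff, Prod.norm_mk, Prod.norm_mk]
    refine max_le hθ (max_le ?_ ?_)
    · exact (pi_norm_le_iff_of_nonneg hm0).2 fun k => hle _ (hu k)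
    · exact (pi_norm_le_iff_of_nonneg hm0).2 fun j => (pi_norm_le_iff_of_nonneg hm0).2 fun k =>
        hle _ (hp j k)
  have h := hN.dist_le_mul _ (hball u p hu hp) _ (hball u' p' hu' hp')
  rw [dist_eq_norm, dist_eq_norm] at h
  have h1 := (norm_le_pi_norm _ i).trans h
  rw [Pi.sub_apply, Real.norm_eq_abs] at h1
  simp only [θ] at h1
  rw [soliton_eq]
  refine h1.trans (mul_le_mul_of_nonneg_left ?_ N.2)
  rw [Prod.mk_sub_mk, Prod.mk_sub_mk, sub_self, Prod.norm_mk, Prod.norm_mk, norm_zero]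
  have hs1 : 0 ≤ ∑ k, |u k - u' k| := Finset.sum_nonneg fun k _ => abs_nonneg _
  have hs2 : 0 ≤ ∑ j, ∑ k, |p j k - p' j k| :=
    Finset.sum_nonneg fun j _ => Finset.sum_nonneg fun k _ => abs_nonneg _
  have hp1 : ‖u - u'‖ ≤ ∑ k, |u k - u' k| := pi_norm_le_sum (u - u')
  have hp2 : ‖p - p'‖ ≤ ∑ j, ∑ k, |p j k - p' j k| :=
    (pi_norm_le_sum (p - p')).trans
      (Finset.sum_le_sum fun j _ => pi_norm_le_sum (p j - p' j))
  refine max_le (by positivity) (max_le ?_ ?_) <;> linarith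

/-- The function with `H^s` coordinates `V`, that is `⟨D⟩^{-s} V`. -/
def sob {s : ℝ} (hs : 2 < s) (V : Fin 9 → L2) : Fin 9 → L2 := fun k => (bessel hs).op (V k)

/-- The derivatives of `sob hs V`. -/
def gradSob {s : ℝ} (hs : 2 < s) (V : Fin 9 → L2) (j : Fin 2) : Fin 9 → L2 :=
  fun k => (dBessel hs j).op (V k)

section Sob

variable {s : ℝ} (hs : 2 < s)

theorem sob_sub (V V' : Fin 9 → L2) (k : Fin 9) : sob hs (V - V') k = sob hs V k - sob hs V' k :=
  map_sub _ _ _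

theorem gradSob_sub (V V' : Fin 9 → L2) (j : Fin 2) (k : Fin 9) :
    gradSob hs (V - V') j k = gradSob hs V j k - gradSob hs V' j k :=
  map_sub _ _ _

/-- The terms of order one and zero at the point `x`. -/
def lowerAt (lam t : ℝ) (V : Fin 9 → L2) (x : Plane) : Fin 9 → ℝ :=
  lowerTerms lam (soliton t x) (val (sob hs V) x) (fun j => val (gradSob hs V j) x)

theorem lowerOrder_sob (lam t : ℝ) (V : Fin 9 → L2) (x : Plane) :
    lowerOrder lam (sob hs V) t x = lowerAt hs lam t V x := by
  rw [lowerOrder_eq, lowerAt]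
  simp only [sob, weakDeriv_bessel]
  rfl

theorem ae_sob_sub (V V' : Fin 9 → L2) :
    ∀ᵐ x, val (sob hs (V - V')) x = val (sob hs V) x - val (sob hs V') x := by
  have h : ∀ k, ∀ᵐ x, sob hs (V - V') k x = sob hs V k x - sob hs V' k x := fun k => by
    rw [sob_sub]; exact Lp.coeFn_sub _ _
  filter_upwards [ae_all_iff.2 h] with x hx
  funext k
  exact hx k

theorem ae_gradSob_sub (V V' : Fin 9 → L2) :
    ∀ᵐ x, ∀ j, val (gradSob hs (V - V') j) x = val (gradSob hs V j) x - val
        (gradSob hs V' j) x := by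
  have h : ∀ j k, ∀ᵐ x, gradSob hs (V - V') j k x = gradSob hs V j k x - gradSob hs V' j k x :=
    fun j k => by rw [gradSob_sub]; exact Lp.coeFn_sub _ _
  filter_upwards [ae_all_iff.2 fun j => ae_all_iff.2 (h j)] with x hx j
  funext k
  exact hx j k

theorem ae_abs_sob_le {R : ℝ} {V : Fin 9 → L2} (hV : ‖V‖ ≤ R) :
    ∀ᵐ x, ∀ k, |val (sob hs V) x k| ≤ embConst s * R := by
  refine ae_all_iff.2 fun k => ?_
  filter_upwards [abs_bessel_le hs (V k)] with x hx
  exact hx.trans (mul_le_mul_of_nonneg_left ((norm_le_pi_norm V k).trans hV) (embConst_nonneg s))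

theorem ae_abs_gradSob_le {R : ℝ} {V : Fin 9 → L2} (hV : ‖V‖ ≤ R) :
    ∀ᵐ x, ∀ j k, |val (gradSob hs V j) x k| ≤ embConst s * R := by
  refine ae_all_iff.2 fun j => ae_all_iff.2 fun k => ?_
  filter_upwards [abs_dBessel_le hs j (V k)] with x hx
  exact hx.trans (mul_le_mul_of_nonneg_left ((norm_le_pi_norm V k).trans hV) (embConst_nonneg s))

/-- The norm of `sob hs V` in `H¹`, up to equivalence. -/
def firstNorm (V : Fin 9 → L2) : ℝ := ∑ k, ‖sob hs V k‖ + ∑ j, ∑ k, ‖gradSob hs V j k‖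

theorem aestronglyMeasurable_lowerAt (lam t : ℝ) (V : Fin 9 → L2) (i : Fin 9) :
    AEStronglyMeasurable fun x => lowerAt hs lam t V x i := by
  have hc := (continuous_apply i).comp (contDiff_lowerTerms lam).continuous
  have h0 : Measurable fun x : Plane => x 0 := by fun_prop
  have hQ : ∀ q : ℝ → ℝ, (∃ g : SchwartzMap ℝ ℝ, ∀ x, g x = q x) →
      AEMeasurable fun x : Plane => q (x 0) := by
    rintro q ⟨g, hg⟩
    simp only [← hg]
    exact (g.continuous.measurable.comp h0).aemeasurable
  have hθ : AEMeasurable fun x : Plane => (![√2 * Real.cos t, √2 * Real.sin t, Q (x 0),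
      deriv Q (x 0), deriv (deriv Q) (x 0)] : Fin 5 → ℝ) := by
    refine aemeasurable_pi_iff.2 fun k => ?_
    fin_cases k
    · exact aemeasurable_const
    · exact aemeasurable_const
    · exact hQ Q ⟨profile, fun x => rfl⟩
    · exact hQ (deriv Q) deriv_Q_eq
    · exact hQ (deriv (deriv Q)) deriv_deriv_Q_eq
  have hu : AEMeasurable fun x => val (sob hs V) x :=
    aemeasurable_pi_iff.2 fun k => (Lp.aestronglyMeasurable _).aemeasurable
  have hp : AEMeasurable fun x => (fun j => val (gradSob hs V j) x : Fin 2 → Fin 9 → ℝ) :=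
    aemeasurable_pi_iff.2 fun j => aemeasurable_pi_iff.2 fun k =>
      (Lp.aestronglyMeasurable _).aemeasurable
  have := (hc.measurable.comp_aemeasurable (hθ.prodMk (hu.prodMk hp))).aestronglyMeasurable
  refine this.congr (Eventually.of_forall fun x => ?_)
  simp only [lowerAt, soliton_eq]
  rfl

/-- A sum of absolute values of square-integrable functions, as an element of `L²`. -/
theorem exists_sum_abs {ι : Type*} (S : Finset ι) (g : ι → L2) :
    ∃ G : L2, ‖G‖ ≤ ∑ i ∈ S, ‖g i‖ ∧ ∀ᵐ x, G x = ∑ i ∈ S, |g i x| := by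
  classical
  induction S using Finset.induction_on with
  | empty => exact ⟨0, by simp, by simp⟩
  | insert a S ha ih =>
    obtain ⟨G, h1, h2⟩ := ih
    refine ⟨|g a| + G, ?_, ?_⟩
    · rw [Finset.sum_insert ha]
      exact (norm_add_le _ _).trans (add_le_add (norm_abs_eq_norm _).le h1)
    · filter_upwards [h2, Lp.coeFn_add |g a| G, Lp.coeFn_abs (g a)] with x e1 e2 e3
      rw [e2, Pi.add_apply, e3, e1, Finset.sum_insert ha]

/-- The functions occurring in `firstNorm`, dominated pointwise. -/
theorem exists_firstNorm_majorant (V : Fin 9 → L2) :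
    ∃ G : L2, ‖G‖ ≤ firstNorm hs V ∧ ∀ᵐ x, G x =
      ∑ k, |val (sob hs V) x k| + ∑ j, ∑ k, |val (gradSob hs V j) x k| := by
  obtain ⟨G, h1, h2⟩ := exists_sum_abs Finset.univ (sob hs V)
  obtain ⟨G', h1', h2'⟩ := exists_sum_abs (Finset.univ ×ˢ Finset.univ)
    fun q : Fin 2 × Fin 9 => gradSob hs V q.1 q.2
  rw [Finset.sum_product] at h1'
  refine ⟨G + G', (norm_add_le _ _).trans (add_le_add h1 h1'), ?_⟩
  filter_upwards [h2, h2', Lp.coeFn_add G G'] with x e1 e2 e3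
  rw [e3, Pi.add_apply, e1, e2, Finset.sum_product]
  rfl

theorem exists_lipschitz_lowerAt (lam R : ℝ) : ∃ N : ℝ, 0 ≤ N ∧
    ∀ (t : ℝ) (V V' : Fin 9 → L2), ‖V‖ ≤ R → ‖V'‖ ≤ R → ∀ᵐ x, ∀ i,
      |lowerAt hs lam t V x i - lowerAt hs lam t V' x i| ≤
        N * (∑ k, |val (sob hs (V - V')) x k| + ∑ j, ∑ k, |val (gradSob hs (V - V') j) x k|) := by
  obtain ⟨N, hN, h⟩ := exists_lipschitz_lowerTerms lam (embConst s * R)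
  refine ⟨N, hN, fun t V V' hV hV' => ?_⟩
  filter_upwards [ae_abs_sob_le hs hV, ae_abs_sob_le hs hV', ae_abs_gradSob_le hs hV,
    ae_abs_gradSob_le hs hV', ae_sob_sub hs V V', ae_gradSob_sub hs V V'] with x h1 h2 h3 h4 h5 h6 i
  simp only [h5, h6, Pi.sub_apply]
  exact h t x _ _ _ _ h1 h2 h3 h4 i

theorem ae_lowerAt_zero (lam t : ℝ) : ∀ᵐ x, lowerAt hs lam t 0 x = 0 := by
  have h1 : ∀ᵐ x, ∀ k, sob hs 0 k x = 0 := ae_all_iff.2 fun k => by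
    rw [sob, Pi.zero_apply, map_zero]; exact Lp.coeFn_zero ℝ 2 volume
  have h2 : ∀ᵐ x, ∀ j k, gradSob hs 0 j k x = 0 := ae_all_iff.2 fun j => ae_all_iff.2 fun k => by
    rw [gradSob, Pi.zero_apply, map_zero]; exact Lp.coeFn_zero ℝ 2 volume
  filter_upwards [h1, h2] with x h1 h2
  have e1 : val (sob hs 0) x = 0 := funext h1
  have e2 : (fun j => val (gradSob hs 0 j) x) = 0 := funext fun j => funext (h2 j)
  rw [lowerAt, e1, e2, lowerTerms_zero]

theorem exists_bound_lowerAt (lam R : ℝ) : ∃ N : ℝ, 0 ≤ N ∧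
    ∀ (t : ℝ) (V : Fin 9 → L2), ‖V‖ ≤ R → ∀ᵐ x, ∀ i, |lowerAt hs lam t V x i| ≤
        N * (∑ k, |val (sob hs V) x k| + ∑ j, ∑ k, |val (gradSob hs V j) x k|) := by
  obtain ⟨N, hN, h⟩ := exists_lipschitz_lowerAt hs lam R
  refine ⟨N, hN, fun t V hV => ?_⟩
  have hR : ‖(0 : Fin 9 → L2)‖ ≤ R := by rw [norm_zero]; exact (norm_nonneg V).trans hV
  filter_upwards [h t V 0 hV hR, ae_lowerAt_zero hs lam t] with x hx h0 i
  simpa [h0] using hx i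

theorem memLp_lowerAt (lam t : ℝ) (V : Fin 9 → L2) (i : Fin 9) :
    MemLp (fun x => lowerAt hs lam t V x i) 2 := by
  obtain ⟨N, hN, h⟩ := exists_bound_lowerAt hs lam ‖V‖
  obtain ⟨G, -, hG⟩ := exists_firstNorm_majorant hs V
  refine MemLp.of_le_mul (c := N) (Lp.memLp G) (aestronglyMeasurable_lowerAt hs lam t V i) ?_
  filter_upwards [h t V le_rfl, hG] with x h1 h2
  rw [Real.norm_eq_abs]
  refine (h1 i).trans (mul_le_mul_of_nonneg_left ?_ hN)
  rw [h2]
  exact Real.le_norm_self _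

/-- The terms of order one and zero as an element of `L²`. -/
def nonlin (lam t : ℝ) (V : Fin 9 → L2) : Fin 9 → L2 := fun i => (memLp_lowerAt hs lam t V i).toLp

theorem coeFn_nonlin (lam t : ℝ) (V : Fin 9 → L2) :
    ∀ᵐ x, ∀ i, nonlin hs lam t V i x = lowerAt hs lam t V x i :=
  ae_all_iff.2 fun i => (memLp_lowerAt hs lam t V i).coeFn_toLp

/-- Lipschitz continuity of the lower-order terms from `H¹` to `L²`, on bounded sets of `H^s`. -/
theorem exists_lipschitz_nonlin (lam R : ℝ) : ∃ N : ℝ, 0 ≤ N ∧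
    ∀ (t : ℝ) (V V' : Fin 9 → L2), ‖V‖ ≤ R → ‖V'‖ ≤ R → ∀ i,
      ‖nonlin hs lam t V i - nonlin hs lam t V' i‖ ≤ N * firstNorm hs (V - V') := by
  obtain ⟨N, hN, h⟩ := exists_lipschitz_lowerAt hs lam R
  refine ⟨N, hN, fun t V V' hV hV' i => ?_⟩
  obtain ⟨G, h1, hG⟩ := exists_firstNorm_majorant hs (V - V')
  refine le_trans ?_ (mul_le_mul_of_nonneg_left h1 hN)
  apply Lp.norm_le_mul_norm_of_ae_le_mul
  filter_upwards [h t V V' hV hV', hG, coeFn_nonlin hs lam t V, coeFn_nonlin hs lam t V',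
    Lp.coeFn_sub (nonlin hs lam t V i) (nonlin hs lam t V' i)] with x h1 h2 h3 h4 h5
  rw [h5, Pi.sub_apply, h3, h4, Real.norm_eq_abs]
  refine (h1 i).trans (mul_le_mul_of_nonneg_left ?_ hN)
  rw [h2]
  exact Real.le_norm_self _

theorem nonlin_zero (lam t : ℝ) : nonlin hs lam t 0 = 0 := by
  funext i
  refine Lp.ext ?_
  filter_upwards [coeFn_nonlin hs lam t 0, ae_lowerAt_zero hs lam t,
    Lp.coeFn_zero ℝ 2 (volume : Measure Plane)] with x h1 h2 h3
  rw [h1, h2, Pi.zero_apply, Pi.zero_apply, h3, Pi.zero_apply]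

/-- Estimate of the lower-order terms in `L²`, linear in the function and its first derivatives. -/
theorem exists_bound_nonlin (lam R : ℝ) : ∃ N : ℝ, 0 ≤ N ∧
    ∀ (t : ℝ) (V : Fin 9 → L2), ‖V‖ ≤ R → ∀ i, ‖nonlin hs lam t V i‖ ≤ N * firstNorm hs V := by
  obtain ⟨N, hN, h⟩ := exists_lipschitz_nonlin hs lam R
  refine ⟨N, hN, fun t V hV i => ?_⟩
  have hR : ‖(0 : Fin 9 → L2)‖ ≤ R := by rw [norm_zero]; exact (norm_nonneg V).trans hV
  simpa [nonlin_zero] using h t V 0 hV hR i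

theorem norm_bessel_op_le (f : L2) : ‖(bessel hs).op f‖ ≤ ‖f‖ := by
  simpa using (bessel hs).norm_op_le (C := 1) (fun ξ => by
    rw [bessel_symbol, Complex.norm_real, Real.norm_eq_abs,
      abs_of_nonneg (Real.rpow_nonneg (jb_pos ξ).le _)]
    exact jb_rpow_neg_le_one hs ξ) f

theorem norm_dBessel_op_le (j : Fin 2) (f : L2) : ‖(dBessel hs j).op f‖ ≤ ‖f‖ := by
  simpa using (dBessel hs j).norm_op_le (C := 1) (fun ξ => by
    rw [dBessel_symbol, norm_mul, Complex.norm_I, one_mul, Complex.norm_real, Real.norm_eq_abs]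
    exact (coord_mul_jb_rpow_le s j ξ).trans
      (Real.rpow_le_one_of_one_le_of_nonpos (one_le_jb ξ) (by linarith))) f

theorem firstNorm_le (V : Fin 9 → L2) : firstNorm hs V ≤ 27 * ‖V‖ := by
  have h1 : ∀ k, ‖sob hs V k‖ ≤ ‖V‖ := fun k =>
    (norm_bessel_op_le hs (V k)).trans (norm_le_pi_norm V k)
  have h2 : ∀ j k, ‖gradSob hs V j k‖ ≤ ‖V‖ := fun j k =>
    (norm_dBessel_op_le hs j (V k)).trans (norm_le_pi_norm V k)
  calc firstNorm hs V ≤ ∑ _k : Fin 9, ‖V‖ + ∑ _j : Fin 2, ∑ _k : Fin 9, ‖V‖ := by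
        unfold firstNorm
        gcongr with k _ j _ k _
        · exact h1 k
        · exact h2 j k
    _ = 27 * ‖V‖ := by simp; ring

/-- Continuity in time, by dominated convergence. -/
theorem continuous_nonlin (lam : ℝ) (V : Fin 9 → L2) (i : Fin 9) :
    Continuous fun t => nonlin hs lam t V i := by
  obtain ⟨N, hN, h⟩ := exists_bound_lowerAt hs lam ‖V‖
  obtain ⟨G, -, hG⟩ := exists_firstNorm_majorant hs V
  rw [continuous_iff_continuousAt]
  intro t₀
  rw [ContinuousAt, tendsto_iff_norm_sub_tendsto_zero]
  have hsq : ∀ t, ‖nonlin hs lam t V i - nonlin hs lam t₀ V i‖ ^ 2 =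
      ∫ x, (lowerAt hs lam t V x i - lowerAt hs lam t₀ V x i) ^ 2 := fun t => by
    rw [← real_inner_self_eq_norm_sq, inner_eq_integral]
    refine integral_congr_ae ?_
    filter_upwards [coeFn_nonlin hs lam t V, coeFn_nonlin hs lam t₀ V,
      Lp.coeFn_sub (nonlin hs lam t V i) (nonlin hs lam t₀ V i)] with x h1 h2 h3
    rw [h3, Pi.sub_apply, h1, h2, sq]
  suffices hlim : Tendsto (fun t => ‖nonlin hs lam t V i - nonlin hs lam t₀ V i‖ ^ 2)
      (𝓝 t₀) (𝓝 0) by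
    have := (Real.continuous_sqrt.tendsto 0).comp hlim
    rw [Real.sqrt_zero] at this
    exact this.congr fun t => Real.sqrt_sq (norm_nonneg _)
  simp only [hsq]
  have hzero : (0 : ℝ) = ∫ _x : Plane, (0 : ℝ) := by simp
  rw [hzero]
  refine tendsto_integral_filter_of_dominated_convergence (fun x => (2 * (N * G x)) ^ 2) ?_ ?_ ?_ ?_
  · exact Eventually.of_forall fun t => ((aestronglyMeasurable_lowerAt hs lam t V i).sub
      (aestronglyMeasurable_lowerAt hs lam t₀ V i)).pow 2
  · refine Eventually.of_forall fun t => ?_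
    filter_upwards [h t V le_rfl, h t₀ V le_rfl, hG] with x h1 h2 h3
    rw [Real.norm_eq_abs, abs_pow]
    gcongr
    refine (abs_sub _ _).trans ?_
    rw [h3]
    linarith [h1 i, h2 i]
  · have := (Lp.memLp G).integrable_sq.const_mul ((2 * N) ^ 2)
    refine this.congr (Eventually.of_forall fun x => ?_)
    ring
  · refine Eventually.of_forall fun x => ?_
    have hc : Continuous fun t => lowerAt hs lam t V x i := by
      have hc := (continuous_apply i).comp (contDiff_lowerTerms lam).continuous
      have h2 : Continuous fun t : ℝ => (![√2 * Real.cos t, √2 * Real.sin t, Q (x 0),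
          deriv Q (x 0), deriv (deriv Q) (x 0)] : Fin 5 → ℝ) := by
        refine continuous_pi fun k => ?_
        fin_cases k <;> simp <;> fun_prop
      have h3 := hc.comp (h2.prodMk (continuous_const (y := (val (sob hs V) x,
        (fun j => val (gradSob hs V j) x : Fin 2 → Fin 9 → ℝ)))))
      refine h3.congr fun t => ?_
      simp only [lowerAt, soliton_eq]
      rfl
    have := ((hc.tendsto t₀).sub_const (lowerAt hs lam t₀ V x i)).pow 2
    simpa using this

end Sob

/-! ### Energy estimates -/

theorem Multiplier.op_op_eq {m₁ m₂ m₃ m₄ : Multiplier}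
    (h : ∀ ξ, m₁.symbol ξ * m₂.symbol ξ = m₃.symbol ξ * m₄.symbol ξ) (f : L2) :
    m₁.op (m₂.op f) = m₃.op (m₄.op f) := by
  rw [← Multiplier.op_mul, ← Multiplier.op_mul]
  exact Multiplier.ext_op h f

theorem Multiplier.op_op_eq_op {m₁ m₂ m₃ : Multiplier}
    (h : ∀ ξ, m₁.symbol ξ * m₂.symbol ξ = m₃.symbol ξ) (f : L2) :
    m₁.op (m₂.op f) = m₃.op f := by
  rw [← Multiplier.op_mul]
  exact Multiplier.ext_op h f

/-- A real multiplier composed with an imaginary one is skew-symmetric. For constant coefficients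
this replaces the commutator estimate. -/
theorem Multiplier.inner_op_add_inner_op {m₁ m₂ : Multiplier}
    (h₁ : ∀ ξ, conj (m₁.symbol ξ) = -m₁.symbol ξ) (h₂ : ∀ ξ, conj (m₂.symbol ξ) = m₂.symbol ξ)
    (f g : L2) : inner ℝ (m₁.op f) (m₂.op g) + inner ℝ (m₁.op g) (m₂.op f) = 0 := by
  rw [m₁.inner_op_of_imaginary h₁, Multiplier.op_op_eq (m₃ := m₂) (m₄ := m₁)
    (fun _ => mul_comm _ _) g, ← m₂.inner_op_of_real h₂, real_inner_comm]
  ring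

theorem cut_mul_cut (n : ℕ) (ξ : Plane) : ((cut n ξ : ℝ) : ℂ) * (cut n ξ : ℝ) = (cut n ξ : ℝ) := by
  rw [← Complex.ofReal_mul, cut_mul_self]

theorem conj_bessel_symbol {s : ℝ} (hs : 2 < s) (ξ : Plane) :
    conj ((bessel hs).symbol ξ) = (bessel hs).symbol ξ := Complex.conj_ofReal _

theorem conj_proj_symbol (n : ℕ) (ξ : Plane) :
    conj ((proj n).symbol ξ) = (proj n).symbol ξ := Complex.conj_ofReal _

theorem conj_invBessel_symbol {s : ℝ} (hs : 2 < s) (n : ℕ) (ξ : Plane) :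
    conj ((invBessel hs n).symbol ξ) = (invBessel hs n).symbol ξ := Complex.conj_ofReal _

theorem conj_lapProj_symbol (n : ℕ) (ξ : Plane) :
    conj ((lapProj n).symbol ξ) = (lapProj n).symbol ξ := Complex.conj_ofReal _

theorem conj_lapBessel_symbol {s : ℝ} (hs : 2 < s) (ξ : Plane) :
    conj ((lapBessel hs).symbol ξ) = (lapBessel hs).symbol ξ := Complex.conj_ofReal _

theorem conj_dBessel_symbol {s : ℝ} (hs : 2 < s) (j : Fin 2) (ξ : Plane) :
    conj ((dBessel hs j).symbol ξ) = -(dBessel hs j).symbol ξ := by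
  rw [dBessel_symbol, map_mul, Complex.conj_I, Complex.conj_ofReal, neg_mul]

theorem proj_proj (n : ℕ) (f : L2) : (proj n).op ((proj n).op f) = (proj n).op f :=
  Multiplier.op_op_eq_op (cut_mul_cut n) f

theorem norm_proj_op_le (n : ℕ) (f : L2) : ‖(proj n).op f‖ ≤ ‖f‖ := by
  simpa using (proj n).norm_op_le (C := 1) (fun ξ => by
    rw [proj_symbol, Complex.norm_real, Real.norm_eq_abs]; exact abs_cut_le_one n ξ) f

theorem invBessel_proj {s : ℝ} (hs : 2 < s) (n : ℕ) (f : L2) :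
    (invBessel hs n).op ((proj n).op f) = (invBessel hs n).op f :=
  Multiplier.op_op_eq_op (fun ξ => by
    rw [invBessel_symbol, proj_symbol, ← Complex.ofReal_mul, mul_right_comm, cut_mul_self]) f

theorem proj_invBessel {s : ℝ} (hs : 2 < s) (n : ℕ) (f : L2) :
    (proj n).op ((invBessel hs n).op f) = (invBessel hs n).op f :=
  Multiplier.op_op_eq_op (fun ξ => by
    rw [invBessel_symbol, proj_symbol, ← Complex.ofReal_mul, ← mul_assoc, cut_mul_self]) f

theorem lapProj_proj (n : ℕ) (f : L2) : (lapProj n).op ((proj n).op f) = (lapProj n).op f :=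
  Multiplier.op_op_eq_op (fun ξ => by
    rw [lapProj_symbol, proj_symbol, ← Complex.ofReal_mul, neg_mul, mul_right_comm,
      cut_mul_self]) f

theorem proj_lapProj (n : ℕ) (f : L2) : (proj n).op ((lapProj n).op f) = (lapProj n).op f :=
  Multiplier.op_op_eq_op (fun ξ => by
    rw [lapProj_symbol, proj_symbol, ← Complex.ofReal_mul, mul_neg, ← mul_assoc,
      cut_mul_self]) f

theorem invBessel_bessel {s : ℝ} (hs : 2 < s) (n : ℕ) (f : L2) :
    (invBessel hs n).op ((bessel hs).op f) = (proj n).op f :=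
  Multiplier.op_op_eq_op (fun ξ => by
    rw [invBessel_symbol, bessel_symbol, proj_symbol, ← Complex.ofReal_mul, mul_assoc,
      jb_rpow_mul_neg, mul_one]) f

theorem bessel_invBessel {s : ℝ} (hs : 2 < s) (n : ℕ) (f : L2) :
    (bessel hs).op ((invBessel hs n).op f) = (proj n).op f := by
  rw [Multiplier.op_op_eq (m₃ := invBessel hs n) (m₄ := bessel hs) (fun _ => mul_comm _ _) f,
    invBessel_bessel]

theorem bessel_lapProj {s : ℝ} (hs : 2 < s) (n : ℕ) (f : L2) :
    (bessel hs).op ((lapProj n).op f) = (lapBessel hs).op ((proj n).op f) :=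
  Multiplier.op_op_eq (fun ξ => by
    rw [lapProj_symbol, bessel_symbol, proj_symbol, lapBessel_symbol, ← Complex.ofReal_mul,
      ← Complex.ofReal_mul]
    congr 1
    ring) f

theorem proj_bessel {s : ℝ} (hs : 2 < s) (n : ℕ) (f : L2) :
    (proj n).op ((bessel hs).op f) = (bessel hs).op ((proj n).op f) :=
  Multiplier.op_op_eq (fun _ => mul_comm _ _) f

/-- `f` is integrable and its integral is at most `E` in absolute value. -/
def IntLe (f : Plane → ℝ) (E : ℝ) : Prop := Integrable f ∧ |∫ x, f x| ≤ E

theorem IntLe.add {f g : Plane → ℝ} {E E' : ℝ} (hf : IntLe f E) (hg : IntLe g E') :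
    IntLe (fun x => f x + g x) (E + E') := by
  refine ⟨hf.1.add hg.1, ?_⟩
  rw [integral_add hf.1 hg.1]
  exact (abs_add_le _ _).trans (add_le_add hf.2 hg.2)

theorem IntLe.neg {f : Plane → ℝ} {E : ℝ} (hf : IntLe f E) : IntLe (fun x => -f x) E := by
  refine ⟨hf.1.neg, ?_⟩
  rw [integral_neg, abs_neg]
  exact hf.2

theorem IntLe.const_mul {f : Plane → ℝ} (hf : IntLe f 0) (c : ℝ) : IntLe (fun x => c * f x) 0 := by
  refine ⟨hf.1.const_mul c, ?_⟩
  rw [integral_const_mul, abs_nonpos_iff.1 hf.2, mul_zero, abs_zero]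

theorem IntLe.mono {f : Plane → ℝ} {E E' : ℝ} (hf : IntLe f E) (h : E ≤ E') : IntLe f E' :=
  ⟨hf.1, hf.2.trans h⟩

/-- The quadratic form of the first-order terms is controlled by its symmetric constituents. -/
theorem intLe_sum_firstOrder (lam : ℝ) {b : Plane → Background} {u v : Plane → Fin 9 → ℝ}
    {p : Plane → Fin 2 → Fin 9 → ℝ} {E : ℝ}
    (h3 : ∀ j k, IntLe (fun x => u x 3 * (p x j k * v x 0 + p x j 0 * v x k)) E)
    (h4 : ∀ j k, IntLe (fun x => u x 4 * (p x j k * v x 0 + p x j 0 * v x k)) E)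
    (hF : ∀ j k, IntLe (fun x => (b x).F * (p x j k * v x 0 + p x j 0 * v x k)) E)
    (hG : ∀ j k, IntLe (fun x => (b x).G * (p x j k * v x 0 + p x j 0 * v x k)) E)
    (h0 : ∀ j k, IntLe (fun x => p x j k * v x 0 + p x j 0 * v x k) 0) :
    IntLe (fun x => ∑ i, firstOrder lam (b x) (u x) (p x) i * v x i) (8 * E) := by
  simp only [sum_firstOrder_mul]
  refine IntLe.mono ((((((h4 0 5).neg.add (h4 1 6).neg).add
    ((hG 0 5).neg.add (hG 1 6).neg)).add ((h3 0 7).add (h3 1 8))).add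
    ((hF 0 7).add (hF 1 8))).add (((h0 0 1).const_mul lam).add ((h0 1 2).const_mul lam))) ?_
  linarith

theorem IsCoef.integrable_mul {s : ℝ} {a : Plane → ℝ} {C : ℝ} (hC : 0 ≤ C) (ha : IsCoef s a C)
    (f g f' g' : L2) : Integrable fun x => a x * (f x * g x + f' x * g' x) :=
  ((integrable_mul_L2 f g).add (integrable_mul_L2 f' g')).bdd_mul ha.aestronglyMeasurable
    (by simpa using ha.abs_le hC)

/-- The background quantities `F_r` and `G_r` are admissible coefficients, uniformly in time. -/
theorem exists_isCoef_soliton {s : ℝ} (hs : 2 < s) : ∃ C : ℝ, 0 ≤ C ∧ ∀ t,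
    IsCoef s (fun x => (soliton t x).F) C ∧ IsCoef s (fun x => (soliton t x).G) C := by
  obtain ⟨C, hC, h⟩ := exists_isCoef_profile hs
  refine ⟨C, hC, fun t => ?_⟩
  simp only [soliton_eq, lineBackground]
  exact ⟨(h _ (abs_sqrt_two_mul_cos_le t)).1, (h _ (abs_sqrt_two_mul_sin_le t)).1⟩

section Sob

variable {s : ℝ} (hs : 2 < s)

/-- The basic energy estimate for the truncated system: the lower-order terms, paired in `H^s` with
the solution, are bounded by its `H^s` norm, with a constant that depends neither on `lam` nor on
the truncation. -/
theorem exists_energy_bound (R : ℝ) : ∃ N : ℝ, 0 ≤ N ∧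
    ∀ (lam t : ℝ) (n : ℕ) (V : Fin 9 → L2), ‖V‖ ≤ R →
      |∑ i, inner ℝ (V i) ((invBessel hs n).op
        (nonlin hs lam t (fun k => (proj n).op (V k)) i))| ≤ N * ‖V‖ := by
  obtain ⟨C, hC, hb⟩ := exists_isCoef_soliton hs
  obtain ⟨D, hD, hres⟩ := exists_residual_bessel hs R
  have hS := symbolConst_nonneg hs
  have hE := embConst_nonneg s
  set M : ℝ := max C (3 * (embConst s * R)) with hM
  have hM0 : 0 ≤ M := hC.trans (le_max_left _ _)
  -- Eight commutators come from the coefficients `u 3`, `u 4`, `F_r`, `G_r`, each in two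
  -- directions; the nine zeroth-order terms contribute `D` each.
  refine ⟨8 * (symbolConst s * M * max R 0) + 9 * D, by positivity, fun lam t n V hV => ?_⟩
  have hVk : ∀ k, ‖V k‖ ≤ ‖V‖ := norm_le_pi_norm V
  have hR : 0 ≤ R := (norm_nonneg V).trans hV
  rw [max_eq_left hR]
  set PV : Fin 9 → L2 := fun k => (proj n).op (V k) with hPV
  have hPVk : ∀ k, ‖PV k‖ ≤ R := fun k => (norm_proj_op_le n _).trans ((hVk k).trans hV)
  set v : Plane → Fin 9 → ℝ := fun x k => (invBessel hs n).op (V k) x with hv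
  set u : Plane → Fin 9 → ℝ := fun x => val (sob hs PV) x with hu
  set p : Plane → Fin 2 → Fin 9 → ℝ := fun x j => val (gradSob hs PV j) x with hp
  have hcoef : ∀ a : Plane → ℝ, IsCoef s a M → ∀ j k,
      IntLe (fun x => a x * (p x j k * v x 0 + p x j 0 * v x k))
        (symbolConst s * M * R * ‖V‖) := by
    intro a ha j k
    refine ⟨ha.integrable_mul hM0 _ _ _ _, (ha.abs_integral_symm_le hs hM0 j n (V k)
        (V 0)).trans ?_⟩
    rw [mul_assoc (symbolConst s * M)]
    gcongr
    · exact (hVk k).trans hV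
    · exact hVk 0
  have hbes : ∀ k, IsCoef s (fun x => u x k) M := fun k =>
    (isCoef_bessel hs (PV k)).mono (le_trans (by gcongr; exact hPVk k) (le_max_right _ _))
  -- The constant coefficients `λ C^j` do not contribute, whatever `λ` is.
  have h0 : ∀ j k, IntLe (fun x => p x j k * v x 0 + p x j 0 * v x k) 0 := by
    intro j k
    refine ⟨(integrable_mul_L2 _ _).add (integrable_mul_L2 _ _), ?_⟩
    have := Multiplier.inner_op_add_inner_op (conj_dBessel_symbol hs j)
      (conj_invBessel_symbol hs n) (PV k) (PV 0)
    rw [hPV, invBessel_proj, invBessel_proj, inner_eq_integral, inner_eq_integral,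
      ← integral_add (integrable_mul_L2 _ _) (integrable_mul_L2 _ _)] at this
    exact (abs_eq_zero.2 this).le
  have hfirst := intLe_sum_firstOrder lam (b := soliton t) (hcoef _ (hbes 3)) (hcoef _ (hbes 4))
    (hcoef _ ((hb t).1.mono (le_max_left _ _))) (hcoef _ ((hb t).2.mono (le_max_left _ _))) h0
  choose Z hZ hZ' using hres t PV hPVk
  -- The zeroth-order terms are in `H^s`, so that `⟨D⟩^s` may be moved to them.
  have hsecond : ∀ i, IntLe (fun x => residual (soliton t x) (u x) i * v x i) (D * ‖V‖) := by
    intro i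
    have hae : (fun x => residual (soliton t x) (u x) i * v x i) =ᵐ[volume]
        fun x => (bessel hs).op (Z i) x * (invBessel hs n).op (V i) x := by
      filter_upwards [hZ' i] with x hx
      rw [hx]; rfl
    refine ⟨(integrable_mul_L2 _ _).congr hae.symm, ?_⟩
    rw [integral_congr_ae hae, ← inner_eq_integral,
      ← (invBessel hs n).inner_op_of_real (conj_invBessel_symbol hs n), invBessel_bessel]
    refine (abs_real_inner_le_norm _ _).trans ?_
    gcongr
    · exact (norm_proj_op_le n _).trans (hZ i)
    · exact hVk i
  have hsum : ∑ i, inner ℝ (V i) ((invBessel hs n).op (nonlin hs lam t PV i)) =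
      (∫ x, ∑ i, firstOrder lam (soliton t x) (u x) (p x) i * v x i) +
        ∑ i, ∫ x, residual (soliton t x) (u x) i * v x i := by
    rw [← integral_finsetSum _ fun i _ => (hsecond i).1,
      ← integral_add hfirst.1 (integrable_finsetSum _ fun i _ => (hsecond i).1)]
    simp only [← (invBessel hs n).inner_op_of_real (conj_invBessel_symbol hs n), inner_eq_integral]
    rw [← integral_finsetSum _ fun i _ => integrable_mul_L2 _ _]
    refine integral_congr_ae ?_
    filter_upwards [coeFn_nonlin hs lam t PV] with x hx
    rw [← Finset.sum_add_distrib]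
    refine Finset.sum_congr rfl fun i _ => ?_
    rw [hx i, lowerAt, lowerTerms, Pi.add_apply]
    ring
  rw [hsum]
  refine (abs_add_le _ _).trans ((add_le_add hfirst.2 (Finset.abs_sum_le_sum_abs _ _)).trans ?_)
  have : ∑ i : Fin 9, |∫ x, residual (soliton t x) (u x) i * v x i| ≤ ∑ _i : Fin 9, D * ‖V‖ :=
    Finset.sum_le_sum fun i _ => (hsecond i).2
  simp only [Finset.sum_const, Finset.card_univ, Fintype.card_fin, nsmul_eq_mul] at this
  push_cast at this
  linarith

/-- The estimate for the difference of two solutions, in `L²`. -/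
theorem exists_difference_bound (lam R : ℝ) : ∃ N : ℝ, 0 ≤ N ∧
    ∀ (t : ℝ) (V V' : Fin 9 → L2), ‖V‖ ≤ R → ‖V'‖ ≤ R →
      |∑ i, inner ℝ (sob hs (V - V') i) (nonlin hs lam t V i - nonlin hs lam t V' i)| ≤
        N * ∑ i, ‖sob hs (V - V') i‖ ^ 2 := by
  obtain ⟨C, hC, hb⟩ := exists_isCoef_soliton hs
  obtain ⟨N, hN, hlip⟩ := exists_lipschitz_lowerTerms lam (embConst s * R)
  have hE := embConst_nonneg s
  set M : ℝ := max C (3 * (embConst s * R)) with hM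
  have hM0 : 0 ≤ M := hC.trans (le_max_left _ _)
  refine ⟨8 * M + 9 * N, by positivity, fun t V V' hV hV' => ?_⟩
  set w : Fin 9 → L2 := sob hs (V - V') with hw
  set S : ℝ := ∑ i, ‖w i‖ ^ 2 with hS
  set v : Plane → Fin 9 → ℝ := val w with hv
  set u : Plane → Fin 9 → ℝ := val (sob hs V) with hu
  set p : Plane → Fin 2 → Fin 9 → ℝ := fun x j => val (gradSob hs (V - V') j) x with hp
  have hle : ∀ k, ‖w k‖ ^ 2 ≤ S := fun k =>
    Finset.single_le_sum (f := fun k => ‖w k‖ ^ 2) (fun _ _ => sq_nonneg _) (Finset.mem_univ k)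
  have hcoef : ∀ a : Plane → ℝ, IsCoef s a M → ∀ j k,
      IntLe (fun x => a x * (p x j k * v x 0 + p x j 0 * v x k)) (M * S) := by
    intro a ha j k
    refine ⟨ha.integrable_mul hM0 _ _ _ _,
      (ha.abs_integral_symm_L2_le hs hM0 j ((V - V') k) ((V - V') 0)).trans ?_⟩
    gcongr
    change ‖w k‖ * ‖w 0‖ ≤ S
    nlinarith [sq_nonneg (‖w k‖ - ‖w 0‖), hle k, hle 0]
  have hbes : ∀ k, IsCoef s (fun x => u x k) M := fun k =>
    (isCoef_bessel hs (V k)).mono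
      (le_trans (by gcongr; exact (norm_le_pi_norm V k).trans hV) (le_max_right _ _))
  have h0 : ∀ j k, IntLe (fun x => p x j k * v x 0 + p x j 0 * v x k) 0 := by
    intro j k
    refine ⟨(integrable_mul_L2 _ _).add (integrable_mul_L2 _ _), ?_⟩
    have := Multiplier.inner_op_add_inner_op (conj_dBessel_symbol hs j)
      (conj_bessel_symbol hs) ((V - V') k) ((V - V') 0)
    rw [inner_eq_integral, inner_eq_integral,
      ← integral_add (integrable_mul_L2 _ _) (integrable_mul_L2 _ _)] at this
    exact (abs_eq_zero.2 this).le
  have hfirst := intLe_sum_firstOrder lam (b := soliton t) (hcoef _ (hbes 3)) (hcoef _ (hbes 4))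
    (hcoef _ ((hb t).1.mono (le_max_left _ _))) (hcoef _ ((hb t).2.mono (le_max_left _ _))) h0
  obtain ⟨G, hG, hG'⟩ := exists_sum_abs Finset.univ w
  have hG2 : ‖G‖ ^ 2 ≤ 9 * S := by
    refine (pow_le_pow_left₀ (norm_nonneg _) hG 2).trans ?_
    simpa using sq_sum_le_card_mul_sum_sq (s := Finset.univ) (f := fun i : Fin 9 => ‖w i‖)
  have hall : Integrable fun x => ∑ i, w i x * (nonlin hs lam t V i - nonlin hs lam t V' i :
      L2) x :=
    integrable_finsetSum _ fun i _ => integrable_mul_L2 _ _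
  -- Apart from the first-order operator at `V`, applied to the difference, no derivatives of the
  -- difference occur; the remaining terms contain the first derivatives of `V'` only, which are
  -- bounded.
  have hrest : |∫ x, (∑ i, w i x * (nonlin hs lam t V i - nonlin hs lam t V' i : L2) x) -
      ∑ i, firstOrder lam (soliton t x) (u x) (p x) i * v x i| ≤ N * (9 * S) := by
    have hGint : ∫ x, N * (G x * G x) ≤ N * (9 * S) := by
      rw [integral_const_mul, ← inner_eq_integral, real_inner_self_eq_norm_sq]
      gcongr
    refine le_trans ?_ hGint
    rw [← Real.norm_eq_abs]
    refine norm_integral_le_of_norm_le ((integrable_mul_L2 G G).const_mul N) ?_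
    have hsub : ∀ᵐ x, ∀ i, (nonlin hs lam t V i - nonlin hs lam t V' i : L2) x =
        nonlin hs lam t V i x - nonlin hs lam t V' i x := ae_all_iff.2 fun i => Lp.coeFn_sub _ _
    filter_upwards [hsub, coeFn_nonlin hs lam t V, coeFn_nonlin hs lam t V', ae_sob_sub hs V V',
      ae_gradSob_sub hs V V', ae_abs_sob_le hs hV, ae_abs_sob_le hs hV',
      ae_abs_gradSob_le hs hV', hG'] with x e1 e2 e3 e4 e5 b1 b2 b3 eG
    have hkey : ∀ i, |lowerAt hs lam t V x i - lowerAt hs lam t V' x i -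
        firstOrder lam (soliton t x) (u x) (p x) i| ≤ N * G x := by
      intro i
      have e6 : p x = (fun j => val (gradSob hs V j) x) - fun j => val (gradSob hs V' j) x :=
        funext fun j => e5 j
      rw [e6, ← lowerTerms_sub]
      have := hlip t x (u x) (val (sob hs V') x) (fun j => val (gradSob hs V' j) x)
        (fun j => val (gradSob hs V' j) x) b1 b2 b3 b3 i
      simp only [sub_self, abs_zero, Finset.sum_const_zero, add_zero] at this
      rw [eG]
      refine le_trans (le_of_eq ?_) (this.trans (le_of_eq ?_))
      · rw [lowerAt, lowerAt, Pi.sub_apply]; congr 1; ring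
      · congr 1
        refine Finset.sum_congr rfl fun k _ => ?_
        have := congrFun e4 k
        rw [Pi.sub_apply] at this
        rw [← this]; rfl
    rw [Real.norm_eq_abs, ← Finset.sum_sub_distrib]
    refine (Finset.abs_sum_le_sum_abs _ _).trans ?_
    calc _ ≤ ∑ i, |w i x| * (N * G x) := Finset.sum_le_sum fun i _ => by
          rw [e1, e2, e3, show firstOrder lam (soliton t x) (u x) (p x) i * v x i =
            w i x * firstOrder lam (soliton t x) (u x) (p x) i from mul_comm _ _, ← mul_sub,
            abs_mul]
          exact mul_le_mul_of_nonneg_left (hkey i) (abs_nonneg _)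
      _ = N * (G x * G x) := by rw [← Finset.sum_mul, ← eG]; ring
  have hsum : ∑ i, inner ℝ (w i) (nonlin hs lam t V i - nonlin hs lam t V' i) =
      (∫ x, (∑ i, w i x * (nonlin hs lam t V i - nonlin hs lam t V' i : L2) x) -
        ∑ i, firstOrder lam (soliton t x) (u x) (p x) i * v x i) +
        ∫ x, ∑ i, firstOrder lam (soliton t x) (u x) (p x) i * v x i := by
    rw [integral_sub hall hfirst.1, sub_add_cancel, integral_finsetSum _ fun i _ =>
      integrable_mul_L2 _ _]
    exact Finset.sum_congr rfl fun i _ => inner_eq_integral _ _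
  rw [hsum]
  refine (abs_add_le _ _).trans ((add_le_add hrest hfirst.2).trans ?_)
  linarith

end Sob

/-! ### The truncated system -/

/-- The radial retraction onto the ball of radius `R`. -/
def retract {X : Type*} [NormedAddCommGroup X] [NormedSpace ℝ X] (R : ℝ) (x : X) : X :=
  (R / max R ‖x‖) • x

theorem div_max_pos {R : ℝ} (hR : 0 < R) (a : ℝ) : 0 < R / max R a :=
  div_pos hR (hR.trans_le (le_max_left _ _))

section Retract

variable {X : Type*} [NormedAddCommGroup X] [NormedSpace ℝ X] {R : ℝ}

theorem norm_retract_le (hR : 0 < R) (x : X) : ‖retract R x‖ ≤ R := by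
  have hm : 0 < max R ‖x‖ := hR.trans_le (le_max_left _ _)
  rw [retract, norm_smul, Real.norm_eq_abs, abs_of_pos (div_max_pos hR _), div_mul_eq_mul_div,
    div_le_iff₀ hm]
  exact mul_le_mul_of_nonneg_left (le_max_right _ _) hR.le

theorem retract_eq_self (hR : 0 < R) {x : X} (hx : ‖x‖ ≤ R) : retract R x = x := by
  rw [retract, max_eq_left hx, div_self hR.ne', one_smul]

/-- The retraction is Lipschitz. The constant is not optimal for `L²`,
    but it holds in every norm. -/
theorem norm_retract_sub_le (hR : 0 < R) (x y : X) :
    ‖retract R x - retract R y‖ ≤ 2 * ‖x - y‖ := by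
  set a := max R ‖x‖ with ha
  set b := max R ‖y‖ with hb
  have ha0 : 0 < a := hR.trans_le (le_max_left _ _)
  have hb0 : 0 < b := hR.trans_le (le_max_left _ _)
  have hRa : R / a ≤ 1 := (div_le_one ha0).2 (le_max_left _ _)
  have hyb : ‖y‖ / b ≤ 1 := (div_le_one hb0).2 (le_max_right _ _)
  have hab : |b - a| ≤ ‖x - y‖ := by
    refine (abs_max_sub_max_le_max R ‖y‖ R ‖x‖).trans ?_
    rw [sub_self, abs_zero, max_eq_right (abs_nonneg _), norm_sub_rev]
    exact abs_norm_sub_norm_le y x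
  have e : retract R x - retract R y = (R / a) • (x - y) + (R / a - R / b) • y := by
    rw [retract, retract, smul_sub, sub_smul]; abel
  have h2 : ‖(R / a - R / b) • y‖ ≤ ‖x - y‖ := by
    rw [norm_smul, Real.norm_eq_abs,
      show R / a - R / b = R / a * ((b - a) / b) by field_simp, abs_mul,
      abs_div (b - a), abs_of_pos hb0, abs_of_pos (div_pos hR ha0)]
    calc R / a * (|b - a| / b) * ‖y‖ = R / a * |b - a| * (‖y‖ / b) := by ring
      _ ≤ 1 * ‖x - y‖ * 1 := by gcongr
      _ = ‖x - y‖ := by ring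
  have h1 : ‖(R / a) • (x - y)‖ ≤ ‖x - y‖ := by
    rw [norm_smul, Real.norm_eq_abs, abs_of_pos (div_pos hR ha0)]
    exact mul_le_of_le_one_left (norm_nonneg _) hRa
  rw [e]
  linarith [norm_add_le ((R / a) • (x - y)) ((R / a - R / b) • y)]

/-- Global solvability for a vector field that is Lipschitz on a ball, after retraction. -/
theorem exists_solution_retract [CompleteSpace X] (hR : 0 < R) {F : ℝ → X → X} {L : ℝ} (hL : 0 ≤ L)
    (hF : ∀ t x y, ‖x‖ ≤ R → ‖y‖ ≤ R → ‖F t x - F t y‖ ≤ L * ‖x - y‖) (hF0 : ∀ t, F t 0 = 0)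
    (hc : ∀ x, Continuous fun t => F t x) {T : ℝ} (hT : 0 ≤ T) (x₀ : X) :
    ∃ W : ℝ → X, W 0 = x₀ ∧
      ∀ t ∈ Set.Icc 0 T, HasDerivWithinAt W (F t (retract R (W t))) (Set.Icc 0 T) t := by
  have hpl : IsPicardLindelof (fun t x => F t (retract R x)) (tmin := 0) (tmax := T)
      ⟨0, le_rfl, hT⟩ x₀ ⟨L * R * T, by positivity⟩ 0 ⟨L * R, by positivity⟩
      ⟨L * 2, by positivity⟩ := by
    refine ⟨fun t _ => ?_, fun x _ => (hc _).continuousOn, fun t _ x _ => ?_, ?_⟩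
    · refine (LipschitzWith.of_dist_le_mul fun x y => ?_).lipschitzOnWith
      rw [dist_eq_norm, dist_eq_norm]
      refine (hF t _ _ (norm_retract_le hR x) (norm_retract_le hR y)).trans ?_
      change _ ≤ L * 2 * ‖x - y‖
      rw [mul_assoc]
      exact mul_le_mul_of_nonneg_left (norm_retract_sub_le hR x y) hL
    · have := hF t (retract R x) 0 (norm_retract_le hR x) (by rw [norm_zero]; exact hR.le)
      rw [hF0, sub_zero, sub_zero] at this
      exact this.trans (mul_le_mul_of_nonneg_left (norm_retract_le hR x) hL)
    · change L * R * max (T - 0) (0 - 0) ≤ L * R * T - 0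
      simp [hT]
  exact hpl.exists_eq_forall_mem_Icc_hasDerivWithinAt₀

end Retract

/-- The action of the matrix `K` after a scalar operator. -/
def dispersion (L : L2 →L[ℝ] L2) (W : Fin 9 → L2) : Fin 9 → L2 := fun i => ∑ k, K i k • L (W k)

theorem dispersion_sub (L : L2 →L[ℝ] L2) (W W' : Fin 9 → L2) (i : Fin 9) :
    dispersion L (W - W') i = dispersion L W i - dispersion L W' i := by
  simp only [dispersion, Pi.sub_apply, map_sub, smul_sub, Finset.sum_sub_distrib]

theorem map_dispersion (M L : L2 →L[ℝ] L2) (W : Fin 9 → L2) (i : Fin 9) :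
    M (dispersion L W i) = dispersion (M.comp L) W i := by
  simp [dispersion, map_sum]

theorem abs_K_le (i k : Fin 9) : |K i k| ≤ 1 := by
  fin_cases i <;> fin_cases k <;> simp [K]

theorem norm_dispersion_le {L : L2 →L[ℝ] L2} {c : ℝ} (hL : ∀ f, ‖L f‖ ≤ c * ‖f‖) (hc : 0 ≤ c)
    (W : Fin 9 → L2) (i : Fin 9) : ‖dispersion L W i‖ ≤ 9 * c * ‖W‖ := by
  calc ‖dispersion L W i‖ ≤ ∑ k, ‖K i k • L (W k)‖ := norm_sum_le _ _
    _ ≤ ∑ _k : Fin 9, 1 * (c * ‖W‖) := by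
        gcongr with k _
        rw [norm_smul, Real.norm_eq_abs]
        gcongr
        · exact abs_K_le i k
        · exact (hL _).trans (by gcongr; exact norm_le_pi_norm W k)
    _ = 9 * c * ‖W‖ := by simp; ring

/-- The dispersive part does not contribute to energy identities: `K` is antisymmetric. -/
theorem sum_inner_dispersion {L M : L2 →L[ℝ] L2} (W : Fin 9 → L2)
    (h : ∀ f g : L2, inner ℝ (M f) (L g) = inner ℝ (M g) (L f)) :
    ∑ i, inner ℝ (M (W i)) (dispersion L W i) = 0 := by
  have hK : ∀ i k, K k i = -K i k := fun i k => by
    have := congrFun (congrFun K_antisymm i) k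
    simpa using this
  simp only [dispersion, inner_sum, inner_smul_right]
  have e : ∑ i, ∑ k, K i k * inner ℝ (M (W i)) (L (W k)) =
      -∑ i, ∑ k, K i k * inner ℝ (M (W i)) (L (W k)) := by
    conv_lhs => rw [Finset.sum_comm]
    rw [← Finset.sum_neg_distrib]
    refine Finset.sum_congr rfl fun i _ => ?_
    rw [← Finset.sum_neg_distrib]
    refine Finset.sum_congr rfl fun k _ => ?_
    rw [hK, h, neg_mul]
  linarith

section Sob

variable {s : ℝ} (hs : 2 < s)

/-- The truncated system, in the coordinates `V = ⟨D⟩^s U`. -/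
def field (lam : ℝ) (n : ℕ) (t : ℝ) (W : Fin 9 → L2) : Fin 9 → L2 := fun i =>
  dispersion (lapProj n).op W i -
    (invBessel hs n).op (nonlin hs lam t (fun k => (proj n).op (W k)) i)

theorem field_zero (lam : ℝ) (n : ℕ) (t : ℝ) : field hs lam n t 0 = 0 := by
  funext i
  have : (fun k => (proj n).op ((0 : Fin 9 → L2) k)) = 0 := by funext k; simp
  rw [field, this, nonlin_zero]
  simp [dispersion]

theorem continuous_field (lam : ℝ) (n : ℕ) (W : Fin 9 → L2) :
    Continuous fun t => field hs lam n t W :=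
  continuous_pi fun i => continuous_const.sub
    ((invBessel hs n).op.continuous.comp (continuous_nonlin hs lam _ i))

theorem norm_proj_pi_le (n : ℕ) (W : Fin 9 → L2) : ‖fun k => (proj n).op (W k)‖ ≤ ‖W‖ :=
  (pi_norm_le_iff_of_nonneg (norm_nonneg _)).2 fun k =>
    (norm_proj_op_le n _).trans (norm_le_pi_norm W k)

/-- For a fixed truncation parameter the truncated system is an ordinary differential equation
with a locally Lipschitz right-hand side. The constant depends on `lam` and `n`; only the energy
estimate does not. -/
theorem exists_lipschitz_field (lam R : ℝ) (n : ℕ) : ∃ L : ℝ, 0 ≤ L ∧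
    ∀ t W W', ‖W‖ ≤ R → ‖W'‖ ≤ R → ‖field hs lam n t W - field hs lam n t W'‖ ≤ L * ‖W - W'‖ := by
  obtain ⟨N, hN, h⟩ := exists_lipschitz_nonlin hs lam R
  refine ⟨9 * ‖(lapProj n).op‖ + ‖(invBessel hs n).op‖ * (N * 27), by positivity,
    fun t W W' hW hW' => (pi_norm_le_iff_of_nonneg (by positivity)).2 fun i => ?_⟩
  have e : (field hs lam n t W - field hs lam n t W') i = dispersion (lapProj n).op (W - W') i -
      (invBessel hs n).op (nonlin hs lam t (fun k => (proj n).op (W k)) i -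
        nonlin hs lam t (fun k => (proj n).op (W' k)) i) := by
    rw [dispersion_sub, map_sub, Pi.sub_apply, field, field]; abel
  rw [e, add_mul]
  refine (norm_sub_le _ _).trans (add_le_add ?_ ?_)
  · exact norm_dispersion_le (fun f => (lapProj n).op.le_opNorm f) (norm_nonneg _) _ i
  · refine ((invBessel hs n).op.le_opNorm _).trans ?_
    rw [mul_assoc, mul_assoc]
    gcongr
    refine (h t _ _ ((norm_proj_pi_le n W).trans hW) ((norm_proj_pi_le n W').trans hW') i).trans ?_
    gcongr
    refine (firstNorm_le hs _).trans ?_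
    gcongr
    refine le_trans (le_of_eq ?_) (norm_proj_pi_le n (W - W'))
    congr 1
    funext k
    simp

theorem sq_norm_le_sum (W : Fin 9 → L2) : ‖W‖ ^ 2 ≤ ∑ i, ‖W i‖ ^ 2 := by
  have h : ‖W‖ ≤ √(∑ i, ‖W i‖ ^ 2) := (pi_norm_le_iff_of_nonneg (Real.sqrt_nonneg _)).2 fun i =>
    Real.le_sqrt_of_sq_le (Finset.single_le_sum (f := fun i => ‖W i‖ ^ 2)
      (fun _ _ => sq_nonneg _) (Finset.mem_univ i))
  calc ‖W‖ ^ 2 ≤ √(∑ i, ‖W i‖ ^ 2) ^ 2 := pow_le_pow_left₀ (norm_nonneg _) h 2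
    _ = _ := Real.sq_sqrt (Finset.sum_nonneg fun _ _ => sq_nonneg _)

theorem HasDerivWithinAt.sum_norm_sq {W : ℝ → Fin 9 → L2} {W' : Fin 9 → L2} {S : Set ℝ} {t : ℝ}
    (h : HasDerivWithinAt W W' S t) :
    HasDerivWithinAt (fun t => ∑ i, ‖W t i‖ ^ 2) (2 * ∑ i, inner ℝ (W t i) (W' i)) S t := by
  rw [Finset.mul_sum]
  exact HasDerivWithinAt.fun_sum fun i _ => (hasDerivWithinAt_pi.1 h i).norm_sq

/-- A scalar form of Grönwall's inequality. -/
theorem le_gronwall {f f' : ℝ → ℝ} {T N ε : ℝ} (hN : 0 < N) (hf0 : ∀ t, 0 ≤ f t)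
    (hf : ∀ t ∈ Set.Icc 0 T, HasDerivWithinAt f (f' t) (Set.Icc 0 T) t)
    (hb : ∀ t ∈ Set.Icc 0 T, |f' t| ≤ N * f t + ε) :
    ∀ t ∈ Set.Icc 0 T, f t ≤ f 0 * Real.exp (N * t) + ε / N * (Real.exp (N * t) - 1) := by
  intro t ht
  have h := norm_le_gronwallBound_of_norm_deriv_right_le (f := f) (f' := f') (δ := f 0) (K := N)
    (ε := ε) (a := 0) (b := T) (fun t ht => (hf t ht).continuousWithinAt)
    (fun t ht => (hf t ⟨ht.1, ht.2.le⟩).mono_of_mem_nhdsWithin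
      (mem_of_superset (Icc_mem_nhdsGE ht.2) (Set.Icc_subset_Icc_left ht.1)))
    (by rw [Real.norm_eq_abs, abs_of_nonneg (hf0 0)])
    (fun t ht => by
      rw [Real.norm_eq_abs, Real.norm_eq_abs, abs_of_nonneg (hf0 t)]
      exact hb t ⟨ht.1, ht.2.le⟩) t ht
  rwa [gronwallBound_of_K_ne_0 hN.ne', sub_zero, Real.norm_eq_abs, abs_of_nonneg (hf0 t)] at h

/-- The truncated systems are solvable, with a bound in `H^s`, on a time interval that depends only
on the size of the data. -/
theorem exists_truncated_solution (r : ℝ) : ∃ T R : ℝ, 0 < T ∧ 0 ≤ R ∧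
    ∀ (lam : ℝ) (n : ℕ) (V₀ : Fin 9 → L2), ∑ i, ‖V₀ i‖ ^ 2 ≤ r ^ 2 → ∃ V : ℝ → Fin 9 → L2,
      (V 0 = fun k => (proj n).op (V₀ k)) ∧
      ∀ t ∈ Set.Icc 0 T, ‖V t‖ ≤ R ∧ (∀ k, (proj n).op (V t k) = V t k) ∧
        HasDerivWithinAt V (field hs lam n t (V t)) (Set.Icc 0 T) t := by
  -- The energy `E` satisfies `|E'| ≤ (N + 1) (E + 1)`, so `E + 1` at most doubles up to the time
  -- `log 2 / (N + 1)`, and the solution does not leave the ball of radius `R` before.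
  set R : ℝ := √(2 * (1 + r ^ 2)) with hR
  have hRpos : 0 < R := Real.sqrt_pos.2 (by positivity)
  have hR2 : R ^ 2 = 2 * (1 + r ^ 2) := Real.sq_sqrt (by positivity)
  obtain ⟨N, hN, hE⟩ := exists_energy_bound hs R
  have hN1 : 0 < N + 1 := by linarith
  set T : ℝ := Real.log 2 / (N + 1) with hT
  have hTpos : 0 < T := div_pos (Real.log_pos one_lt_two) hN1
  refine ⟨T, R, hTpos, hRpos.le, fun lam n V₀ hV₀ => ?_⟩
  obtain ⟨L, hL, hlip⟩ := exists_lipschitz_field hs lam R n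
  obtain ⟨W, hW0, hW⟩ := exists_solution_retract hRpos hL hlip (field_zero hs lam n)
    (continuous_field hs lam n) hTpos.le V₀
  -- The retracted solution is a multiple of the solution, so the energy estimate for the former
  -- can be divided by the factor `c`.
  have hpair : ∀ t, |∑ i, inner ℝ (W t i) (field hs lam n t (retract R (W t)) i)| ≤ N * ‖W t‖ := by
    intro t
    set c := R / max R ‖W t‖ with hc
    have hc0 : 0 < c := div_max_pos hRpos _
    have h1 := hE lam t n (retract R (W t)) (norm_retract_le hRpos _)
    have h2 : ∑ i, inner ℝ (retract R (W t) i) (field hs lam n t (retract R (W t)) i) =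
        -∑ i, inner ℝ (retract R (W t) i) ((invBessel hs n).op
          (nonlin hs lam t (fun k => (proj n).op (retract R (W t) k)) i)) := by
      have h3 := sum_inner_dispersion (L := (lapProj n).op) (M := ContinuousLinearMap.id ℝ L2)
        (retract R (W t)) (fun f g => by
          rw [ContinuousLinearMap.id_apply, ContinuousLinearMap.id_apply,
            ← (lapProj n).inner_op_of_real (conj_lapProj_symbol n), real_inner_comm])
      simp only [ContinuousLinearMap.id_apply] at h3
      simp only [field, inner_sub_right, Finset.sum_sub_distrib, h3, zero_sub]
    have h4 : ∑ i, inner ℝ (retract R (W t) i) (field hs lam n t (retract R (W t)) i) =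
        c * ∑ i, inner ℝ (W t i) (field hs lam n t (retract R (W t)) i) := by
      rw [Finset.mul_sum]
      exact Finset.sum_congr rfl fun i _ => real_inner_smul_left _ _ _
    have h5 : ‖retract R (W t)‖ = c * ‖W t‖ := by
      rw [retract, norm_smul, Real.norm_eq_abs, abs_of_pos hc0]
    rw [← abs_neg, ← h2, h4, abs_mul, abs_of_pos hc0, h5] at h1
    refine le_of_mul_le_mul_left ?_ hc0
    linarith
  have hbound : ∀ t ∈ Set.Icc 0 T, ‖W t‖ ≤ R := by
    intro t ht
    have hg := le_gronwall (f := fun t => ∑ i, ‖W t i‖ ^ 2) hN1 (ε := N + 1)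
      (fun t => Finset.sum_nonneg fun _ _ => sq_nonneg _)
      (fun t ht => HasDerivWithinAt.sum_norm_sq (hW t ht))
      (fun t _ => by
        rw [abs_mul, abs_of_pos (two_pos : (0 : ℝ) < 2)]
        -- `2 N ‖W‖ ≤ N (1 + ‖W‖²)`
        nlinarith [hpair t, sq_norm_le_sum (W t), sq_nonneg (‖W t‖ - 1), norm_nonneg (W t)]) t ht
    have hexp : Real.exp ((N + 1) * t) ≤ 2 := by
      rw [← Real.exp_log (two_pos : (0 : ℝ) < 2)]
      refine Real.exp_le_exp.2 ((mul_le_mul_of_nonneg_left ht.2 hN1.le).trans ?_)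
      rw [hT, mul_div_cancel₀ _ hN1.ne']
    rw [hW0, div_self hN1.ne', one_mul] at hg
    have h1 : ‖W t‖ ^ 2 ≤ R ^ 2 := by
      rw [hR2]
      have h0 : 0 ≤ ∑ i, ‖V₀ i‖ ^ 2 := Finset.sum_nonneg fun _ _ => sq_nonneg _
      nlinarith [sq_norm_le_sum (W t), Real.exp_pos ((N + 1) * t)]
    exact (sq_le_sq₀ (norm_nonneg _) hRpos.le).1 h1
  refine ⟨fun t k => (proj n).op (W t k), by simp only [hW0], fun t ht => ⟨?_, fun k =>
      proj_proj n _, ?_⟩⟩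
  · exact (norm_proj_pi_le n _).trans (hbound t ht)
  · have hd := hW t ht
    rw [retract_eq_self hRpos (hbound t ht)] at hd
    refine hasDerivWithinAt_pi.2 fun i => ?_
    have := (proj n).op.hasFDerivAt.comp_hasDerivWithinAt t (hasDerivWithinAt_pi.1 hd i)
    refine this.congr_deriv ?_
    have e1 : dispersion ((proj n).op.comp (lapProj n).op) (W t) i =
        dispersion (lapProj n).op (fun k => (proj n).op (W t k)) i := by
      simp [dispersion, proj_lapProj, lapProj_proj]
    simp only [field, map_sub, map_dispersion, e1, proj_invBessel, proj_proj]

end Sob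

/-! ### Approximation by low frequencies and interpolation -/

theorem tendsto_proj (f : L2) : Tendsto (fun n : ℕ => (proj n).op f) atTop (𝓝 f) := by
  rw [tendsto_iff_norm_sub_tendsto_zero]
  have hae : ∀ n : ℕ, ∫⁻ ξ, ‖((cut n ξ : ℝ) : ℂ) * hat f ξ - hat f ξ‖ₑ ^ 2 =
      ENNReal.ofReal (‖(proj n).op f - f‖ ^ 2) := fun n => by
    rw [← lintegral_hat_sq]
    refine lintegral_congr_ae ?_
    filter_upwards [(proj n).hat_op f, coeFn_hat_sub ((proj n).op f) f] with ξ h1 h2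
    rw [h2, h1, proj_symbol]
  have hlim : Tendsto (fun n : ℕ => ∫⁻ ξ, ‖((cut n ξ : ℝ) : ℂ) * hat f ξ - hat f ξ‖ₑ ^ 2) atTop
      (𝓝 (∫⁻ _ξ : Plane, 0)) := by
    refine tendsto_lintegral_of_dominated_convergence' (fun ξ => ‖hat f ξ‖ₑ ^ 2) ?_ ?_ ?_ ?_
    · intro n
      refine AEMeasurable.pow_const (AEStronglyMeasurable.enorm ?_) 2
      exact ((Complex.measurable_ofReal.comp (measurable_cut n)).aestronglyMeasurable.mul
        (Lp.aestronglyMeasurable _)).sub (Lp.aestronglyMeasurable _)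
    · refine fun n => Eventually.of_forall fun ξ => ?_
      refine pow_le_pow_left' ?_ 2
      unfold cut
      split_ifs <;> simp
    · rw [lintegral_hat_sq]; exact ENNReal.ofReal_ne_top
    · refine Eventually.of_forall fun ξ => tendsto_const_nhds.congr' ?_
      filter_upwards [eventually_cut_eq_one ξ] with n hn
      simp [hn]
  simp only [hae, lintegral_zero] at hlim
  have h2 := (ENNReal.tendsto_toReal ENNReal.zero_ne_top).comp hlim
  have h3 := (Real.continuous_sqrt.tendsto _).comp h2
  simp only [ENNReal.toReal_zero, Real.sqrt_zero] at h3
  refine h3.congr fun n => ?_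
  rw [Function.comp_apply, Function.comp_apply, ENNReal.toReal_ofReal (sq_nonneg _),
    Real.sqrt_sq (norm_nonneg _)]

theorem IsTest.laplacian {η : Plane → ℝ} (h : IsTest η) : IsTest (Δ η) := by
  have e : Δ η = (fun x => fderiv ℝ (fun y => fderiv ℝ η y (e 0)) x (e 0)) +
      fun x => fderiv ℝ (fun y => fderiv ℝ η y (e 1)) x (e 1) := by
    funext x
    rw [h.laplacian_eq, Fin.sum_univ_two]; rfl
  rw [e]
  exact ⟨((h.deriv 0).deriv 0).1.add ((h.deriv 1).deriv 1).1,
    ((h.deriv 0).deriv 0).2.add ((h.deriv 1).deriv 1).2⟩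

section Sob

variable {s : ℝ} (hs : 2 < s)

/-- High frequencies of `H^s` functions are small in `L²`. -/
theorem norm_proj_bessel_sub_le (n : ℕ) (f : L2) :
    ‖(bessel hs).op f - (proj n).op ((bessel hs).op f)‖ ≤ 1 / ((n : ℝ) + 1) * ‖f‖ := by
  rw [← norm_hat, ← norm_hat f]
  apply Lp.norm_le_mul_norm_of_ae_le_mul
  filter_upwards [(bessel hs).hat_op f, (proj n).hat_op ((bessel hs).op f),
    coeFn_hat_sub ((bessel hs).op f) ((proj n).op ((bessel hs).op f))] with ξ h1 h2 h3
  rw [h3, h2, h1, proj_symbol, bessel_symbol]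
  have h0 := Real.rpow_nonneg (jb_pos ξ).le (-s)
  by_cases h : jb ξ ≤ n + 1
  · have : cut n ξ = 1 := if_pos h
    rw [this]; simp; positivity
  · have : cut n ξ = 0 := if_neg h
    rw [this, Complex.ofReal_zero, zero_mul, sub_zero, norm_mul, Complex.norm_real,
      Real.norm_eq_abs, abs_of_nonneg h0]
    gcongr
    rw [one_div, ← Real.rpow_neg_one]
    refine (Real.rpow_le_rpow_of_exponent_le (one_le_jb ξ) (by linarith : -s ≤ -1)).trans ?_
    exact Real.rpow_le_rpow_of_nonpos (by positivity) (not_le.1 h).le (by norm_num)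

theorem abs_coord_sq_mul_jb_rpow_le {s : ℝ} (hs : 2 < s) (j : Fin 2) (ξ : Plane) :
    |-((2 * Real.pi * ξ j) ^ 2 * jb ξ ^ (-s))| ≤ 1 := by
  have h0 := Real.rpow_nonneg (jb_pos ξ).le (-s)
  rw [abs_neg, abs_of_nonneg (by positivity)]
  have h1 : (2 * Real.pi * ξ j) ^ 2 ≤ jb ξ ^ 2 := by
    rw [← sq_abs]
    exact pow_le_pow_left₀ (abs_nonneg _) (two_pi_coord_le_jb ξ j) 2
  calc (2 * Real.pi * ξ j) ^ 2 * jb ξ ^ (-s) ≤ jb ξ ^ 2 * jb ξ ^ (-s) := by gcongr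
    _ = jb ξ ^ (2 - s) := by
        rw [← Real.rpow_natCast, ← Real.rpow_add (jb_pos ξ)]; norm_num [sub_eq_add_neg]
    _ ≤ 1 := Real.rpow_le_one_of_one_le_of_nonpos (one_le_jb ξ) (by linarith)

/-- The second derivative `∂_j² (1 - Δ)^{-s/2}`. -/
def ddBessel (j : Fin 2) : Multiplier :=
  evenMultiplier (fun ξ => -((2 * Real.pi * ξ j) ^ 2 * jb ξ ^ (-s)))
    (by have := measurable_jb_rpow (-s); fun_prop) (fun ξ => by rw [jb_neg]; simp)
    ⟨1, abs_coord_sq_mul_jb_rpow_le hs j⟩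

/-- Interpolation of the first derivatives between `L²` and `H^s`. -/
theorem sq_norm_dBessel_le (j : Fin 2) (f : L2) :
    ‖(dBessel hs j).op f‖ ^ 2 ≤ ‖f‖ * ‖(bessel hs).op f‖ := by
  rw [← real_inner_self_eq_norm_sq, (dBessel hs j).inner_op_of_imaginary (conj_dBessel_symbol hs j),
    Multiplier.op_op_eq (m₃ := ddBessel hs j) (m₄ := bessel hs)]
  · refine (le_abs_self _).trans ?_
    rw [abs_neg]
    refine (abs_real_inner_le_norm _ _).trans ?_
    gcongr
    simpa using (ddBessel hs j).norm_op_le (C := 1) (fun ξ => by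
      rw [ddBessel, evenMultiplier, Complex.norm_real]
      exact abs_coord_sq_mul_jb_rpow_le hs j ξ) ((bessel hs).op f)
  · intro ξ
    rw [dBessel_symbol, bessel_symbol, ddBessel, evenMultiplier]
    push_cast
    linear_combination (2 * Real.pi * (ξ j : ℂ) * ((jb ξ ^ (-s) : ℝ) : ℂ)) ^ 2 * Complex.I_mul_I

/-- Smallness in `L²` and boundedness in `H^s` imply smallness in `H¹`. -/
theorem firstNorm_le_sqrt (V : Fin 9 → L2) :
    firstNorm hs V ≤ 9 * ‖sob hs V‖ + 18 * √(‖V‖ * ‖sob hs V‖) := by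
  have h1 : ∀ j k, ‖gradSob hs V j k‖ ≤ √(‖V‖ * ‖sob hs V‖) := fun j k => by
    refine Real.le_sqrt_of_sq_le ((sq_norm_dBessel_le hs j (V k)).trans ?_)
    gcongr
    · exact norm_le_pi_norm V k
    · exact norm_le_pi_norm (sob hs V) k
  calc firstNorm hs V ≤ ∑ _k : Fin 9, ‖sob hs V‖ +
        ∑ _j : Fin 2, ∑ _k : Fin 9, √(‖V‖ * ‖sob hs V‖) := by
        unfold firstNorm
        gcongr with k _ j _ k _
        · exact norm_le_pi_norm (sob hs V) k
        · exact h1 j k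
    _ = _ := by simp; ring

theorem norm_lapBessel_op_le (f : L2) : ‖(lapBessel hs).op f‖ ≤ ‖f‖ := by
  simpa using (lapBessel hs).norm_op_le (C := 1) (fun ξ => by
    have h0 := Real.rpow_nonneg (jb_pos ξ).le (-s)
    rw [lapBessel_symbol, Complex.norm_real, Real.norm_eq_abs, abs_neg, abs_of_nonneg
        (by positivity)]
    calc (2 * Real.pi * ‖ξ‖) ^ 2 * jb ξ ^ (-s) ≤ jb ξ ^ 2 * jb ξ ^ (-s) := by
          refine mul_le_mul_of_nonneg_right ?_ h0; rw [jb_sq]; linarith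
      _ = jb ξ ^ (2 - s) := by
          rw [← Real.rpow_natCast, ← Real.rpow_add (jb_pos ξ)]; norm_num [sub_eq_add_neg]
      _ ≤ 1 := Real.rpow_le_one_of_one_le_of_nonpos (one_le_jb ξ) (by linarith)) f

/-! ### The right-hand side of the equation -/

/-- The time derivative prescribed by the equation, as an element of `L²`. -/
def evolution (lam t : ℝ) (V : Fin 9 → L2) : Fin 9 → L2 := fun i =>
  dispersion (lapBessel hs).op V i - nonlin hs lam t V i

/-- The right-hand side of the weak formulation, as the inner product with an element of `L²`. -/
theorem weakRHS_sob (lam t : ℝ) (V : Fin 9 → L2) {η : Plane → ℝ} (hη : IsTest η) (i : Fin 9) :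
    weakRHS lam (sob hs V) t η i = inner ℝ (evolution hs lam t V i) hη.toL2 := by
  rw [weakRHS, evolution, inner_sub_left, ← hη.integral_mul, ← hη.integral_mul]
  congr 1
  · have h1 : ∀ k, Integrable fun x => K i k * ((bessel hs).op (V k) x * Δ η x) := fun k =>
      ((Lp.memLp _).integrable_mul hη.laplacian.memLp).const_mul _
    have h2 : ∫ x, (K *ᵥ val (sob hs V) x) i * Δ η x =
        ∑ k, K i k * ∫ x, (bessel hs).op (V k) x * Δ η x := by
      simp_rw [← integral_const_mul]
      rw [← integral_finsetSum _ fun k _ => h1 k]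
      refine integral_congr_ae (Eventually.of_forall fun x => ?_)
      simp only [Matrix.mulVec, dotProduct, Finset.sum_mul, val, sob, mul_assoc]
    rw [h2, hη.integral_mul, dispersion, sum_inner]
    refine Finset.sum_congr rfl fun k _ => ?_
    rw [real_inner_smul_left, integral_bessel_mul_laplacian hs (V k) hη, hη.integral_mul]
  · refine integral_congr_ae ?_
    filter_upwards [coeFn_nonlin hs lam t V] with x hx
    rw [lowerOrder_sob, hx]

theorem exists_bound_evolution (lam R : ℝ) : ∃ N : ℝ, 0 ≤ N ∧
    ∀ (t : ℝ) (V : Fin 9 → L2), ‖V‖ ≤ R → ∀ i, ‖evolution hs lam t V i‖ ≤ N := by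
  obtain ⟨N, hN, h⟩ := exists_bound_nonlin hs lam R
  refine ⟨9 * max R 0 + N * (27 * max R 0), by positivity, fun t V hV i => ?_⟩
  have hV' : ‖V‖ ≤ max R 0 := hV.trans (le_max_left _ _)
  refine (norm_sub_le _ _).trans (add_le_add ?_ ?_)
  · refine (norm_dispersion_le (c := 1) (fun f => by
      rw [one_mul]; exact norm_lapBessel_op_le hs f) zero_le_one V i).trans ?_
    rw [mul_one]
    gcongr
  · refine (h t V hV i).trans ?_
    gcongr
    exact (firstNorm_le hs V).trans (by gcongr)

/-- The difference of the right-hand sides at two functions, paired with the difference of the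
functions. -/
theorem exists_evolution_bound (lam R : ℝ) : ∃ N : ℝ, 0 ≤ N ∧
    ∀ (t : ℝ) (V V' : Fin 9 → L2), ‖V‖ ≤ R → ‖V'‖ ≤ R →
      |∑ i, inner ℝ (sob hs (V - V') i) (evolution hs lam t V i - evolution hs lam t V' i)| ≤
        N * ∑ i, ‖sob hs (V - V') i‖ ^ 2 := by
  obtain ⟨N, hN, h⟩ := exists_difference_bound hs lam R
  refine ⟨N, hN, fun t V V' hV hV' => ?_⟩
  have h1 := sum_inner_dispersion (L := (lapBessel hs).op) (M := (bessel hs).op) (V - V')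
    (fun f g => by
      rw [(bessel hs).inner_op_of_real (conj_bessel_symbol hs),
        Multiplier.op_op_eq (m₃ := lapBessel hs) (m₄ := bessel hs) (fun _ => mul_comm _ _) g,
        ← (lapBessel hs).inner_op_of_real (conj_lapBessel_symbol hs), real_inner_comm])
  have h2 : ∑ i, inner ℝ (sob hs (V - V') i) (evolution hs lam t V i - evolution hs lam t V' i) =
      -∑ i, inner ℝ (sob hs (V - V') i) (nonlin hs lam t V i - nonlin hs lam t V' i) := by
    have h3 : ∀ i, evolution hs lam t V i - evolution hs lam t V' i =
        dispersion (lapBessel hs).op (V - V') i - (nonlin hs lam t V i - nonlin hs lam t V' i) :=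
      fun i => by rw [dispersion_sub, evolution, evolution]; abel
    simp only [h3, inner_sub_right _ (dispersion (lapBessel hs).op (V - V') _),
      Finset.sum_sub_distrib (f := fun i => inner ℝ (sob hs (V - V') i)
        (dispersion (lapBessel hs).op (V - V') i))]
    rw [show ∑ i, inner ℝ (sob hs (V - V') i) (dispersion (lapBessel hs).op (V - V') i) = 0 from h1,
      zero_sub]
  rw [h2, abs_neg]
  exact h t V V' hV hV'

end Sob

/-! ### Convergence of the truncated solutions -/

section Sob

variable {s : ℝ} (hs : 2 < s)

/-- The time derivative of the truncated solutions, in `L²`. -/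
def truncEvolution (lam : ℝ) (n : ℕ) (t : ℝ) (V : Fin 9 → L2) : Fin 9 → L2 := fun i =>
  dispersion (lapBessel hs).op V i - (proj n).op (nonlin hs lam t V i)

/-- A truncated solution `V` has frequencies at most `n + 1`; for these `⟨D⟩^{-s}` undoes `⟨D⟩^s`,
    and
`⟨D⟩^{-s} V` solves the system in which only the lower-order terms are truncated. -/
theorem hasDerivWithinAt_sob {lam : ℝ} {n : ℕ} {V : ℝ → Fin 9 → L2} {S : Set ℝ} {t : ℝ}
    (hP : ∀ k, (proj n).op (V t k) = V t k)
    (h : HasDerivWithinAt V (field hs lam n t (V t)) S t) :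
    HasDerivWithinAt (fun t => sob hs (V t)) (truncEvolution hs lam n t (V t)) S t := by
  refine hasDerivWithinAt_pi.2 fun i => ?_
  have := (bessel hs).op.hasFDerivAt.comp_hasDerivWithinAt t (hasDerivWithinAt_pi.1 h i)
  refine this.congr_deriv ?_
  have hP' : (fun k => (proj n).op (V t k)) = V t := funext hP
  have e1 : dispersion ((bessel hs).op.comp (lapProj n).op) (V t) i =
      dispersion (lapBessel hs).op (V t) i := by
    simp [dispersion, bessel_lapProj, hP]
  simp only [field, map_sub, map_dispersion, e1, bessel_invBessel, hP', truncEvolution]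

theorem abs_inner_proj_sub_le (n : ℕ) (f g : L2) :
    |inner ℝ ((bessel hs).op f) (g - (proj n).op g)| ≤ 1 / ((n : ℝ) + 1) * (‖f‖ * ‖g‖) := by
  rw [inner_sub_right, ← (proj n).inner_op_of_real (conj_proj_symbol n), ← inner_sub_left]
  refine (abs_real_inner_le_norm _ _).trans ?_
  rw [← mul_assoc]
  gcongr
  exact norm_proj_bessel_sub_le hs n f

/-- The difference estimate for two truncations. The error of the truncation is small in `L²`, as it
is paired with functions that are bounded in `H^s`. -/
theorem exists_truncEvolution_bound (lam R : ℝ) : ∃ N M : ℝ, 0 ≤ N ∧ 0 ≤ M ∧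
    ∀ (t : ℝ) (n m : ℕ) (V V' : Fin 9 → L2), ‖V‖ ≤ R → ‖V'‖ ≤ R →
      |∑ i, inner ℝ (sob hs (V - V') i)
        (truncEvolution hs lam n t V i - truncEvolution hs lam m t V' i)| ≤
        N * ∑ i, ‖sob hs (V - V') i‖ ^ 2 + M * (1 / ((n : ℝ) + 1) + 1 / ((m : ℝ) + 1)) := by
  obtain ⟨N, hN, h⟩ := exists_evolution_bound hs lam R
  obtain ⟨D, hD, hd⟩ := exists_bound_nonlin hs lam R
  refine ⟨N, 9 * (2 * max R 0 * (D * (27 * max R 0))), hN, by positivity,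
    fun t n m V V' hV hV' => ?_⟩
  have hR : max R 0 = R := max_eq_left ((norm_nonneg V).trans hV)
  rw [hR]
  have hVV : ∀ i, ‖(V - V') i‖ ≤ 2 * R := fun i =>
    (norm_le_pi_norm (V - V') i).trans ((norm_sub_le _ _).trans (by linarith))
  have hnl : ∀ V : Fin 9 → L2, ‖V‖ ≤ R → ∀ i, ‖nonlin hs lam t V i‖ ≤ D * (27 * R) := fun V hV i =>
    (hd t V hV i).trans (by gcongr; exact (firstNorm_le hs V).trans (by gcongr))
  have hRnn : 0 ≤ R := (norm_nonneg V).trans hV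
  have hterm : ∀ (n : ℕ) (W : Fin 9 → L2), ‖W‖ ≤ R → ∀ i, |inner ℝ (sob hs (V - V') i)
      (nonlin hs lam t W i - (proj n).op (nonlin hs lam t W i))| ≤
        1 / ((n : ℝ) + 1) * (2 * R * (D * (27 * R))) := fun n W hW i => by
    refine (abs_inner_proj_sub_le hs n _ _).trans ?_
    gcongr
    · exact hVV i
    · exact hnl W hW i
  have e : ∑ i, inner ℝ (sob hs (V - V') i)
        (truncEvolution hs lam n t V i - truncEvolution hs lam m t V' i) =
      ∑ i, inner ℝ (sob hs (V - V') i) (evolution hs lam t V i - evolution hs lam t V' i) +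
      ∑ i, (inner ℝ (sob hs (V - V') i)
          (nonlin hs lam t V i - (proj n).op (nonlin hs lam t V i)) -
        inner ℝ (sob hs (V - V') i)
          (nonlin hs lam t V' i - (proj m).op (nonlin hs lam t V' i))) := by
    rw [← Finset.sum_add_distrib]
    refine Finset.sum_congr rfl fun i _ => ?_
    rw [← inner_sub_right, ← inner_add_right]
    congr 1
    simp only [truncEvolution, evolution]
    abel
  rw [e]
  refine (abs_add_le _ _).trans (add_le_add (h t V V' hV hV') ?_)
  refine (Finset.abs_sum_le_sum_abs _ _).trans ?_
  calc _ ≤ ∑ _i : Fin 9, (1 / ((n : ℝ) + 1) * (2 * R * (D * (27 * R))) +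
        1 / ((m : ℝ) + 1) * (2 * R * (D * (27 * R)))) := Finset.sum_le_sum fun i _ =>
          (abs_sub _ _).trans (add_le_add (hterm n V hV i) (hterm m V' hV' i))
    _ = _ := by simp; ring

theorem continuousOn_nonlin {lam R : ℝ} {V : ℝ → Fin 9 → L2} {S : Set ℝ} (hV : ContinuousOn V S)
    (hR : ∀ t ∈ S, ‖V t‖ ≤ R) (i : Fin 9) :
    ContinuousOn (fun t => nonlin hs lam t (V t) i) S := by
  obtain ⟨N, hN, h⟩ := exists_lipschitz_nonlin hs lam R
  intro t₀ ht₀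
  have h1 : Tendsto (fun t => ‖V t - V t₀‖) (𝓝[S] t₀) (𝓝 0) :=
    tendsto_iff_norm_sub_tendsto_zero.1 (hV t₀ ht₀)
  have h2 : Tendsto (fun t => ‖nonlin hs lam t (V t₀) i - nonlin hs lam t₀ (V t₀) i‖)
      (𝓝[S] t₀) (𝓝 0) := tendsto_iff_norm_sub_tendsto_zero.1
    ((continuous_nonlin hs lam (V t₀) i).continuousWithinAt)
  refine tendsto_iff_norm_sub_tendsto_zero.2 (squeeze_zero' (Eventually.of_forall fun t =>
    norm_nonneg _) ?_ (by simpa using ((h1.const_mul (N * 27)).add h2)))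
  filter_upwards [self_mem_nhdsWithin] with t ht
  refine (norm_sub_le_norm_sub_add_norm_sub _ (nonlin hs lam t (V t₀) i) _).trans ?_
  gcongr
  refine (h t _ _ (hR t ht) (hR t₀ ht₀) i).trans ?_
  rw [mul_assoc]
  gcongr
  exact firstNorm_le hs _

theorem continuous_dispersion (L : L2 →L[ℝ] L2) (i : Fin 9) :
    Continuous fun V => dispersion L V i := by
  unfold dispersion
  fun_prop

theorem continuousOn_truncEvolution {lam R : ℝ} (n : ℕ) {V : ℝ → Fin 9 → L2} {S : Set ℝ}
    (hV : ContinuousOn V S) (hR : ∀ t ∈ S, ‖V t‖ ≤ R) (i : Fin 9) :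
    ContinuousOn (fun t => truncEvolution hs lam n t (V t) i) S :=
  ((continuous_dispersion _ i).comp_continuousOn hV).sub
    ((proj n).op.continuous.comp_continuousOn (continuousOn_nonlin hs hV hR i))

theorem inner_dispersion_lapBessel (V : Fin 9 → L2) {η : Plane → ℝ} (hη : IsTest η) (i : Fin 9) :
    inner ℝ (dispersion (lapBessel hs).op V i) hη.toL2 =
      ∑ k, K i k * inner ℝ (sob hs V k) hη.laplacian.toL2 := by
  rw [dispersion, sum_inner]
  refine Finset.sum_congr rfl fun k _ => ?_
  rw [real_inner_smul_left, ← hη.integral_mul, ← integral_bessel_mul_laplacian hs (V k) hη,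
    hη.laplacian.integral_mul]
  rfl

theorem norm_le_sqrt_of_sum_le {W : Fin 9 → L2} {c : ℝ} (h : ∑ i, ‖W i‖ ^ 2 ≤ c) : ‖W‖ ≤ √c :=
  Real.le_sqrt_of_sq_le ((sq_norm_le_sum W).trans h)

theorem sum_sq_le (W : Fin 9 → L2) : ∑ i, ‖W i‖ ^ 2 ≤ 9 * ‖W‖ ^ 2 := by
  calc ∑ i, ‖W i‖ ^ 2 ≤ ∑ _i : Fin 9, ‖W‖ ^ 2 := by
        gcongr with i _; exact norm_le_pi_norm W i
    _ = _ := by simp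

/-- The truncated solutions form a Cauchy sequence in `L²`, uniformly in time. -/
theorem exists_cauchy_bound {lam T R : ℝ} {V₀ : Fin 9 → L2}
    {V : ℕ → ℝ → Fin 9 → L2} (h0 : ∀ n, V n 0 = fun k => (proj n).op (V₀ k))
    (hR : ∀ n, ∀ t ∈ Set.Icc 0 T, ‖V n t‖ ≤ R)
    (hP : ∀ n, ∀ t ∈ Set.Icc 0 T, ∀ k, (proj n).op (V n t k) = V n t k)
    (hd : ∀ n, ∀ t ∈ Set.Icc 0 T,
      HasDerivWithinAt (V n) (field hs lam n t (V n t)) (Set.Icc 0 T) t) :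
    ∃ D : ℝ, 0 ≤ D ∧ ∀ n m, ∀ t ∈ Set.Icc 0 T,
      ‖sob hs (V n t) - sob hs (V m t)‖ ≤ √(D * (1 / ((n : ℝ) + 1) + 1 / ((m : ℝ) + 1))) := by
  obtain ⟨N, M, hN, hM, h⟩ := exists_truncEvolution_bound hs lam R
  set N' := 2 * N + 1 with hN'
  have hN'0 : 0 < N' := by linarith
  set E := Real.exp (N' * T) with hE
  refine ⟨18 * ‖V₀‖ ^ 2 * E + 2 * M / N' * E, by positivity, fun n m t ht => ?_⟩
  have ht0 : 0 ≤ t := ht.1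
  set δ : ℝ := 1 / ((n : ℝ) + 1) + 1 / ((m : ℝ) + 1) with hδ
  have hδ0 : 0 ≤ δ := by positivity
  have hδ2 : δ ≤ 2 := by
    have : ∀ n : ℕ, 1 / ((n : ℝ) + 1) ≤ 1 := fun n =>
      (div_le_one (by positivity)).2 (by linarith [n.cast_nonneg (α := ℝ)])
    linarith [this n, this m]
  have hsub : ∀ t, (fun t => sob hs (V n t - V m t)) t = sob hs (V n t) - sob hs (V m t) := fun t =>
    funext fun k => sob_sub hs _ _ k
  have hg := le_gronwall (f := fun t => ∑ i, ‖sob hs (V n t - V m t) i‖ ^ 2) (T := T) hN'0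
    (ε := 2 * M * δ) (fun t => Finset.sum_nonneg fun _ _ => sq_nonneg _)
    (fun t ht => HasDerivWithinAt.sum_norm_sq (W := fun t => sob hs (V n t - V m t))
      (W' := truncEvolution hs lam n t (V n t) - truncEvolution hs lam m t (V m t)) (by
        have := (hasDerivWithinAt_sob hs (hP n t ht) (hd n t ht)).sub
          (hasDerivWithinAt_sob hs (hP m t ht) (hd m t ht))
        rw [funext hsub]
        exact this))
    (fun t ht => by
      have h1 := h t n m _ _ (hR n t ht) (hR m t ht)
      have h2 : 0 ≤ ∑ i, ‖sob hs (V n t - V m t) i‖ ^ 2 :=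
        Finset.sum_nonneg fun _ _ => sq_nonneg _
      rw [abs_mul, abs_of_pos (two_pos : (0 : ℝ) < 2), hN']
      simp only [Pi.sub_apply]
      nlinarith) t ht
  have hinit : ∑ i, ‖sob hs (V n 0 - V m 0) i‖ ^ 2 ≤ 18 * ‖V₀‖ ^ 2 * δ := by
    have h1 : ∀ i, ‖sob hs (V n 0 - V m 0) i‖ ≤ δ * ‖V₀‖ := by
      intro i
      rw [sob_sub, h0, h0, sob, sob, ← proj_bessel, ← proj_bessel]
      refine (norm_sub_le_norm_sub_add_norm_sub _ ((bessel hs).op (V₀ i)) _).trans ?_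
      rw [hδ, add_mul, norm_sub_rev]
      have h2 : ∀ n : ℕ, ‖(bessel hs).op (V₀ i) - (proj n).op ((bessel hs).op (V₀ i))‖ ≤
          1 / ((n : ℝ) + 1) * ‖V₀‖ := fun n =>
        (norm_proj_bessel_sub_le hs n _).trans (by gcongr; exact norm_le_pi_norm V₀ i)
      exact add_le_add (h2 n) (h2 m)
    calc ∑ i, ‖sob hs (V n 0 - V m 0) i‖ ^ 2 ≤ ∑ _i : Fin 9, (δ * ‖V₀‖) ^ 2 := by
          gcongr with i _; exact h1 i
      _ = 9 * ‖V₀‖ ^ 2 * δ * δ := by simp; ring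
      _ ≤ 9 * ‖V₀‖ ^ 2 * δ * 2 := by gcongr
      _ = _ := by ring
  rw [← hsub]
  refine norm_le_sqrt_of_sum_le (hg.trans ?_)
  have hexp : Real.exp (N' * t) ≤ E := Real.exp_le_exp.2 (by gcongr; exact ht.2)
  have hexp0 := Real.exp_pos (N' * t)
  have h1 : (∑ i, ‖sob hs (V n 0 - V m 0) i‖ ^ 2) * Real.exp (N' * t) ≤ 18 * ‖V₀‖ ^ 2 * δ * E := by
    gcongr
  have h2 : 2 * M * δ / N' * (Real.exp (N' * t) - 1) ≤ 2 * M * δ / N' * E := by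
    gcongr; linarith
  refine (add_le_add h1 h2).trans_eq ?_
  ring

end Sob

/-! ### Existence -/

section Sob

variable {s : ℝ} (hs : 2 < s)

/-- The limit of a sequence that converges in `L²` and is bounded in `H^s`. -/
theorem exists_sob_limit {R : ℝ} {V : ℕ → Fin 9 → L2} {ε : ℕ → ℝ} (hε : Tendsto ε atTop (𝓝 0))
    (hR : ∀ n, ‖V n‖ ≤ R)
    (hC : ∀ n m, n ≤ m → ‖sob hs (V n) - sob hs (V m)‖ ≤ ε n) :
    ∃ W : Fin 9 → L2, ‖W‖ ≤ R ∧ ∀ n, ‖sob hs (V n) - sob hs W‖ ≤ ε n := by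
  have hcauchy : CauchySeq fun n => sob hs (V n) :=
    cauchySeq_of_le_tendsto_0' ε (fun n m h => by rw [dist_eq_norm]; exact hC n m h) hε
  obtain ⟨u, hu⟩ := cauchySeq_tendsto_of_complete hcauchy
  have hk : ∀ k, ∃ W : L2, u k = (bessel hs).op W ∧ ‖W‖ ≤ R := fun k => by
    refine exists_bessel_of_bounded hs fun n => ?_
    have h1 : Tendsto (fun m => ‖(invBessel hs n).op (sob hs (V m) k)‖) atTop
        (𝓝 ‖(invBessel hs n).op (u k)‖) :=
      (((invBessel hs n).op.continuous.tendsto _).comp ((tendsto_pi_nhds.1 hu) k)).norm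
    refine le_of_tendsto' h1 fun m => ?_
    rw [sob, invBessel_bessel]
    exact (norm_proj_op_le n _).trans ((norm_le_pi_norm (V m) k).trans (hR m))
  choose W hW hWR using hk
  have huW : u = sob hs W := funext hW
  refine ⟨W, (pi_norm_le_iff_of_nonneg ((norm_nonneg _).trans (hR 0))).2 hWR, fun n => ?_⟩
  rw [← huW]
  refine le_of_tendsto (tendsto_const_nhds.sub hu).norm ?_
  filter_upwards [eventually_ge_atTop n] with m hm
  exact hC n m hm

/-- Convergence in `L²` and boundedness in `H^s` imply the convergence of the nonlinear terms. -/
theorem tendsto_nonlin {lam t R : ℝ} {V : ℕ → Fin 9 → L2} {W : Fin 9 → L2} (hR : ∀ n, ‖V n‖ ≤ R)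
    (hW : ‖W‖ ≤ R) (h : Tendsto (fun n => sob hs (V n)) atTop (𝓝 (sob hs W))) (i : Fin 9) :
    Tendsto (fun n => nonlin hs lam t (V n) i) atTop (𝓝 (nonlin hs lam t W i)) := by
  obtain ⟨N, hN, hlip⟩ := exists_lipschitz_nonlin hs lam R
  rw [tendsto_iff_norm_sub_tendsto_zero] at h ⊢
  have h1 : Tendsto (fun n => N * (9 * ‖sob hs (V n) - sob hs W‖ +
      18 * √(2 * R * ‖sob hs (V n) - sob hs W‖))) atTop (𝓝 0) := by
    have := ((Real.continuous_sqrt.tendsto _).comp (h.const_mul (2 * R))).const_mul 18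
    simpa using ((h.const_mul 9).add this).const_mul N
  refine squeeze_zero (fun n => norm_nonneg _) (fun n => ?_) h1
  refine (hlip t _ _ (hR n) hW i).trans ?_
  have e : sob hs (V n - W) = sob hs (V n) - sob hs W := funext fun k => sob_sub hs _ _ k
  have h2 : ‖V n - W‖ ≤ 2 * R := (norm_sub_le _ _).trans (by linarith [hR n])
  gcongr
  refine (firstNorm_le_sqrt hs _).trans ?_
  rw [e]
  gcongr

/-- Convergence of the right-hand sides, tested against a fixed function. -/
theorem tendsto_inner_truncEvolution {lam t R : ℝ} {V : ℕ → Fin 9 → L2} {W : Fin 9 → L2}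
    (hR : ∀ n, ‖V n‖ ≤ R) (hW : ‖W‖ ≤ R)
    (h : Tendsto (fun n => sob hs (V n)) atTop (𝓝 (sob hs W))) {η : Plane → ℝ} (hη : IsTest η)
    (i : Fin 9) :
    Tendsto (fun n => inner ℝ (truncEvolution hs lam n t (V n) i) hη.toL2) atTop
      (𝓝 (inner ℝ (evolution hs lam t W i) hη.toL2)) := by
  simp only [truncEvolution, evolution, inner_sub_left]
  refine Tendsto.sub ?_ ?_
  · simp only [inner_dispersion_lapBessel]
    exact tendsto_finsetSum _ fun k _ =>
      (((tendsto_pi_nhds.1 h k).inner tendsto_const_nhds).const_mul _)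
  · refine Tendsto.inner ?_ tendsto_const_nhds
    have h1 := tendsto_iff_norm_sub_tendsto_zero.1
      (tendsto_nonlin hs (lam := lam) (t := t) hR hW h i)
    have h2 := tendsto_iff_norm_sub_tendsto_zero.1 (tendsto_proj (nonlin hs lam t W i))
    refine tendsto_iff_norm_sub_tendsto_zero.2 (squeeze_zero (fun n => norm_nonneg _) (fun n => ?_)
      (by simpa using h1.add h2))
    refine (norm_sub_le_norm_sub_add_norm_sub _ ((proj n).op (nonlin hs lam t W i)) _).trans ?_
    gcongr
    rw [← map_sub]
    exact norm_proj_op_le n _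

theorem exists_bound_truncEvolution (lam R : ℝ) : ∃ N : ℝ, 0 ≤ N ∧
    ∀ (n : ℕ) (t : ℝ) (V : Fin 9 → L2), ‖V‖ ≤ R → ∀ i, ‖truncEvolution hs lam n t V i‖ ≤ N := by
  obtain ⟨N, hN, h⟩ := exists_bound_nonlin hs lam R
  refine ⟨9 * max R 0 + N * (27 * max R 0), by positivity, fun n t V hV i => ?_⟩
  have hV' : ‖V‖ ≤ max R 0 := hV.trans (le_max_left _ _)
  refine (norm_sub_le _ _).trans (add_le_add ?_ ?_)
  · refine (norm_dispersion_le (c := 1) (fun f => by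
      rw [one_mul]; exact norm_lapBessel_op_le hs f) zero_le_one V i).trans ?_
    rw [mul_one]
    gcongr
  · refine (norm_proj_op_le n _).trans ((h t V hV i).trans ?_)
    gcongr
    exact (firstNorm_le hs V).trans (by gcongr)

/-- The limit of the truncated solutions solves the system. -/
theorem exists_isSolution_of_truncated {lam T R : ℝ} (hT : 0 < T) {V₀ : Fin 9 → L2}
    {V : ℕ → ℝ → Fin 9 → L2} (h0 : ∀ n, V n 0 = fun k => (proj n).op (V₀ k))
    (hR : ∀ n, ∀ t ∈ Set.Icc 0 T, ‖V n t‖ ≤ R)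
    (hP : ∀ n, ∀ t ∈ Set.Icc 0 T, ∀ k, (proj n).op (V n t k) = V n t k)
    (hd : ∀ n, ∀ t ∈ Set.Icc 0 T,
      HasDerivWithinAt (V n) (field hs lam n t (V n t)) (Set.Icc 0 T) t) :
    ∃ U, IsSolution s lam T (sob hs V₀) U := by
  obtain ⟨D, hD, hC⟩ := exists_cauchy_bound hs h0 hR hP hd
  set ε : ℕ → ℝ := fun n => √(D * (1 / ((n : ℝ) + 1) + 1 / ((n : ℝ) + 1))) with hε
  have hε0 : Tendsto ε atTop (𝓝 0) := by
    have h1 := tendsto_one_div_add_atTop_nhds_zero_nat (𝕜 := ℝ)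
    have := (Real.continuous_sqrt.tendsto _).comp ((h1.add h1).const_mul D)
    simpa [hε, Function.comp_def] using this
  -- The limit is taken in `L²` at each time; the bound in `H^s` passes to the limit.
  have hlim : ∀ t ∈ Set.Icc 0 T, ∃ W : Fin 9 → L2, ‖W‖ ≤ R ∧
      ∀ n, ‖sob hs (V n t) - sob hs W‖ ≤ ε n := fun t ht =>
    exists_sob_limit hs hε0 (fun n => hR n t ht) fun n m hnm => (hC n m t ht).trans (by
      simp only [hε]; gcongr)
  choose! W hWR hW using hlim
  have h0T : (0 : ℝ) ∈ Set.Icc 0 T := ⟨le_rfl, hT.le⟩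
  have hten : ∀ t ∈ Set.Icc 0 T, Tendsto (fun n => sob hs (V n t)) atTop (𝓝 (sob hs (W t))) :=
    fun t ht => tendsto_iff_norm_sub_tendsto_zero.2
      (squeeze_zero (fun n => norm_nonneg _) (fun n => hW t ht n) hε0)
  have hcont : ContinuousOn (fun t => sob hs (W t)) (Set.Icc 0 T) := by
    have hu : TendstoUniformlyOn (fun n t => sob hs (V n t)) (fun t => sob hs (W t)) atTop
        (Set.Icc 0 T) := by
      rw [Metric.tendstoUniformlyOn_iff]
      intro δ hδ
      filter_upwards [hε0.eventually (gt_mem_nhds hδ)] with n hn t ht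
      rw [dist_comm, dist_eq_norm]
      exact (hW t ht n).trans_lt hn
    refine hu.continuousOn (Frequently.of_forall fun n => ?_)
    exact fun t ht => (hasDerivWithinAt_sob hs (hP n t ht) (hd n t ht)).continuousWithinAt
  have hRnn : 0 ≤ R := (norm_nonneg _).trans (hR 0 0 h0T)
  have hinit : sob hs (W 0) = sob hs V₀ := by
    refine tendsto_nhds_unique (hten 0 h0T) (tendsto_pi_nhds.2 fun k => ?_)
    simp only [h0, sob, ← proj_bessel]
    exact tendsto_proj _
  refine ⟨fun t => sob hs (W t), ⟨hcont.aestronglyMeasurable measurableSet_Icc, ?_, hinit, ?_⟩⟩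
  · refine lt_of_le_of_lt (essSup_le_of_ae_le (ENNReal.ofReal √(9 * R ^ 2)) ?_)
      ENNReal.ofReal_lt_top
    filter_upwards [ae_restrict_mem measurableSet_Icc] with t ht
    refine (sobolevENorm_bessel hs (W t)).le.trans (ENNReal.ofReal_le_ofReal ?_)
    refine Real.sqrt_le_sqrt ((sum_sq_le (W t)).trans ?_)
    have := pow_le_pow_left₀ (norm_nonneg _) (hWR t ht) 2
    linarith
  intro η hη i
  obtain ⟨N, hN, hb⟩ := exists_bound_truncEvolution hs lam R
  set φ := hη.toL2 with hφ
  let F : ℕ → ℝ → ℝ := fun n τ => inner ℝ (truncEvolution hs lam n τ (V n τ) i) φ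
  let f : ℝ → ℝ := fun τ => inner ℝ (evolution hs lam τ (W τ) i) φ
  have hVc : ∀ n, ContinuousOn (V n) (Set.Icc 0 T) := fun n t ht => (hd n t ht).continuousWithinAt
  have hFc : ∀ n, ContinuousOn (F n) (Set.Icc 0 T) := fun n =>
    (continuousOn_truncEvolution hs n (hVc n) (hR n) i).inner (𝕜 := ℝ) continuousOn_const
  have hFf : ∀ τ ∈ Set.Icc 0 T, Tendsto (fun n => F n τ) atTop (𝓝 (f τ)) := fun τ hτ =>
    tendsto_inner_truncEvolution hs (fun n => hR n τ hτ) (hWR τ hτ) (hten τ hτ) hη i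
  have hFb : ∀ n, ∀ τ ∈ Set.Icc 0 T, ‖F n τ‖ ≤ N * ‖φ‖ := fun n τ hτ =>
    (norm_inner_le_norm _ _).trans (by gcongr; exact hb n τ _ (hR n τ hτ) i)
  have hfm : AEStronglyMeasurable f (volume.restrict (Set.Icc 0 T)) := by
    refine aestronglyMeasurable_of_tendsto_ae atTop
      (fun n => (hFc n).aestronglyMeasurable measurableSet_Icc) ?_
    filter_upwards [ae_restrict_mem measurableSet_Icc] with τ hτ
    exact hFf τ hτ
  have hfi : IntegrableOn f (Set.Icc 0 T) := by
    refine Integrable.of_bound hfm (N * ‖φ‖) ?_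
    filter_upwards [ae_restrict_mem measurableSet_Icc] with τ hτ
    exact le_of_tendsto' (hFf τ hτ).norm fun n => hFb n τ hτ
  have hrhs : (fun τ => weakRHS lam (sob hs (W τ)) τ η i) = f :=
    funext fun τ => weakRHS_sob hs lam τ (W τ) hη i
  refine ⟨by rw [hrhs]; exact hfi, fun t ht => ?_⟩
  rw [hrhs, hη.integral_mul, hη.integral_mul]
  have hsub : Set.uIoc 0 t ⊆ Set.Icc 0 T := by
    rw [Set.uIoc_of_le ht.1]
    exact fun τ hτ => ⟨hτ.1.le, hτ.2.trans ht.2⟩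
  have hint : Tendsto (fun n => ∫ τ in (0 : ℝ)..t, F n τ) atTop (𝓝 (∫ τ in (0 : ℝ)..t, f τ)) := by
    refine intervalIntegral.tendsto_integral_filter_of_dominated_convergence
      (fun _ => N * ‖φ‖) ?_ ?_ ?_ ?_
    · exact Eventually.of_forall fun n =>
        ((hFc n).mono hsub).aestronglyMeasurable measurableSet_uIoc
    · exact Eventually.of_forall fun n => Eventually.of_forall fun τ hτ => hFb n τ (hsub hτ)
    · exact intervalIntegrable_const
    · exact Eventually.of_forall fun τ hτ => hFf τ (hsub hτ)
  have hft : ∀ n, ∫ τ in (0 : ℝ)..t, F n τ =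
      inner ℝ (sob hs (V n t) i) φ - inner ℝ (sob hs (V n 0) i) φ := fun n => by
    have hIcc : Set.Icc 0 t ⊆ Set.Icc 0 T := Set.Icc_subset_Icc_right ht.2
    have hder : ∀ τ ∈ Set.Icc 0 T, HasDerivWithinAt (fun τ => inner ℝ (sob hs (V n τ) i) φ)
        (F n τ) (Set.Icc 0 T) τ := fun τ hτ => by
      have := (hasDerivWithinAt_pi.1 (hasDerivWithinAt_sob hs (hP n τ hτ) (hd n τ hτ)) i).inner ℝ
        (hasDerivWithinAt_const τ (Set.Icc 0 T) φ)
      simpa [F] using this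
    refine intervalIntegral.integral_eq_sub_of_hasDeriv_right_of_le ht.1
      (f := fun τ => inner ℝ (sob hs (V n τ) i) φ)
      (fun τ hτ => ((hder τ (hIcc hτ)).continuousWithinAt).mono hIcc) (fun τ hτ => ?_) ?_
    · have hτT : τ < T := hτ.2.trans_le ht.2
      refine (hder τ ⟨hτ.1.le, hτT.le⟩).mono_of_mem_nhdsWithin
        (mem_of_superset (Ioc_mem_nhdsGT hτT) fun x hx => ⟨hτ.1.le.trans hx.1.le, hx.2⟩)
    · exact ((hFc n).mono hIcc).intervalIntegrable_of_Icc ht.1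
  simp only [hft] at hint
  have h1 := ((tendsto_pi_nhds.1 (hten t ht) i).inner (𝕜 := ℝ) (tendsto_const_nhds (x := φ))).sub
    ((tendsto_pi_nhds.1 (hten 0 h0T) i).inner (𝕜 := ℝ) (tendsto_const_nhds (x := φ)))
  have h2 := tendsto_nhds_unique hint h1
  rw [h2, hinit]

end Sob

/-- Local existence, on a time interval that depends only on the size of the data. -/
theorem exists_local_solution {s : ℝ} (hs : 2 < s) (r : ℝ) : ∃ T : ℝ, 0 < T ∧ ∀ (lam : ℝ) (U₀ :
    Fin 9 → L2),
    sobolevENorm s U₀ < ⊤ → (sobolevENorm s U₀).toReal = r → ∃ U, IsSolution s lam T U₀ U := by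
  obtain ⟨T, R, hT, -, h⟩ := exists_truncated_solution hs r
  refine ⟨T, hT, fun lam U₀ hU₀ hr => ?_⟩
  obtain ⟨V₀, hV₀⟩ := exists_bessel_of_sobolevENorm hs hU₀
  obtain rfl : U₀ = sob hs V₀ := funext hV₀
  have hsum : ∑ i, ‖V₀ i‖ ^ 2 ≤ r ^ 2 := by
    rw [← hr, show sobolevENorm s (sob hs V₀) = _ from sobolevENorm_bessel hs V₀,
      ENNReal.toReal_ofReal (Real.sqrt_nonneg _),
      Real.sq_sqrt (Finset.sum_nonneg fun _ _ => sq_nonneg _)]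
  choose V hV0 hV using fun n => h lam n V₀ hsum
  exact exists_isSolution_of_truncated hs hT hV0 (fun n t ht => (hV n t ht).1)
    (fun n t ht => (hV n t ht).2.1) fun n t ht => (hV n t ht).2.2

/-! ### Uniqueness -/

/-- An equation tested against smooth functions may be tested against all of `L²`, if its right-hand
side is bounded in `L²`. -/
theorem inner_eq_integral_of_test {T L : ℝ} {w d : ℝ → L2}
    (hL : ∀ᵐ τ ∂volume.restrict (Set.Icc 0 T), ‖d τ‖ ≤ L)
    (hint : ∀ (η : Plane → ℝ) (hη : IsTest η),
      IntegrableOn (fun τ => inner ℝ (d τ) hη.toL2) (Set.Icc 0 T))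
    (heq : ∀ (η : Plane → ℝ) (hη : IsTest η), ∀ t ∈ Set.Icc 0 T,
      inner ℝ (w t) hη.toL2 = ∫ τ in (0 : ℝ)..t, inner ℝ (d τ) hη.toL2) (ψ : L2) :
    IntegrableOn (fun τ => inner ℝ (d τ) ψ) (Set.Icc 0 T) ∧
      ∀ t ∈ Set.Icc 0 T, inner ℝ (w t) ψ = ∫ τ in (0 : ℝ)..t, inner ℝ (d τ) ψ := by
  obtain ⟨φ, hφ, hlim⟩ := mem_closure_iff_seq_limit.1 (dense_test ψ)
  choose η hη hηφ using hφ
  obtain ⟨B, hB⟩ := hlim.norm.bddAbove_range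
  have hB' : ∀ n, ‖φ n‖ ≤ B := fun n => hB ⟨n, rfl⟩
  have hintφ : ∀ n, IntegrableOn (fun τ => inner ℝ (d τ) (φ n)) (Set.Icc 0 T) := fun n => by
    rw [← hηφ n]; exact hint _ (hη n)
  have hten : ∀ τ, Tendsto (fun n => inner ℝ (d τ) (φ n)) atTop (𝓝 (inner ℝ (d τ) ψ)) := fun τ =>
    tendsto_const_nhds.inner hlim
  refine ⟨?_, fun t ht => ?_⟩
  · refine Integrable.of_bound (aestronglyMeasurable_of_tendsto_ae atTop
      (fun n => (hintφ n).aestronglyMeasurable) (Eventually.of_forall hten)) (L * ‖ψ‖) ?_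
    filter_upwards [hL] with τ hτ
    exact (norm_inner_le_norm _ _).trans (by gcongr)
  · have hsub : Set.uIoc 0 t ⊆ Set.Icc 0 T := by
      rw [Set.uIoc_of_le ht.1]
      exact fun τ hτ => ⟨hτ.1.le, hτ.2.trans ht.2⟩
    have h1 : Tendsto (fun n => ∫ τ in (0 : ℝ)..t, inner ℝ (d τ) (φ n)) atTop
        (𝓝 (∫ τ in (0 : ℝ)..t, inner ℝ (d τ) ψ)) := by
      refine intervalIntegral.tendsto_integral_filter_of_dominated_convergence
        (fun _ => |L| * B) ?_ ?_ intervalIntegrable_const ?_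
      · exact Eventually.of_forall fun n => ((hintφ n).mono_set hsub).aestronglyMeasurable
      · refine Eventually.of_forall fun n => ?_
        filter_upwards [(ae_restrict_iff' measurableSet_Icc).1 hL] with τ hτ hτt
        refine (norm_inner_le_norm _ _).trans ?_
        gcongr
        · exact (hτ (hsub hτt)).trans (le_abs_self L)
        · exact hB' n
      · exact Eventually.of_forall fun τ _ => hten τ
    refine tendsto_nhds_unique (tendsto_const_nhds.inner hlim) (h1.congr fun n => ?_)
    rw [← hηφ n]
    exact (heq _ (hη n) t ht).symm

/-- A path in `L²` that starts at `0` and satisfies an `L²` energy inequality weakly vanishes. Here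
`d` is the derivative of `w`; as `w` is merely Lipschitz, the energy is differentiated by hand. -/
theorem eq_zero_of_weak_energy {T L N : ℝ} (hL0 : 0 ≤ L) (hN : 0 ≤ N) {w d : ℝ → Fin 9 → L2}
    (hw0 : w 0 = 0)
    (hL : ∀ᵐ τ ∂volume.restrict (Set.Icc 0 T), ∀ i, ‖d τ i‖ ≤ L)
    (hE : ∀ᵐ τ ∂volume.restrict (Set.Icc 0 T),
      |∑ i, inner ℝ (w τ i) (d τ i)| ≤ N * ∑ i, ‖w τ i‖ ^ 2)
    (hint : ∀ i, ∀ (η : Plane → ℝ) (hη : IsTest η),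
      IntegrableOn (fun τ => inner ℝ (d τ i) hη.toL2) (Set.Icc 0 T))
    (heq : ∀ i, ∀ (η : Plane → ℝ) (hη : IsTest η), ∀ t ∈ Set.Icc 0 T,
      inner ℝ (w t i) hη.toL2 = ∫ τ in (0 : ℝ)..t, inner ℝ (d τ i) hη.toL2) :
    ∀ t ∈ Set.Icc 0 T, w t = 0 := by
  have hψ := fun i => inner_eq_integral_of_test (w := fun t => w t i) (d := fun t => d t i)
    (hL.mono fun τ h => h i) (hint i) (heq i)
  have hsub : ∀ t ∈ Set.Icc 0 T, ∀ t' ∈ Set.Icc 0 T, t ≤ t' → Set.uIoc t t' ⊆ Set.Icc 0 T := by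
    intro t ht t' ht' htt' τ hτ
    rw [Set.uIoc_of_le htt'] at hτ
    exact ⟨ht.1.trans hτ.1.le, hτ.2.trans ht'.2⟩
  have hii : ∀ i ψ, ∀ t ∈ Set.Icc 0 T, ∀ t' ∈ Set.Icc 0 T, t ≤ t' →
      IntervalIntegrable (fun τ => inner ℝ (d τ i) ψ) volume t t' := fun i ψ t ht t' ht' h =>
    intervalIntegrable_iff.2 (((hψ i ψ).1).mono_set (hsub t ht t' ht' h))
  have hdiff : ∀ i ψ, ∀ t ∈ Set.Icc 0 T, ∀ t' ∈ Set.Icc 0 T, t ≤ t' →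
      inner ℝ (w t' i - w t i) ψ = ∫ τ in t..t', inner ℝ (d τ i) ψ := by
    intro i ψ t ht t' ht' htt'
    have h0 : (0 : ℝ) ∈ Set.Icc 0 T := ⟨le_rfl, ht.1.trans ht.2⟩
    rw [inner_sub_left, (hψ i ψ).2 t ht, (hψ i ψ).2 t' ht',
      intervalIntegral.integral_interval_sub_left (hii i ψ 0 h0 t' ht' ht'.1)
        (hii i ψ 0 h0 t ht ht.1)]
  have hae : ∀ᵐ τ, τ ∈ Set.Icc 0 T → (∀ i, ‖d τ i‖ ≤ L) ∧
      |∑ i, inner ℝ (w τ i) (d τ i)| ≤ N * ∑ i, ‖w τ i‖ ^ 2 :=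
    (ae_restrict_iff' measurableSet_Icc).1 (hL.and hE)
  -- the path is Lipschitz
  have hlip : ∀ i, ∀ t ∈ Set.Icc 0 T, ∀ t' ∈ Set.Icc 0 T, t ≤ t' →
      ‖w t' i - w t i‖ ≤ L * (t' - t) := by
    intro i t ht t' ht' htt'
    set δ := w t' i - w t i with hδ
    have h1 : ‖δ‖ ^ 2 ≤ L * ‖δ‖ * |t' - t| := by
      rw [← real_inner_self_eq_norm_sq]
      refine (le_abs_self _).trans ?_
      rw [show inner ℝ δ δ = _ from hdiff i δ t ht t' ht' htt', ← Real.norm_eq_abs]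
      refine intervalIntegral.norm_integral_le_of_norm_le_const_ae ?_
      filter_upwards [hae] with τ hτ hτt
      refine (norm_inner_le_norm _ _).trans ?_
      gcongr
      exact (hτ (hsub t ht t' ht' htt' hτt)).1 i
    rw [abs_of_nonneg (sub_nonneg.2 htt')] at h1
    by_contra hcon
    rw [not_le] at hcon
    have h2 : 0 < ‖δ‖ := lt_of_le_of_lt (mul_nonneg hL0 (sub_nonneg.2 htt')) hcon
    nlinarith
  set f : ℝ → ℝ := fun t => ∑ i, ‖w t i‖ ^ 2 with hf
  set M : ℝ := 2 * N * (18 * L ^ 2 * T) + 9 * (L * (2 * L)) with hM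
  -- The increment is `∫ ⟨d τ, w t' + w t⟩ dτ`; replacing `w t' + w t` by `2 w τ` costs an error of
  -- first order in `t' - t`, which disappears in the limit `t' → t`.
  have hincr : ∀ t ∈ Set.Icc 0 T, ∀ t' ∈ Set.Icc 0 T, t ≤ t' →
      |f t' - f t| ≤ (4 * N * f t + M * (t' - t)) * (t' - t) := by
    intro t ht t' ht' htt'
    have hh : 0 ≤ t' - t := sub_nonneg.2 htt'
    have hhT : t' - t ≤ T := by linarith [ht'.2, ht.1]
    have e : f t' - f t = ∫ τ in t..t', ∑ i, inner ℝ (d τ i) (w t' i + w t i) := by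
      rw [intervalIntegral.integral_finsetSum fun i _ => hii i _ t ht t' ht' htt', hf]
      simp only [← hdiff _ _ t ht t' ht' htt']
      rw [← Finset.sum_sub_distrib]
      refine Finset.sum_congr rfl fun i _ => ?_
      rw [inner_sub_left, inner_add_right, inner_add_right, real_inner_self_eq_norm_sq,
        real_inner_self_eq_norm_sq, real_inner_comm]
      ring
    rw [e, ← Real.norm_eq_abs]
    have habs : |t' - t| = t' - t := abs_of_nonneg hh
    rw [← habs]
    refine intervalIntegral.norm_integral_le_of_norm_le_const_ae ?_
    rw [habs]
    filter_upwards [hae] with τ hτ hτt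
    obtain ⟨hd, he⟩ := hτ (hsub t ht t' ht' htt' hτt)
    have hτI := hsub t ht t' ht' htt' hτt
    rw [Set.uIoc_of_le htt'] at hτt
    have hfτ : f τ ≤ 2 * f t + 18 * L ^ 2 * T * (t' - t) := by
      have h1 : ∀ i, ‖w τ i‖ ^ 2 ≤ 2 * ‖w t i‖ ^ 2 + 2 * (L ^ 2 * T * (t' - t)) := by
        intro i
        have h2 : ‖w τ i‖ ≤ ‖w t i‖ + L * (t' - t) := by
          have h3 := hlip i t ht τ hτI hτt.1.le
          have h4 : L * (τ - t) ≤ L * (t' - t) := by gcongr; exact hτt.2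
          have h5 := norm_add_le (w t i) (w τ i - w t i)
          rw [add_sub_cancel] at h5
          linarith
        have h6 : (L * (t' - t)) ^ 2 ≤ L ^ 2 * T * (t' - t) := by
          rw [mul_pow, sq (t' - t), ← mul_assoc]
          gcongr
        have h7 : ‖w τ i‖ ^ 2 ≤ (‖w t i‖ + L * (t' - t)) ^ 2 := by gcongr
        nlinarith [sq_nonneg (‖w t i‖ - L * (t' - t))]
      calc f τ ≤ ∑ i, (2 * ‖w t i‖ ^ 2 + 2 * (L ^ 2 * T * (t' - t))) :=
            Finset.sum_le_sum fun i _ => h1 i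
        _ = _ := by
            rw [Finset.sum_add_distrib, ← Finset.mul_sum, hf]
            simp
            ring
    have e2 : ∑ i, inner ℝ (d τ i) (w t' i + w t i) = 2 * ∑ i, inner ℝ (w τ i) (d τ i) +
        ∑ i, inner ℝ (d τ i) ((w t' i - w τ i) + (w t i - w τ i)) := by
      rw [Finset.mul_sum, ← Finset.sum_add_distrib]
      refine Finset.sum_congr rfl fun i _ => ?_
      rw [real_inner_comm (d τ i) (w τ i), inner_add_right, inner_add_right, inner_sub_right,
        inner_sub_right]
      ring
    have h8 : |∑ i, inner ℝ (d τ i) ((w t' i - w τ i) + (w t i - w τ i))| ≤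
        9 * (L * (2 * L * (t' - t))) := by
      refine (Finset.abs_sum_le_sum_abs _ _).trans ?_
      calc _ ≤ ∑ _i : Fin 9, L * (2 * L * (t' - t)) := Finset.sum_le_sum fun i _ => by
            refine (abs_real_inner_le_norm _ _).trans ?_
            gcongr
            · exact hd i
            · refine (norm_add_le _ _).trans ?_
              have h3 := hlip i t ht τ hτI hτt.1.le
              have h4 := hlip i τ hτI t' ht' hτt.2
              rw [norm_sub_rev (w t i)]
              have : 0 ≤ L * (t' - t) := by positivity
              have h5 : L * (t' - τ) + L * (τ - t) = L * (t' - t) := by ring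
              linarith
        _ = _ := by simp
    rw [e2, Real.norm_eq_abs]
    refine (abs_add_le _ _).trans ?_
    rw [abs_mul, abs_of_pos (two_pos : (0 : ℝ) < 2)]
    have h9 : N * f τ ≤ N * (2 * f t + 18 * L ^ 2 * T * (t' - t)) := by gcongr
    change |∑ i, inner ℝ (w τ i) (d τ i)| ≤ N * f τ at he
    rw [hM]
    linarith
  have hfc : ContinuousOn f (Set.Icc 0 T) := by
    refine continuousOn_finsetSum _ fun i _ => ContinuousOn.pow (ContinuousOn.norm ?_) 2
    refine LipschitzOnWith.continuousOn (K := ⟨L, hL0⟩) (LipschitzOnWith.of_dist_le_mul ?_)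
    intro t ht t' ht'
    rw [dist_eq_norm, Real.dist_eq]
    change _ ≤ L * _
    rcases le_total t t' with h | h
    · rw [norm_sub_rev, abs_sub_comm, abs_of_nonneg (sub_nonneg.2 h)]
      exact hlip i t ht t' ht' h
    · rw [abs_of_nonneg (sub_nonneg.2 h)]
      exact hlip i t' ht' t ht h
  intro t ht
  have hg := le_gronwallBound_of_liminf_deriv_right_le (f := f) (f' := fun t => 4 * N * f t)
    (δ := 0) (K := 4 * N) (ε := 0) (a := 0) (b := T) hfc (fun x hx r hr => by
      have hc : Tendsto (fun z : ℝ => 4 * N * f x + M * (z - x)) (𝓝[>] x) (𝓝 (4 * N * f x)) := by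
        have : Continuous fun z : ℝ => 4 * N * f x + M * (z - x) := by fun_prop
        simpa using (this.tendsto x).mono_left nhdsWithin_le_nhds
      refine Eventually.frequently ?_
      filter_upwards [hc.eventually (gt_mem_nhds hr), Ioc_mem_nhdsGT hx.2] with z hz hzT
      have hz0 : 0 < z - x := sub_pos.2 hzT.1
      have := (le_abs_self _).trans (hincr x ⟨hx.1, hx.2.le⟩ z ⟨hx.1.trans hzT.1.le,
          hzT.2⟩ hzT.1.le)
      rw [inv_mul_lt_iff₀ hz0]
      nlinarith) (by simp [hf, hw0]) (fun x _ => by linarith) t ht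
  rw [gronwallBound_ε0_δ0] at hg
  have h1 := (sq_norm_le_sum (w t)).trans hg
  have h2 : ‖w t‖ = 0 := by nlinarith [norm_nonneg (w t)]
  exact norm_eq_zero.1 h2

/-- The coordinates of a solution. They exist and are bounded for almost every time only,
    as the bound
in `H^s` is an essential supremum. -/
theorem IsSolution.exists_sob {s : ℝ} (hs : 2 < s) {lam T : ℝ} {U₀ : Fin 9 → L2} {U : ℝ → Fin 9 →
    L2}
    (h : IsSolution s lam T U₀ U) : ∃ R : ℝ, ∃ V : ℝ → Fin 9 → L2,
      ∀ᵐ τ ∂volume.restrict (Set.Icc 0 T), ‖V τ‖ ≤ R ∧ U τ = sob hs (V τ) := by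
  set M := essSup (fun t => sobolevENorm s (U t)) (volume.restrict (Set.Icc 0 T)) with hM
  have hex : ∀ τ, ∃ V : Fin 9 → L2, sobolevENorm s (U τ) ≤ M →
      ‖V‖ ≤ M.toReal ∧ U τ = sob hs V := by
    intro τ
    by_cases hτ : sobolevENorm s (U τ) ≤ M
    · obtain ⟨V, hV⟩ := exists_bessel_of_sobolevENorm hs (hτ.trans_lt h.bounded)
      have hUV : U τ = sob hs V := funext hV
      refine ⟨V, fun _ => ⟨(norm_le_sqrt_of_sum_le le_rfl).trans ?_, hUV⟩⟩
      rw [hUV, show sobolevENorm s (sob hs V) = _ from sobolevENorm_bessel hs V] at hτ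
      exact (ENNReal.ofReal_le_iff_le_toReal h.bounded.ne).1 hτ
    · exact ⟨0, fun h => absurd h hτ⟩
  choose V hV using hex
  exact ⟨M.toReal, V, by
    filter_upwards [ENNReal.ae_le_essSup fun t => sobolevENorm s (U t)] with τ hτ
    exact hV τ hτ⟩

/-- Two solutions with the same data coincide. -/
theorem IsSolution.unique {s : ℝ} (hs : 2 < s) {lam T : ℝ} {U₀ : Fin 9 → L2} {U U' : ℝ → Fin 9 → L2}
    (h : IsSolution s lam T U₀ U) (h' : IsSolution s lam T U₀ U') :
    ∀ t ∈ Set.Icc 0 T, U t = U' t := by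
  obtain ⟨R₁, V, hV⟩ := IsSolution.exists_sob hs h
  obtain ⟨R₂, V', hV'⟩ := IsSolution.exists_sob hs h'
  set R := max R₁ R₂ with hR
  obtain ⟨L, hL, hbL⟩ := exists_bound_evolution hs lam R
  obtain ⟨N, hN, hbN⟩ := exists_evolution_bound hs lam R
  have hae : ∀ᵐ τ ∂volume.restrict (Set.Icc 0 T), (‖V τ‖ ≤ R ∧ U τ = sob hs (V τ)) ∧
      ‖V' τ‖ ≤ R ∧ U' τ = sob hs (V' τ) := by
    filter_upwards [hV, hV'] with τ h1 h2
    exact ⟨⟨h1.1.trans (le_max_left _ _), h1.2⟩, h2.1.trans (le_max_right _ _), h2.2⟩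
  let d : ℝ → Fin 9 → L2 := fun τ i => evolution hs lam τ (V τ) i - evolution hs lam τ (V' τ) i
  have hd : ∀ (η : Plane → ℝ) (hη : IsTest η) (i : Fin 9),
      (fun τ => weakRHS lam (U τ) τ η i - weakRHS lam (U' τ) τ η i)
        =ᵐ[volume.restrict (Set.Icc 0 T)] fun τ => inner ℝ (d τ i) hη.toL2 := fun η hη i => by
    filter_upwards [hae] with τ hτ
    rw [hτ.1.2, hτ.2.2, weakRHS_sob hs _ _ _ hη, weakRHS_sob hs _ _ _ hη, inner_sub_left]
  have key := eq_zero_of_weak_energy (T := T) (L := 2 * L) (N := N) (by positivity) hN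
    (w := fun t => U t - U' t) (d := d) (by rw [h.initial, h'.initial, sub_self])
    (by
      filter_upwards [hae] with τ hτ i
      refine (norm_sub_le _ _).trans ?_
      linarith [hbL τ _ hτ.1.1 i, hbL τ _ hτ.2.1 i])
    (by
      filter_upwards [hae] with τ hτ
      have e : U τ - U' τ = sob hs (V τ - V' τ) := by
        rw [hτ.1.2, hτ.2.2]; exact funext fun k => (sob_sub hs _ _ k).symm
      rw [e]
      exact hbN τ _ _ hτ.1.1 hτ.2.1)
    (fun i η hη => ((h.equation η hη i).1.sub (h'.equation η hη i).1).congr (hd η hη i))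
    (fun i η hη t ht => by
      have hsub : Set.uIoc 0 t ⊆ Set.Icc 0 T := by
        rw [Set.uIoc_of_le ht.1]
        exact fun τ hτ => ⟨hτ.1.le, hτ.2.trans ht.2⟩
      have h1 : ∫ τ in (0 : ℝ)..t, inner ℝ (d τ i) hη.toL2 =
          ∫ τ in (0 : ℝ)..t, (weakRHS lam (U τ) τ η i - weakRHS lam (U' τ) τ η i) := by
        refine intervalIntegral.integral_congr_ae ?_
        filter_upwards [(ae_restrict_iff' measurableSet_Icc).1 (hd η hη i)] with τ hτ hτt
        exact (hτ (hsub hτt)).symm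
      rw [h1, intervalIntegral.integral_sub
        (intervalIntegrable_iff.2 ((h.equation η hη i).1.mono_set hsub))
        (intervalIntegrable_iff.2 ((h'.equation η hη i).1.mono_set hsub)),
        ← (h.equation η hη i).2 t ht, ← (h'.equation η hη i).2 t ht, Pi.sub_apply, inner_sub_left,
        hη.integral_mul, hη.integral_mul, hη.integral_mul]
      ring)
  intro t ht
  exact sub_eq_zero.1 (key t ht)

end PerturbedZakharov

end

open PerturbedZakharov in
theorem theorem3 (s : ℝ) (hs : 2 < s) :
    ∃ T : ℝ → ℝ, (∀ r, 0 < T r) ∧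
      ∀ (lam : ℝ) (U₀ : Fin 9 → L2), sobolevENorm s U₀ < ⊤ →
        (∃ U : ℝ → Fin 9 → L2, IsSolution s lam (T (sobolevENorm s U₀).toReal) U₀ U) ∧
        ∀ U U' : ℝ → Fin 9 → L2,
          IsSolution s lam (T (sobolevENorm s U₀).toReal) U₀ U →
          IsSolution s lam (T (sobolevENorm s U₀).toReal) U₀ U' →
          ∀ t ∈ Set.Icc 0 (T (sobolevENorm s U₀).toReal), U t = U' t := by
  choose T hT h using exists_local_solution hs
  exact ⟨T, hT, fun lam U₀ hU₀ => ⟨h _ lam U₀ hU₀ rfl,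
    fun _ _ hU hU' => IsSolution.unique hs hU hU'⟩⟩
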